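/- **Model.** Asynchronous crash-prone sequential processes of a finite set $\Pi$ communicate through atomic shared objects; an execution is a finite or infinite sequence of invocations, atomic operations on the shared objects, and responses. An algorithm is *wait-free* if every operation returns after finitely many steps of the process that invoked it, whatever the other processes do. **Lists.** AllowList and DenyList objects have static sets of managers and verifiers and operations APPEND$(x)$, PROVE$(x)$, READ$()$. APPEND is valid iff a manager invokes it. READ returns, in any order, the list of all earlier valid PROVE operations with the names of their invokers. In an AllowList, PROVE$(x)$ is valid iff a verifier invokes it and $x$ is initially listed or was validly appended before. In a DenyList only verifiers have valid PROVE operations; PROVE$(x)$ by a verifier may be invalid only after a valid APPEND$(x)$; once a PROVE$(x)$ of a verifier was invalid, all later PROVE$(x)$ are invalid (anti-flickering); after a valid APPEND$(x)$ there is a point from which all PROVE$(x)$ are invalid (progress). A $k$-DenyList has exactly $k$ verifiers. **Tokens.** $\mathcal W$ is a set of wallets and $\mu(w)\subseteq\Pi$ is the set of processes that can invoke TRANSFER for $w\in\mathcal W$. Each wallet initially owns $v_0\ge 1$ tokens. Cryptography is ideal: a TRANSFER has as arguments a source token $T_O$, the public key $pk_r$ of a recipient and a private key $sk_s$; the deterministic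 local function Pour$(T_O,pk_r,sk_s)$ yields a transaction $tx$ that consists of $T_O$, of a new token $tx.T_R$, owned by the recipient and determined injectively by $T_O$ and $pk_r$, and of a proof, and Verify$(tx)$ holds iff $sk_s$ is the key of the owner of $T_O$. A process uses only private keys of wallets $w$ with $p\in\mu(w)$. The sequential *Anon-AT object* for $\mu$ and $v_0$: TRANSFER$(T_O,pk_r,sk_s)$ by $p$ destroys $T_O$, creates and returns $T_R$ if $p$ serves the wallet of $sk_s$, this wallet owns $T_O$, and $T_O$ exists and is not yet destroyed; otherwise it returns False and changes nothing. It is a *$k$-Anon-AT object* if $\mathcal W$ is finite and $\max_w|\mu(w)|=k$. **Algorithm.** Let $k\ge1$, AL an AllowList that initially lists the initial tokens, and DL an initially empty $k$-DenyList; all sets $\mu(w)$ are contained in the set of the $k$ verifiers of DL, who are also managers of DL and managers and verifiers of AL. AL lists created tokens (no ex-nihilo creation), DL lists spent tokens (no double spending). TRANSFER$(T_O,pk_r,sk_s)$ by $p$ is: compute $tx=$ Pour$(T_O,pk_r,sk_s)$. If Verify$(tx)$, $T_O\in$ AL and $T_O\notin$ DL (tested in this order, membership by means of PROVE), then: AL.PROVE$(T_O)$;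 DL.PROVE$(T_O)$; DL.APPEND$(T_O)$; repeat DL.PROVE$(T_O)$ until it is invalid; if ChooseLeader(DL.READ(), $T_O$) $=p$, then AL.APPEND$(tx.T_R)$ and return $tx.T_R$. In all other cases return False. ChooseLeader is any deterministic function that selects one of the processes that issued a valid DL.PROVE$(T_O)$. **Theorem.** 1. The algorithm wait-free implements anonymous asset transfer. Precisely, every execution has the following properties. (a) *Termination.* It is wait-free. (b) *TRANSFER validity.* One can assign to TRANSFER operations a destruction instant of the source $T_O$ and a later activation instant of $T_R$, such that: at the destruction instant, which follows the invocation, $tx$ is correct and $T_O$ exists (it is initial or already activated) and is not destroyed; no token is destroyed twice; a TRANSFER that returns a token returns its $T_R$ and both instants lie before its response; a TRANSFER that returns False destroyed nothing and either $tx$ is incorrect or, at some instant between invocation and response, $T_O$ was not yet created or already destroyed. (A pending TRANSFER may have destroyed $T_O$ and not have activated $T_R$; if its process crashes, the token is lost.) (c) *Linearizability.* The execution is linearizable with respect to the sequential Anon-AT object, provided that no TRANSFER of a token $T$ is invoked while a TRANSFER (with correct material) that is to create $T$ is pending. (d) *Anonymity.* Publicly visible are all accesses to AL and DL with the names of the processes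 and their outcomes, where a token appears in AL by an opaque commitment $cm(T)$ and in DL by an opaque serial number $sn(T)$ ($cm,sn$ injective), and where proofs of membership in AL hide their commitment; the arguments and the returned token of a TRANSFER are private, its invocation and whether it succeeded are not. Let $p$ invoke a TRANSFER of a token $T$ of a wallet $w$ to a recipient $w'$, with resulting token $T_R$. Let $w_1$ be any wallet with $p\in\mu(w_1)$, $T_1$ any token of $w_1$ and $w_1'$ any recipient, with resulting token $T_{R,1}$. Suppose that $T$ and $T_1$ are initial or were returned by a TRANSFER before, and that no other TRANSFER of the execution uses $T$, $T_1$, $T_R$ or $T_{R,1}$ as its source. Then there are another execution, in which $p$ instead transfers $T_1$ to $w_1'$ while all other TRANSFER invocations and their responses are unchanged, and injective encodings $cm_1$, equal to $cm$ except on $T_R,T_{R,1}$, and $sn_1$, equal to $sn$ except on $T,T_1$, such that the sequences of publicly visible events of the two executions are identical. 2. For every set $X$ with at least two elements, $k$ is the largest $n$ such that consensus on values in $X$ among $n$ processes can be wait-free implemented from atomic read/write registers and (any number of) $k$-Anon-AT objects. That is, $k$-Anon-AT has consensus number $k$. -/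

import Mathlib

/-! # Asynchronous shared memory, AllowList and DenyList objects, anonymous asset transfer -/

namespace AAT

/-! ## Shared objects -/

/-- A sequential history of one shared object: at each instant of a discrete time scale, either
nothing happens to the object, or one process performs one operation and gets its response. -/
abbrev History (Proc Op Res : Type) : Type := ℕ → Option (Proc × Op × Res)

/-- A shared object, specified by the set of its legal sequential histories. -/
structure ObjSpec (Proc : Type) where
  Op : Type
  Res : Type
  Legal : History Proc Op Res → Prop

/-- An object type `(Q, Q₀, O, R, Δ)`. -/
structure ObjType (Proc : Type) where
  State : Type
  initial : Set State
  Op : Type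
  Res : Type
  trans : Proc → State → Op → Res → State → Prop

/-- The legal histories of an object type are those that label a run of its transition relation. -/
def ObjType.toSpec {Proc : Type} (T : ObjType Proc) : ObjSpec Proc where
  Op := T.Op
  Res := T.Res
  Legal h := ∃ σ : ℕ → T.State, σ 0 ∈ T.initial ∧ ∀ t,
    match h t with
    | none => σ (t + 1) = σ t
    | some (p, o, r) => T.trans p (σ t) o r (σ (t + 1))

inductive RegisterOp (X : Type)
  | read
  | write (x : X)

/-- An atomic (multi-writer, multi-reader) read/write register with initial value `x₀`.
A write returns `none`, a read returns the current value. -/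
def register (Proc : Type) {X : Type} (x₀ : X) : ObjType Proc where
  State := X
  initial := {x₀}
  Op := RegisterOp X
  Res := Option X
  trans _ x o r y :=
    match o with
    | .read => r = some x ∧ y = x
    | .write z => r = none ∧ y = z

def IsRegister {Proc : Type} (O : ObjSpec Proc) : Prop :=
  ∃ (X : Type) (x₀ : X), O = (register Proc x₀).toSpec

/-! ## AllowList and DenyList objects -/

inductive ListOp (S : Type)
  | append (x : S)
  | prove (x : S)
  | read

/-- Responses of an AllowList or a DenyList. `ok` answers a valid APPEND or a valid PROVE (the proof
itself is opaque), `fail` is the response `False`, and `proofs l` answers a READ with the list of the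
proofs that were issued, each one with the name of the process that issued it. -/
inductive ListRes (Proc S : Type)
  | ok
  | fail
  | proofs (l : List (Proc × S))

/-- READ validity: a READ returns, in an arbitrary order, the list of the valid PROVE operations
that precede it, with the names of the processes that invoked them. Here `ts` enumerates the times of
these operations. -/
def ReadValid {Proc S : Type} (h : History Proc (ListOp S) (ListRes Proc S)) : Prop :=
  ∀ t p r, h t = some (p, .read, r) → ∃ (l : List (Proc × S)) (ts : List ℕ), r = .proofs l ∧
    ts.Nodup ∧ (∀ u, u ∈ ts ↔ u < t ∧ ∃ q x, h u = some (q, .prove x, .ok)) ∧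
    List.Forall₂ (fun u y => h u = some (y.1, .prove y.2, .ok)) ts l

/-- APPEND validity: an APPEND is valid exactly if a manager invokes it. -/
def AppendValid {Proc S : Type} (managers : Finset Proc)
    (h : History Proc (ListOp S) (ListRes Proc S)) : Prop :=
  ∀ t p x r, h t = some (p, .append x, r) →
    (p ∈ managers → r = .ok) ∧ (p ∉ managers → r = .fail)

/-- The legal histories of an AllowList in which the elements of `S₀` are listed from the start. -/
structure AllowListLegal {Proc S : Type} (managers verifiers : Finset Proc) (S₀ : Set S)
    (h : History Proc (ListOp S) (ListRes Proc S)) : Prop where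
  append_valid : AppendValid managers h
  prove_response : ∀ t p x r, h t = some (p, .prove x, r) → r = .ok ∨ r = .fail
  /-- A PROVE is valid exactly if a verifier invokes it and the element is already listed. -/
  prove_valid : ∀ t p x r, h t = some (p, .prove x, r) →
    (r = .ok ↔ p ∈ verifiers ∧ (x ∈ S₀ ∨ ∃ u < t, ∃ q, h u = some (q, .append x, .ok)))
  read_valid : ReadValid h

def allowList {Proc S : Type} (managers verifiers : Finset Proc) (S₀ : Set S) : ObjSpec Proc where
  Op := ListOp S
  Res := ListRes Proc S
  Legal := AllowListLegal managers verifiers S₀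

/-- The legal histories of a DenyList, initially empty. A PROVE may remain valid for a while after
the APPEND that revokes the element, within the limits set by anti-flickering and progress. -/
structure DenyListLegal {Proc S : Type} (managers verifiers : Finset Proc)
    (h : History Proc (ListOp S) (ListRes Proc S)) : Prop where
  append_valid : AppendValid managers h
  prove_response : ∀ t p x r, h t = some (p, .prove x, r) → r = .ok ∨ r = .fail
  prove_verifier : ∀ t p x, h t = some (p, .prove x, .ok) → p ∈ verifiers
  /-- An invalid PROVE by a verifier is preceded by a valid APPEND of the same element. -/
  prove_valid : ∀ t p x, h t = some (p, .prove x, .fail) →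
    p ∉ verifiers ∨ ∃ u < t, ∃ q, h u = some (q, .append x, .ok)
  /-- After an invalid PROVE by a verifier, every PROVE of the same element is invalid. -/
  anti_flickering : ∀ t p x, p ∈ verifiers → h t = some (p, .prove x, .fail) →
    ∀ u q r, t < u → h u = some (q, .prove x, r) → r = .fail
  /-- After a valid APPEND there is a point from which every PROVE of the element is invalid. -/
  progress : ∀ t p x, h t = some (p, .append x, .ok) →
    ∃ u, ∀ v q r, u ≤ v → h v = some (q, .prove x, r) → r = .fail
  read_valid : ReadValid h

/-- A DenyList object; it is a `k`-DenyList if `verifiers` has `k` elements. -/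
def denyList {Proc : Type} (S : Type) (managers verifiers : Finset Proc) : ObjSpec Proc where
  Op := ListOp S
  Res := ListRes Proc S
  Legal := DenyListLegal managers verifiers

/-! ## Algorithms and their executions -/

/-- What a process does next: one atomic operation on a shared object, whose response determines the
next local state, or the return from the operation that it is executing. -/
inductive Instr {Proc ι : Type} (obj : ι → ObjSpec Proc) (Res Loc : Type)
  | call (i : ι) (o : (obj i).Op) (next : (obj i).Res → Loc)
  | ret (r : Res) (l : Loc)

/-- A deterministic distributed algorithm over the shared objects `obj`, offering the operations `Op`
with responses `Res`: local states, initial ones, the (local) beginning of an operation, and the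
instruction that a process executes in a given local state. -/
structure Algorithm {Proc ι : Type} (obj : ι → ObjSpec Proc) (Op Res : Type) where
  Loc : Type
  start : Proc → Loc
  begin_ : Proc → Op → Loc → Loc
  instr : Proc → Loc → Instr obj Res Loc

inductive Event {Proc ι : Type} (obj : ι → ObjSpec Proc) (Op Res : Type)
  | inv (p : Proc) (o : Op)
  | call (p : Proc) (i : ι) (o : (obj i).Op) (r : (obj i).Res)
  | ret (p : Proc) (r : Res)

/-- The process that takes the step. -/
def Event.proc {Proc ι : Type} {obj : ι → ObjSpec Proc} {Op Res : Type} :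
    Event obj Op Res → Proc
  | .inv p _ => p
  | .call p _ _ _ => p
  | .ret p _ => p

/-- A process is idle, or busy with an operation. -/
inductive Status (Loc : Type)
  | idle (l : Loc)
  | busy (l : Loc)

section Executions

variable {Proc ι : Type} [DecidableEq Proc] {obj : ι → ObjSpec Proc} {Op Res : Type}

/-- The effect of one event (or of none) on the local states. -/
def Algorithm.Step (A : Algorithm obj Op Res) (e : Option (Event obj Op Res))
    (σ τ : Proc → Status A.Loc) : Prop :=
  match e with
  | none => τ = σ
  | some (.inv p o) => ∃ l, σ p = .idle l ∧ τ = Function.update σ p (.busy (A.begin_ p o l))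
  | some (.call p i o r) => ∃ l next, σ p = .busy l ∧ A.instr p l = .call i o next ∧
      τ = Function.update σ p (.busy (next r))
  | some (.ret p r) => ∃ l l₁, σ p = .busy l ∧ A.instr p l = .ret r l₁ ∧
      τ = Function.update σ p (.idle l₁)

/-- An execution, finite (no event from some instant on) or infinite. A process crashes by taking no
more steps. The sub-history of every shared object has to be legal. -/
structure Execution (A : Algorithm obj Op Res) where
  event : ℕ → Option (Event obj Op Res)
  status : ℕ → Proc → Status A.Loc
  status_zero : ∀ p, status 0 p = .idle (A.start p)
  step : ∀ t, A.Step (event t) (status t) (status (t + 1))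
  legal : ∀ i, ∃ h : History Proc (obj i).Op (obj i).Res,
    (∀ t p o r, h t = some (p, o, r) ↔ event t = some (.call p i o r)) ∧ (obj i).Legal h

variable {A : Algorithm obj Op Res}

/-- Process `p` invokes operation `o` at time `s`. Operations of an execution are identified by the
time of their invocation. -/
def Execution.Invokes (E : Execution A) (s : ℕ) (p : Proc) (o : Op) : Prop :=
  E.event s = some (.inv p o)

/-- The operation that `p` invokes at time `s` returns `r` at time `t`. -/
def Execution.Returns (E : Execution A) (s : ℕ) (p : Proc) (t : ℕ) (r : Res) : Prop :=
  (∃ o, E.Invokes s p o) ∧ s < t ∧ E.event t = some (.ret p r) ∧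
    ∀ u r₁, s < u → u < t → E.event u ≠ some (.ret p r₁)

/-- Process `p` takes infinitely many steps. -/
def Execution.TakesInfinitelyManySteps (E : Execution A) (p : Proc) : Prop :=
  {t | ∃ e, E.event t = some e ∧ e.proc = p}.Infinite

/-- Every operation returns after finitely many steps of the process that invoked it, unless that
process crashes, whatever the other processes do. -/
def Execution.WaitFree (E : Execution A) : Prop :=
  ∀ s p o, E.Invokes s p o → E.TakesInfinitelyManySteps p → ∃ t r, E.Returns s p t r

end Executions

/-- Linearizability with respect to the sequential object `T`: there is a legal sequential history
`S` which consists of all completed operations, with the responses they got, and of some of the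
pending ones, completed with some response, and which respects the real-time order.
`pos s` is the position in `S` of the operation invoked at time `s`. -/
def Execution.Linearizable {Proc ι : Type} [DecidableEq Proc] {obj : ι → ObjSpec Proc}
    (T : ObjSpec Proc) {A : Algorithm obj T.Op T.Res} (E : Execution A) : Prop :=
  ∃ (S : History Proc T.Op T.Res) (pos : ℕ → Option ℕ),
    T.Legal S ∧
    (∀ s n, pos s = some n → ∃ p o r, E.Invokes s p o ∧ S n = some (p, o, r) ∧
      ∀ t r₁, E.Returns s p t r₁ → r₁ = r) ∧
    (∀ s p t r, E.Returns s p t r → ∃ n, pos s = some n) ∧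
    (∀ n x, S n = some x → ∃ s, pos s = some n) ∧
    (∀ s₁ s₂ n, pos s₁ = some n → pos s₂ = some n → s₁ = s₂) ∧
    (∀ s₁ s₂ p t r n₁ n₂, E.Returns s₁ p t r → t < s₂ → pos s₁ = some n₁ → pos s₂ = some n₂ →
      n₁ < n₂)

/-! ## Consensus -/

/-- The algorithm solves (one-shot) consensus: in every execution in which each process proposes at
most once, termination, agreement and validity hold. -/
def Algorithm.SolvesConsensus {Proc ι : Type} [DecidableEq Proc] {obj : ι → ObjSpec Proc} {X : Type}
    (A : Algorithm obj X X) : Prop :=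
  ∀ E : Execution A,
    (∀ s₁ s₂ p x₁ x₂, E.Invokes s₁ p x₁ → E.Invokes s₂ p x₂ → s₁ = s₂) →
    E.WaitFree ∧
    (∀ t₁ t₂ p₁ p₂ x₁ x₂, E.event t₁ = some (.ret p₁ x₁) → E.event t₂ = some (.ret p₂ x₂) →
      x₁ = x₂) ∧
    (∀ t p x, E.event t = some (.ret p x) → ∃ s < t, ∃ q, E.Invokes s q x)

/-- Consensus on values in `X` among `n` processes can be wait-free implemented from read/write
registers and from objects that belong to the class `C`, any number of each. -/
def ConsensusSolvable (X : Type) (n : ℕ) (C : ObjSpec (Fin n) → Prop) : Prop :=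
  ∃ (ι : Type) (obj : ι → ObjSpec (Fin n)) (A : Algorithm obj X X),
    (∀ i, IsRegister (obj i) ∨ C (obj i)) ∧ A.SolvesConsensus

/-! ## Tokens and the anonymous asset transfer object -/

/-- Tokens of the wallets `W`, with idealized cryptography: the `i`-th initial token of a wallet, or
the token created by spending `src` in favour of a recipient. -/
inductive Token (W : Type)
  | mint (w : W) (i : ℕ)
  | out (src : Token W) (recipient : W)

/-- The wallet whose private key is needed to spend the token. -/
def Token.owner {W : Type} : Token W → W
  | .mint w _ => w
  | .out _ w => w

/-- Each wallet initially holds `v₀` tokens. -/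
def initialTokens (W : Type) (v₀ : ℕ) : Set (Token W) := {T | ∃ w, ∃ i < v₀, T = .mint w i}

/-- The arguments `(T_O, pk_r, sk_s)` of TRANSFER. A public or private key is represented by the
wallet it belongs to. -/
structure TransferOp (W : Type) where
  source : Token W
  recipient : W
  key : W

/-- The material to destroy the token `source` and to create the token `created`. -/
structure Tx (W : Type) where
  source : Token W
  created : Token W
  key : W

/-- The local function Pour: it only computes the material of the transaction. -/
def pour {W : Type} (o : TransferOp W) : Tx W := ⟨o.source, .out o.source o.recipient, o.key⟩

/-- The material is correct: it was computed with the private key of the owner of the source. -/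
def Tx.Verify {W : Type} (tx : Tx W) : Prop := tx.key = tx.source.owner

/-- The (sequential) Anonymous Asset Transfer object type. `μ w` is the set of processes that can
invoke TRANSFER on behalf of `w`. A state consists of the tokens created and of the tokens destroyed
so far. A TRANSFER that is valid returns the new token, any other one returns `none` (`False`). -/
def anonAT {Proc W : Type} (μ : W → Finset Proc) (v₀ : ℕ) : ObjType Proc where
  State := Set (Token W) × Set (Token W)
  initial := {(initialTokens W v₀, ∅)}
  Op := TransferOp W
  Res := Option (Token W)
  trans p q o r q₁ :=
    let valid := p ∈ μ o.key ∧ (pour o).Verify ∧ o.source ∈ q.1 ∧ o.source ∉ q.2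
    (valid ∧ r = some (pour o).created ∧
      q₁ = (insert (pour o).created q.1, insert o.source q.2)) ∨
    (¬ valid ∧ r = none ∧ q₁ = q)

/-- A `k`-Anon-AT object: `k` is the size of the biggest `μ w`. -/
def IsKAnonAT {Proc : Type} (k v₀ : ℕ) (O : ObjSpec Proc) : Prop :=
  ∃ (W : Type) (_ : Finite W) (μ : W → Finset Proc),
    (∀ w, (μ w).card ≤ k) ∧ (∃ w, (μ w).card = k) ∧ O = (anonAT μ v₀).toSpec

/-! ## The algorithm -/

/-- The two shared objects of the algorithm. -/
inductive Base
  | allow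
  | deny

/-- The parameters: the owner map, the initial number of tokens per wallet, the managers and
verifiers of the two lists, and the deterministic choice among the candidate leaders. -/
structure Params (Proc W : Type) where
  μ : W → Finset Proc
  v₀ : ℕ
  allowManagers : Finset Proc
  allowVerifiers : Finset Proc
  denyManagers : Finset Proc
  denyVerifiers : Finset Proc
  choose : Finset Proc → Proc

/-- The DenyList is a `k`-DenyList, the processes that act for wallets are among its verifiers and
have access to all the operations they need, and the choice function chooses an element of its
argument. -/
structure Params.Admissible {Proc W : Type} (P : Params Proc W) (k : ℕ) : Prop where
  card_verifiers : P.denyVerifiers.card = k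
  serves : ∀ w, P.μ w ⊆ P.denyVerifiers
  denyManagers : P.denyVerifiers ⊆ P.denyManagers
  allowVerifiers : P.denyVerifiers ⊆ P.allowVerifiers
  allowManagers : P.denyVerifiers ⊆ P.allowManagers
  choose_mem : ∀ s : Finset Proc, s.Nonempty → P.choose s ∈ s

/-- AL is an AllowList that lists the initial tokens, DL is an empty DenyList. -/
def Params.obj {Proc W : Type} (P : Params Proc W) : Base → ObjSpec Proc
  | .allow => allowList P.allowManagers P.allowVerifiers (initialTokens W P.v₀)
  | .deny => denyList (Token W) P.denyManagers P.denyVerifiers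

open Classical in
/-- ChooseLeader: a deterministic choice among the processes that, according to the response `r` to
a READ of the DenyList, issued a valid proof for the token `T`. -/
noncomputable def chooseLeader {Proc W : Type} [Fintype Proc] (choose : Finset Proc → Proc)
    (r : ListRes Proc (Token W)) (T : Token W) : Proc :=
  match r with
  | .proofs l => choose (Finset.univ.filter fun q => (q, T) ∈ l)
  | _ => choose ∅

/-- Program points of TRANSFER. -/
inductive Line (W : Type)
  | ready
  | testAllow (tx : Tx W)
  | testDeny (tx : Tx W)
  | proveAllow (tx : Tx W)
  | proveDeny (tx : Tx W)
  | appendDeny (tx : Tx W)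
  | loop (tx : Tx W)
  | elect (tx : Tx W)
  | appendAllow (tx : Tx W)
  | done (r : Option (Token W))

open Classical in
/-- The algorithm. A process tests `tx ∈ AL` and `tx ∉ DL`, in this order, by the operation that
reports it, PROVE.
```
TRANSFER(T_O, pk_r, sk_s):
  tx ← Pour(T_O, pk_r, sk_s)
  if Verify(tx) and tx ∈ AL and tx ∉ DL then
    AL.PROVE(tx)
    DL.PROVE(tx)
    DL.APPEND(tx)
    do ret ← DL.PROVE(tx) while ret ≠ False
    if ChooseLeader(DL.READ(), tx) = p then
      AL.APPEND(tx.created)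
      return tx.created
  return False
``` -/
noncomputable def transferAlgorithm {Proc W : Type} [Fintype Proc] (P : Params Proc W) :
    Algorithm P.obj (TransferOp W) (Option (Token W)) where
  Loc := Line W
  start _ := .ready
  begin_ _ o _ := if (pour o).Verify then .testAllow (pour o) else .done none
  instr p l :=
    match l with
    | .ready => .ret none .ready
    | .testAllow tx => .call .allow (ListOp.prove tx.source) fun r : ListRes Proc (Token W) =>
        match r with
        | .ok => .testDeny tx
        | _ => .done none
    | .testDeny tx => .call .deny (ListOp.prove tx.source) fun r : ListRes Proc (Token W) =>
        match r with
        | .ok => .proveAllow tx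
        | _ => .done none
    | .proveAllow tx => .call .allow (ListOp.prove tx.source) fun _ => .proveDeny tx
    | .proveDeny tx => .call .deny (ListOp.prove tx.source) fun _ => .appendDeny tx
    | .appendDeny tx => .call .deny (ListOp.append tx.source) fun _ => .loop tx
    | .loop tx => .call .deny (ListOp.prove tx.source) fun r : ListRes Proc (Token W) =>
        match r with
        | .fail => .elect tx
        | _ => .loop tx
    | .elect tx => .call .deny ListOp.read fun r : ListRes Proc (Token W) =>
        if chooseLeader P.choose r tx.source = p then .appendAllow tx else .done none
    | .appendAllow tx => .call .allow (ListOp.append tx.created) fun _ => .done (some tx.created)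
    | .done r => .ret r .ready

/-! ## Correctness of the algorithm -/

section Correctness

variable {Proc W : Type} [Fintype Proc] [DecidableEq Proc] {P : Params Proc W}

/-- A process uses only the private keys of the wallets it acts for. -/
def Authorized (E : Execution (transferAlgorithm P)) : Prop :=
  ∀ s p o, E.Invokes s p o → p ∈ P.μ o.key

/-- Just before time `n`, the token `T` exists and is unspent, if the TRANSFER invoked at time `s`
destroys its source at time `d s` and activates the token it creates at time `a s` (`⊤`: never). -/
def Live (E : Execution (transferAlgorithm P)) (d a : ℕ → ℕ∞) (T : Token W) (n : ℕ) : Prop :=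
  (T ∈ initialTokens W P.v₀ ∨ ∃ s p o, E.Invokes s p o ∧ (pour o).created = T ∧ a s < n) ∧
  ∀ s p o, E.Invokes s p o → o.source = T → ¬ d s < n

/-- TRANSFER validity. Each TRANSFER destroys its source at most once, at an instant between its
invocation and its response at which the source exists and is unspent; no token is destroyed twice.
A TRANSFER returns the new token exactly if it destroyed the source and then activated the new token.
One that returns `False` destroyed nothing, and its material was incorrect or else its source
was not yet created or already spent at some instant between invocation and response. A pending
TRANSFER may have destroyed its source without having activated the new token. -/
def TransferValidity (E : Execution (transferAlgorithm P)) : Prop :=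
  ∃ d a : ℕ → ℕ∞, ∀ s p o, E.Invokes s p o →
    d s ≤ a s ∧
    (∀ n : ℕ, d s = n → s < n ∧ (pour o).Verify ∧ Live E d a o.source n) ∧
    (∀ s₁ p₁ o₁, E.Invokes s₁ p₁ o₁ → o₁.source = o.source → d s ≠ ⊤ → d s₁ ≠ ⊤ → s₁ = s) ∧
    (∀ t T, E.Returns s p t (some T) → T = (pour o).created ∧ a s < t) ∧
    (∀ t, E.Returns s p t none →
      d s = ⊤ ∧ ((pour o).Verify → ∃ n : ℕ, s < n ∧ n ≤ t ∧ ¬ Live E d a o.source n))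

/-- No TRANSFER of a token is invoked while a TRANSFER that is to create this token is pending. -/
def NoSpendingInFlight (E : Execution (transferAlgorithm P)) : Prop :=
  ∀ s₁ p₁ o₁ s₂ p₂ o₂, E.Invokes s₁ p₁ o₁ → E.Invokes s₂ p₂ o₂ → s₁ < s₂ →
    (pour o₁).Verify → (pour o₁).created = o₂.source → ∃ t r, t < s₂ ∧ E.Returns s₁ p₁ t r

/-! ### Anonymity -/

def ListOp.map {S S₁ : Type} (f : S → S₁) : ListOp S → ListOp S₁
  | .append x => .append (f x)
  | .prove x => .prove (f x)
  | .read => .read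

def ListRes.map {S S₁ : Type} (f : S → S₁) : ListRes Proc S → ListRes Proc S₁
  | .ok => .ok
  | .fail => .fail
  | .proofs l => .proofs (l.map fun x => (x.1, f x.2))

/-- What is publicly visible of one event; `none` stands for a value hidden by a zero-knowledge
proof. -/
inductive PublicEvent (Proc H : Type)
  | inv (p : Proc)
  | allow (p : Proc) (o : ListOp (Option H)) (r : ListRes Proc (Option H))
  | deny (p : Proc) (o : ListOp H) (r : ListRes Proc H)
  | ret (p : Proc) (success : Bool)

/-- What is appended to the AllowList is visible, what is proven about it is not. -/
def hideProven {H S : Type} (cm : S → H) : ListOp S → ListOp (Option H)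
  | .append x => .append (some (cm x))
  | .prove _ => .prove none
  | .read => .read

/-- The public part of an event. Every access to a shared object is public, with the name of the
process and with the opaque values involved: a token appears in the AllowList as its commitment
`cm T` and in the DenyList as its serial number `sn T`, and the proofs of membership in the AllowList
hide the commitment. The arguments and the result of a TRANSFER are private. -/
def publicEvent {H : Type} (cm sn : Token W → H) :
    Event P.obj (TransferOp W) (Option (Token W)) → PublicEvent Proc H
  | .inv p _ => .inv p
  | .call p .allow o r => .allow p (hideProven cm o) (ListRes.map (fun _ : Token W => none) r)
  | .call p .deny o r => .deny p (ListOp.map sn o) (ListRes.map sn r)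
  | .ret p r => .ret p r.isSome

/-- The token is one of the initial ones, or it was returned by a TRANSFER before time `s`. -/
def ExistsBefore (E : Execution (transferAlgorithm P)) (T : Token W) (s : ℕ) : Prop :=
  T ∈ initialTokens W P.v₀ ∨ ∃ t < s, ∃ q, E.event t = some (.ret q (some T))

/-- Anonymity of the TRANSFER operation `o` that `p` invokes at time `s`. For every wallet of the
anonymity set of `p`, that is the owner `o₁.key` of some other token, and for every
other recipient, there is an execution in which `p` instead performs the TRANSFER `o₁` of that
token to that recipient, while all other TRANSFER operations, and their responses, are unchanged, and
which looks the same to everybody: the public events are the same if the unknown encodings of the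
tokens differ, and the encodings need differ only for the commitments of the two created tokens and
for the serial numbers of the two sources.
The four tokens involved are not used as a source by another TRANSFER. -/
def Anonymous (E : Execution (transferAlgorithm P)) : Prop :=
  ∀ (s : ℕ) (p : Proc) (o o₁ : TransferOp W), E.Invokes s p o → (pour o).Verify →
    (pour o₁).Verify → p ∈ P.μ o₁.key →
    ExistsBefore E o.source s → ExistsBefore E o₁.source s →
    (∀ s₂ q o₂, E.Invokes s₂ q o₂ → s₂ ≠ s → o₂.source ≠ o.source ∧ o₂.source ≠ o₁.source ∧
      o₂.source ≠ (pour o).created ∧ o₂.source ≠ (pour o₁).created) →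
    ∀ (H : Type) (cm sn : Token W → H), Function.Injective cm → Function.Injective sn →
    ∃ (E₁ : Execution (transferAlgorithm P)) (cm₁ sn₁ : Token W → H),
      Authorized E₁ ∧ E₁.Invokes s p o₁ ∧
      (∀ t q o₂, t ≠ s → (E₁.Invokes t q o₂ ↔ E.Invokes t q o₂)) ∧
      (∀ t q r, (∀ r₁, ¬ E.Returns s p t r₁) →
        (E₁.event t = some (.ret q r) ↔ E.event t = some (.ret q r))) ∧
      (∀ t, (E₁.event t).map (publicEvent cm₁ sn₁) = (E.event t).map (publicEvent cm sn)) ∧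
      Function.Injective cm₁ ∧ Function.Injective sn₁ ∧
      (∀ T, T ≠ (pour o).created → T ≠ (pour o₁).created → cm₁ T = cm T) ∧
      (∀ T, T ≠ o.source → T ≠ o₁.source → sn₁ T = sn T)

end Correctness

end AAT

/-!
# Anonymous asset transfer and its consensus number

**The algorithm is correct.** For a token `T`, consider the first invalid `DL.PROVE(T)` of a
verifier. By anti-flickering no proof for `T` is valid afterwards, so that from this instant on the
set of the processes with a valid proof is fixed, and all processes that leave the loop elect the same
one among them, `leader`. Its TRANSFER destroys `T` at this instant (`DestroysAt`) and activates the
new token when it appends it to the AllowList (`ActivatesAt`). The leader has only one such TRANSFER: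
a second one would begin after the return of the first one, when `T` is already revoked
(`DestroysAt.unique_source`). A TRANSFER that returns `False` has used incorrect material, or did not
find its source on the AllowList, or its source was destroyed before (`returns_none`). This gives
`transferValidity`.
Termination (`waitFree`) comes from the progress property of the DenyList.

For `linearizable`, a TRANSFER that destroys its source is placed at the destruction, even though the
new token is activated later. The remaining ones are placed at their response if their
source was destroyed before, and at their invocation otherwise. An operation of the last kind that
failed to find its source on the AllowList could only be valid in the sequential object if its source
were created by a TRANSFER that is still pending; this is what `NoSpendingInFlight` excludes.

For `anonymous`, the execution is renamed: the two source tokens are exchanged in all accesses to the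
DenyList and all membership proofs, the two created tokens in all appends to the AllowList. The
opposite exchange of the encodings makes the change invisible. The DenyList treats all elements
alike (`DenyListLegal.rename`); in the AllowList, the membership proofs keep their outcomes because
both sources existed from the beginning of the operation.

**The consensus number.** For `k` processes (`tokenConsensus`), all of them serve all wallets of one
object. Each one publishes its proposal and then tries to transfer, to its own wallet, first a fixed
token, then all tokens that come from it by one transfer, and so on. These transfers form a chain to
which each process contributes at most one link, so every process succeeds at depth less than `k`,
and the token that it then holds shows who came first.

More than `k` processes cannot reach consensus (`not_consensusSolvable`), by a bivalence argument: if
every step from a bivalent configuration led to a univalent one, then two processes whose steps have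
different outcomes could be found such that either their steps commute or the first one's step goes
unnoticed by the second one. For an Anon-AT object this holds because an invalid TRANSFER has no
effect, valid ones of different tokens commute, and more than `k` processes cannot all be entitled to
spend the same token (`anonATImpl_weak`). Hence a bivalent configuration always has a bivalent
successor (`exists_bivalent_step`), and some process runs forever without deciding.
-/

namespace AAT

/-! ### Executions of arbitrary algorithms -/

section Generic

variable {Proc ι : Type} [DecidableEq Proc] {obj : ι → ObjSpec Proc} {Op Res : Type}
  {A : Algorithm obj Op Res}

namespace Execution

/-- Just before time `t`, the operation `o` that `p` invoked at time `s` has not yet returned. -/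
def Pending (E : Execution A) (s : ℕ) (p : Proc) (o : Op) (t : ℕ) : Prop :=
  E.Invokes s p o ∧ s < t ∧ ∀ u r, s < u → u < t → E.event u ≠ some (.ret p r)

theorem returns_iff (E : Execution A) {s p t r} :
    E.Returns s p t r ↔ ∃ o, E.Pending s p o t ∧ E.event t = some (.ret p r) := by
  unfold Returns Pending; grind

theorem status_of_inv (E : Execution A) {t p o} (h : E.event t = some (.inv p o)) :
    ∃ l, E.status t p = .idle l ∧ E.status (t + 1) p = .busy (A.begin_ p o l) := by
  have := E.step t
  rw [h] at this
  obtain ⟨l, h1, h2⟩ := this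
  exact ⟨l, h1, by rw [h2]; simp⟩

theorem status_of_call (E : Execution A) {t p i o r} (h : E.event t = some (.call p i o r)) :
    ∃ l next, E.status t p = .busy l ∧ A.instr p l = .call i o next ∧
      E.status (t + 1) p = .busy (next r) := by
  have := E.step t
  rw [h] at this
  obtain ⟨l, next, h1, h3, h2⟩ := this
  exact ⟨l, next, h1, h3, by rw [h2]; simp⟩

theorem status_of_ret (E : Execution A) {t p r} (h : E.event t = some (.ret p r)) :
    ∃ l l₁, E.status t p = .busy l ∧ A.instr p l = .ret r l₁ ∧
      E.status (t + 1) p = .idle l₁ := by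
  have := E.step t
  rw [h] at this
  obtain ⟨l, next, h1, h3, h2⟩ := this
  exact ⟨l, next, h1, h3, by rw [h2]; simp⟩

theorem status_of_ne (E : Execution A) {t p} (h : ∀ e, E.event t = some e → e.proc ≠ p) :
    E.status (t + 1) p = E.status t p := by
  have := E.step t
  cases he : E.event t with
  | none => rw [he] at this; exact congrFun this p
  | some e =>
    have hp := h e he
    rw [he] at this
    cases e with
    | inv q o => obtain ⟨l, -, h2⟩ := this; rw [h2]; exact Function.update_of_ne (Ne.symm hp) _ _
    | call q i o r => obtain ⟨l, _, -, -, h2⟩ := this; rw [h2]; exact Function.update_of_ne (Ne.symm hp) _ _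
    | ret q r => obtain ⟨l, _, -, -, h2⟩ := this; rw [h2]; exact Function.update_of_ne (Ne.symm hp) _ _

/-- From the point of view of one process, each instant brings one of its own events or nothing. -/
theorem event_cases (E : Execution A) (t : ℕ) (p : Proc) :
    (∀ e, E.event t = some e → e.proc ≠ p) ∨ (∃ o, E.event t = some (.inv p o)) ∨
      (∃ i o r, E.event t = some (.call p i o r)) ∨ ∃ r, E.event t = some (.ret p r) := by
  by_cases h : ∀ e, E.event t = some e → e.proc ≠ p
  · exact .inl h
  · push Not at h
    obtain ⟨e, he, rfl⟩ := h
    cases e with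
    | inv q o => exact .inr (.inl ⟨o, he⟩)
    | call q i o r => exact .inr (.inr (.inl ⟨i, o, r, he⟩))
    | ret q r => exact .inr (.inr (.inr ⟨r, he⟩))

/-- Induction along one operation: a property of time and local state that holds when the operation
begins and is kept by every instant holds as long as the operation is pending. -/
theorem pending_induction (E : Execution A) {s : ℕ} {p : Proc} {o : Op} {M : ℕ → A.Loc → Prop}
    (hstart : ∀ l, M (s + 1) (A.begin_ p o l))
    (hmono : ∀ t l, s < t → (∀ e, E.event t = some e → e.proc ≠ p) → M t l → M (t + 1) l)
    (hcall : ∀ t l i op next r, E.Pending s p o t → E.status t p = .busy l →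
      A.instr p l = .call i op next → E.event t = some (.call p i op r) → M t l →
      M (t + 1) (next r))
    (t : ℕ) (h : E.Pending s p o t) : ∃ l, E.status t p = .busy l ∧ M t l := by
  induction t with
  | zero => exact absurd h.2.1 (by omega)
  | succ t ih =>
    obtain ⟨hi, hlt, hr⟩ := h
    rcases Nat.lt_succ_iff_lt_or_eq.mp hlt with hst | rfl
    · have hP : E.Pending s p o t := ⟨hi, hst, fun u r h1 h2 => hr u r h1 (by omega)⟩
      obtain ⟨l, hl, hM⟩ := ih hP
      rcases E.event_cases t p with h1 | ⟨o', h1⟩ | ⟨i, o', r, h1⟩ | ⟨r, h1⟩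
      · exact ⟨l, by rw [E.status_of_ne h1, hl], hmono t l hst h1 hM⟩
      · obtain ⟨l', h2, -⟩ := E.status_of_inv h1
        rw [hl] at h2; cases h2
      · obtain ⟨l', next, h2, h3, h4⟩ := E.status_of_call h1
        rw [hl] at h2; cases h2
        exact ⟨_, h4, hcall t l i o' next r hP hl h3 h1 hM⟩
      · exact absurd h1 (hr t r hst (by omega))
    · obtain ⟨l, -, h2⟩ := E.status_of_inv hi
      exact ⟨_, h2, hstart l⟩

theorem Pending.busy {E : Execution A} {s p o t} (h : E.Pending s p o t) :
    ∃ l, E.status t p = .busy l := by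
  obtain ⟨l, hl, -⟩ := E.pending_induction (M := fun _ _ => True) (fun _ => trivial)
    (fun _ _ _ _ _ => trivial) (fun _ _ _ _ _ _ _ _ _ _ _ => trivial) t h
  exact ⟨l, hl⟩

theorem Pending.mono {E : Execution A} {s p o t u} (h : E.Pending s p o t) (hs : s < u)
    (hu : u ≤ t) : E.Pending s p o u :=
  ⟨h.1, hs, fun v r h1 h2 => h.2.2 v r h1 (by omega)⟩

theorem exists_pending_of_busy (E : Execution A) {p t l} (h : E.status t p = .busy l) :
    ∃ s o, E.Pending s p o t := by
  induction t generalizing l with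
  | zero => rw [E.status_zero] at h; cases h
  | succ t ih =>
    have key : ∀ l', E.status t p = .busy l' → (∀ r, E.event t ≠ some (.ret p r)) →
        ∃ s o, E.Pending s p o (t + 1) := by
      intro l' hl' hr
      obtain ⟨s, o, h1, h2, h3⟩ := ih hl'
      refine ⟨s, o, h1, by omega, fun u r hu hu' => ?_⟩
      rcases Nat.lt_succ_iff_lt_or_eq.mp hu' with h4 | rfl
      · exact h3 u r hu h4
      · exact hr r
    rcases E.event_cases t p with h1 | ⟨o', h1⟩ | ⟨i, o', r, h1⟩ | ⟨r, h1⟩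
    · refine key l (by rw [← E.status_of_ne h1, h]) fun r hr => h1 _ hr rfl
    · exact ⟨t, o', h1, by omega, fun u r hu hu' => by omega⟩
    · obtain ⟨l', next, h2, -⟩ := E.status_of_call h1
      exact key l' h2 fun r hr => by rw [h1] at hr; cases hr
    · obtain ⟨l', next, -, -, h2⟩ := E.status_of_ret h1
      rw [h] at h2; cases h2

theorem Pending.not_invokes {E : Execution A} {s p o t o'} (h : E.Pending s p o t) :
    ¬ E.Invokes t p o' := by
  intro hi
  obtain ⟨l, hl⟩ := h.busy
  obtain ⟨l', hl', -⟩ := E.status_of_inv hi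
  rw [hl] at hl'; cases hl'

theorem Pending.unique {E : Execution A} {s₁ s₂ p o₁ o₂ t} (h₁ : E.Pending s₁ p o₁ t)
    (h₂ : E.Pending s₂ p o₂ t) : s₁ = s₂ := by
  rcases lt_trichotomy s₁ s₂ with h | h | h
  · exact absurd h₂.1 (h₁.mono h h₂.2.1.le).not_invokes
  · exact h
  · exact absurd h₁.1 (h₂.mono h h₁.2.1.le).not_invokes

theorem Invokes.unique {E : Execution A} {s p o p' o'} (h₁ : E.Invokes s p o)
    (h₂ : E.Invokes s p' o') : p = p' ∧ o = o' := by
  unfold Invokes at h₁ h₂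
  rw [h₁] at h₂
  cases h₂
  exact ⟨rfl, rfl⟩

theorem Pending.unique_op {E : Execution A} {s₁ s₂ p o₁ o₂ t} (h₁ : E.Pending s₁ p o₁ t)
    (h₂ : E.Pending s₂ p o₂ t) : o₁ = o₂ := by
  have := h₁.unique h₂
  subst this
  exact (Invokes.unique h₁.1 h₂.1).2

/-- If a process invokes two operations, then the first one returns before the second begins. -/
theorem exists_returns_between (E : Execution A) {s₁ s₂ p o₁ o₂} (h₁ : E.Invokes s₁ p o₁)
    (h₂ : E.Invokes s₂ p o₂) (h : s₁ < s₂) : ∃ t r, t < s₂ ∧ E.Returns s₁ p t r := by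
  by_contra hc
  push Not at hc
  have : ∀ t, s₁ < t → t ≤ s₂ → E.Pending s₁ p o₁ t := by
    intro t
    induction t using Nat.strong_induction_on with
    | _ t ih =>
      intro h3 h4
      refine ⟨h₁, h3, fun u r hu hu' he => ?_⟩
      exact hc u r (by omega) (E.returns_iff.2 ⟨o₁, ih u hu' hu (by omega), he⟩)
  exact (this s₂ h le_rfl).not_invokes h₂

theorem pending_of_not_returns (E : Execution A) {s p o} (hi : E.Invokes s p o)
    (hc : ∀ t r, ¬ E.Returns s p t r) (t : ℕ) (hst : s < t) : E.Pending s p o t := by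
  induction t using Nat.strong_induction_on with
  | _ t ih =>
    exact ⟨hi, hst, fun u r h1 h2 he => hc u r (E.returns_iff.2 ⟨o, ih u h2 h1, he⟩)⟩

/-- A criterion for termination: no access to an object increases the rank of the local state, and
no rank is kept by infinitely many accesses. -/
theorem exists_returns_of_rank (E : Execution A) {s p o} (hi : E.Invokes s p o)
    (hinf : E.TakesInfinitelyManySteps p) (rank : A.Loc → ℕ)
    (hle : ∀ t l i op next r, E.Pending s p o t → E.status t p = .busy l →
      A.instr p l = .call i op next → E.event t = some (.call p i op r) → rank (next r) ≤ rank l)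
    (hlt : ∀ n, ∃ u, ∀ t ≥ u, ∀ l i op next r, E.Pending s p o t → E.status t p = .busy l →
      A.instr p l = .call i op next → E.event t = some (.call p i op r) → rank l = n →
      rank (next r) < n) :
    ∃ t r, E.Returns s p t r := by
  by_contra hc
  push Not at hc
  have hPd := E.pending_of_not_returns hi hc
  have hret : ∀ t r, s < t → E.event t ≠ some (.ret p r) := fun t r hst =>
    (hPd (t + 1) (by omega)).2.2 t r hst (by omega)
  have hmono : ∀ t t', s < t → t ≤ t' → ∀ l l', E.status t p = .busy l →
      E.status t' p = .busy l' → rank l' ≤ rank l := by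
    intro t t' hst htt'
    induction t', htt' using Nat.le_induction with
    | base => intro l l' h1 h2; rw [h1] at h2; cases h2; rfl
    | succ t' htt' ih =>
      intro l l' h1 h2
      rcases E.event_cases t' p with h3 | ⟨o', h3⟩ | ⟨i, op, r, h3⟩ | ⟨r, h3⟩
      · rw [E.status_of_ne h3] at h2
        exact ih l l' h1 h2
      · exact absurd h3 (hPd t' (by omega)).not_invokes
      · obtain ⟨l₁, next, h4, h5, h6⟩ := E.status_of_call h3
        rw [h2] at h6
        cases h6
        exact (hle t' l₁ i op next r (hPd t' (by omega)) h4 h5 h3).trans (ih l l₁ h1 h4)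
      · exact absurd h3 (hret t' r (by omega))
  have hmain : ∀ n t, s < t → ∀ l, E.status t p = .busy l → rank l = n → False := by
    intro n
    induction n using Nat.strong_induction_on with
    | _ n ih =>
      intro t hst l hl hn
      obtain ⟨u, hu⟩ := hlt n
      obtain ⟨t', ⟨e, he, hp⟩, ht'⟩ := hinf.exists_gt (max t u)
      have h1 := le_max_left t u
      have h2 := le_max_right t u
      rcases E.event_cases t' p with h3 | ⟨o', h3⟩ | ⟨i, op, r, h3⟩ | ⟨r, h3⟩
      · exact h3 e he hp
      · exact (hPd t' (by omega)).not_invokes h3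
      · obtain ⟨l₁, next, h4, h5, h6⟩ := E.status_of_call h3
        rcases (hmono t t' hst (by omega) l l₁ hl h4).lt_or_eq with h7 | h7
        · exact ih _ (by omega) t' (by omega) l₁ h4 rfl
        · have h8 := hu t' (by omega) l₁ i op next r (hPd t' (by omega)) h4 h5 h3 (by omega)
          exact ih _ h8 (t' + 1) (by omega) (next r) h6 rfl
      · exact hret t' r (by omega) h3
  obtain ⟨l, hl⟩ := (hPd (s + 1) (by omega)).busy
  exact hmain _ (s + 1) (by omega) l hl rfl

end Execution

end Generic

/-! ### The course of a TRANSFER operation -/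

section Transfer

variable {Proc W : Type} [Fintype Proc] [DecidableEq Proc] {P : Params Proc W}

/-- An access to the AllowList. -/
abbrev allowCall (p : Proc) (o : ListOp (Token W)) (r : ListRes Proc (Token W)) :
    Event P.obj (TransferOp W) (Option (Token W)) := .call p .allow o r

/-- An access to the DenyList. -/
abbrev denyCall (p : Proc) (o : ListOp (Token W)) (r : ListRes Proc (Token W)) :
    Event P.obj (TransferOp W) (Option (Token W)) := .call p .deny o r

/-- Between the times `s` and `t`, process `p` got no valid proof for `T` from the DenyList. -/
def NoProof (E : Execution (transferAlgorithm P)) (s : ℕ) (p : Proc) (T : Token W) (t : ℕ) : Prop :=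
  ∀ u, s < u → u < t → E.event u ≠ some (denyCall p (.prove T) .ok)

/-- The TRANSFER `o`, invoked at time `s`, has passed its three tests before time `t`. -/
def Entered (E : Execution (transferAlgorithm P)) (s : ℕ) (p : Proc) (o : TransferOp W) (t : ℕ) :
    Prop :=
  (pour o).Verify ∧ ∃ u v, s < u ∧ u < v ∧ v < t ∧
    E.event u = some (allowCall p (.prove o.source) .ok) ∧
    E.event v = some (denyCall p (.prove o.source) .ok)

/-- Before time `t`, `p` got an invalid proof for the source and then read the DenyList, with
response `r`. -/
def Elected (E : Execution (transferAlgorithm P)) (s : ℕ) (p : Proc) (o : TransferOp W) (t : ℕ)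
    (r : ListRes Proc (Token W)) : Prop :=
  Entered E s p o t ∧ ∃ u v, s < u ∧ u < v ∧ v < t ∧
    E.event u = some (denyCall p (.prove o.source) .fail) ∧
    E.event v = some (denyCall p .read r)

/-- What the local state of `p` at time `t` tells about the TRANSFER `o` that it invoked at
time `s`. -/
def LineFacts (E : Execution (transferAlgorithm P)) (s : ℕ) (p : Proc) (o : TransferOp W) (t : ℕ) :
    Line W → Prop
  | .ready => False
  | .testAllow tx => tx = pour o ∧ tx.Verify ∧ NoProof E s p o.source t
  | .testDeny tx => tx = pour o ∧ tx.Verify ∧ NoProof E s p o.source t ∧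
      ∃ u, s < u ∧ u < t ∧ E.event u = some (allowCall p (.prove o.source) .ok)
  | .proveAllow tx | .proveDeny tx | .appendDeny tx => tx = pour o ∧ Entered E s p o t
  | .loop tx => tx = pour o ∧ Entered E s p o t ∧
      ∃ u r, s < u ∧ u < t ∧ E.event u = some (denyCall p (.append o.source) r)
  | .elect tx => tx = pour o ∧ Entered E s p o t ∧
      ∃ u, s < u ∧ u < t ∧ E.event u = some (denyCall p (.prove o.source) .fail)
  | .appendAllow tx => tx = pour o ∧
      ∃ r, Elected E s p o t r ∧ chooseLeader P.choose r o.source = p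
  | .done none =>
      (NoProof E s p o.source t ∧ (¬ (pour o).Verify ∨
        (∃ u r, s < u ∧ u < t ∧ r ≠ .ok ∧ E.event u = some (allowCall p (.prove o.source) r)) ∨
        ∃ u r, s < u ∧ u < t ∧ r ≠ .ok ∧ E.event u = some (denyCall p (.prove o.source) r))) ∨
      ∃ r, Elected E s p o t r ∧ chooseLeader P.choose r o.source ≠ p
  | .done (some T) => T = (pour o).created ∧ ∃ u r r₁, s < u ∧ u < t ∧ Elected E s p o u r ∧
      chooseLeader P.choose r o.source = p ∧
      E.event u = some (allowCall p (.append (pour o).created) r₁)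

theorem Entered.mono {E : Execution (transferAlgorithm P)} {s p o t t'} (h : Entered E s p o t)
    (ht : t ≤ t') : Entered E s p o t' := by
  obtain ⟨h1, u, v, h2, h3, h4, h5⟩ := h
  exact ⟨h1, u, v, h2, h3, by omega, h5⟩

theorem Elected.mono {E : Execution (transferAlgorithm P)} {s p o t t' r} (h : Elected E s p o t r)
    (ht : t ≤ t') : Elected E s p o t' r := by
  obtain ⟨h1, u, v, h2, h3, h4, h5⟩ := h
  exact ⟨h1.mono ht, u, v, h2, h3, by omega, h5⟩

theorem NoProof.succ {E : Execution (transferAlgorithm P)} {s p T t} (h : NoProof E s p T t)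
    (ht : E.event t ≠ some (denyCall p (.prove T) .ok)) : NoProof E s p T (t + 1) := by
  intro u hu hu'
  rcases Nat.lt_succ_iff_lt_or_eq.mp hu' with h4 | rfl
  · exact h u hu h4
  · exact ht

theorem LineFacts.succ {E : Execution (transferAlgorithm P)} {s p o t l}
    (ht : ∀ e, E.event t = some e → e.proc ≠ p) (h : LineFacts E s p o t l) :
    LineFacts E s p o (t + 1) l := by
  have hne : E.event t ≠ some (denyCall p (.prove o.source) .ok) := fun he => ht _ he rfl
  cases l with
  | ready => exact h
  | testAllow tx => exact ⟨h.1, h.2.1, h.2.2.succ hne⟩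
  | testDeny tx =>
    obtain ⟨h1, h2, h3, u, h4, h5, h6⟩ := h
    exact ⟨h1, h2, h3.succ hne, u, h4, by omega, h6⟩
  | proveAllow tx => exact ⟨h.1, h.2.mono (by omega)⟩
  | proveDeny tx => exact ⟨h.1, h.2.mono (by omega)⟩
  | appendDeny tx => exact ⟨h.1, h.2.mono (by omega)⟩
  | loop tx =>
    obtain ⟨h1, h2, u, r, h4, h5, h6⟩ := h
    exact ⟨h1, h2.mono (by omega), u, r, h4, by omega, h6⟩
  | elect tx =>
    obtain ⟨h1, h2, u, h4, h5, h6⟩ := h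
    exact ⟨h1, h2.mono (by omega), u, h4, by omega, h6⟩
  | appendAllow tx =>
    obtain ⟨h1, r, h2, h3⟩ := h
    exact ⟨h1, r, h2.mono (by omega), h3⟩
  | done r =>
    cases r with
    | none =>
      rcases h with ⟨h1, h | ⟨u, r, h4, h5, h6⟩ | ⟨u, r, h4, h5, h6⟩⟩ | ⟨r, h1, h2⟩
      · exact .inl ⟨h1.succ hne, .inl h⟩
      · exact .inl ⟨h1.succ hne, .inr (.inl ⟨u, r, h4, by omega, h6⟩)⟩
      · exact .inl ⟨h1.succ hne, .inr (.inr ⟨u, r, h4, by omega, h6⟩)⟩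
      · exact .inr ⟨r, h1.mono (by omega), h2⟩
    | some T =>
      obtain ⟨h1, u, r, r₁, h2, h3, h4⟩ := h
      exact ⟨h1, u, r, r₁, h2, by omega, h4⟩

theorem lineFacts_call {E : Execution (transferAlgorithm P)} {s p o t} {l : Line W} {i op next r}
    (hst : s < t) (hi : (transferAlgorithm P).instr p l = .call i op next)
    (he : E.event t = some (.call p i op r)) (h : LineFacts E s p o t l) :
    LineFacts E s p o (t + 1) (next r) := by
  cases l with
  | ready => exact h.elim
  | testAllow tx =>
    obtain ⟨rfl, h2, h3⟩ := h
    cases hi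
    have h3' := h3.succ (by rw [he]; intro hc; cases hc)
    cases r with
    | ok => exact ⟨rfl, h2, h3', t, hst, by omega, he⟩
    | fail => exact .inl ⟨h3', .inr (.inl ⟨t, .fail, hst, by omega, by simp, he⟩)⟩
    | proofs l => exact .inl ⟨h3', .inr (.inl ⟨t, .proofs l, hst, by omega, by simp, he⟩)⟩
  | testDeny tx =>
    obtain ⟨rfl, h2, h3, u, h4, h5, h6⟩ := h
    cases hi
    cases r with
    | ok => exact ⟨rfl, h2, u, t, h4, h5, by omega, h6, he⟩
    | fail =>
      exact .inl ⟨h3.succ (by rw [he]; intro hc; cases hc),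
        .inr (.inr ⟨t, .fail, hst, by omega, by simp, he⟩)⟩
    | proofs l =>
      exact .inl ⟨h3.succ (by rw [he]; intro hc; cases hc),
        .inr (.inr ⟨t, .proofs l, hst, by omega, by simp, he⟩)⟩
  | proveAllow tx => cases hi; exact ⟨h.1, h.2.mono (by omega)⟩
  | proveDeny tx => cases hi; exact ⟨h.1, h.2.mono (by omega)⟩
  | appendDeny tx =>
    obtain ⟨rfl, h⟩ := h
    cases hi; exact ⟨rfl, h.mono (by omega), t, r, hst, by omega, he⟩
  | loop tx =>
    obtain ⟨rfl, h, u, r', h1, h2, h3⟩ := h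
    cases hi
    cases r with
    | ok => exact ⟨rfl, h.mono (by omega), u, r', h1, by omega, h3⟩
    | fail => exact ⟨rfl, h.mono (by omega), t, hst, by omega, he⟩
    | proofs l => exact ⟨rfl, h.mono (by omega), u, r', h1, by omega, h3⟩
  | elect tx =>
    obtain ⟨rfl, h, u, h1, h2, h3⟩ := h
    cases hi
    have hE : Elected E s p o (t + 1) r :=
      ⟨h.mono (by omega), u, t, h1, h2, by omega, h3, he⟩
    beta_reduce
    split_ifs with hc
    · exact ⟨rfl, r, hE, hc⟩
    · exact .inr ⟨r, hE, hc⟩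
  | appendAllow tx =>
    obtain ⟨rfl, r', h, h1⟩ := h
    cases hi
    exact ⟨rfl, t, r', r, hst, by omega, h, h1, he⟩
  | done r => cases hi

theorem Execution.Pending.lineFacts {E : Execution (transferAlgorithm P)} {s p o t}
    (h : E.Pending s p o t) : ∃ l, E.status t p = .busy l ∧ LineFacts E s p o t l := by
  refine E.pending_induction (M := LineFacts E s p o) (fun l => ?_)
    (fun t l _ => LineFacts.succ) (fun t l i op next r hP _ hi he => lineFacts_call hP.2.1 hi he) t h
  have hN : NoProof E s p o.source (s + 1) := fun u h1 h2 => by omega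
  dsimp only [transferAlgorithm]
  split_ifs with hv
  · exact ⟨rfl, hv, hN⟩
  · exact .inl ⟨hN, .inl hv⟩

variable {E : Execution (transferAlgorithm P)}

/-! ### The accesses to the lists -/

theorem deny_legal (E : Execution (transferAlgorithm P)) :
    ∃ h : History Proc (ListOp (Token W)) (ListRes Proc (Token W)),
      (∀ t p o r, h t = some (p, o, r) ↔ E.event t = some (denyCall p o r)) ∧
      DenyListLegal P.denyManagers P.denyVerifiers h := E.legal .deny

theorem allow_legal (E : Execution (transferAlgorithm P)) :
    ∃ h : History Proc (ListOp (Token W)) (ListRes Proc (Token W)),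
      (∀ t p o r, h t = some (p, o, r) ↔ E.event t = some (allowCall p o r)) ∧
      AllowListLegal P.allowManagers P.allowVerifiers (initialTokens W P.v₀) h := E.legal .allow

theorem deny_append_ok {t p x r} (hp : p ∈ P.denyManagers)
    (h : E.event t = some (denyCall p (.append x) r)) : r = .ok := by
  obtain ⟨H, hH, hL⟩ := deny_legal E
  exact (hL.append_valid t p x r ((hH ..).2 h)).1 hp

theorem deny_prove_response {t p x r} (h : E.event t = some (denyCall p (.prove x) r)) :
    r = .ok ∨ r = .fail := by
  obtain ⟨H, hH, hL⟩ := deny_legal E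
  exact hL.prove_response t p x r ((hH ..).2 h)

theorem deny_anti_flickering {t u p q x r} (hp : p ∈ P.denyVerifiers)
    (h : E.event t = some (denyCall p (.prove x) .fail)) (htu : t < u)
    (h' : E.event u = some (denyCall q (.prove x) r)) : r = .fail := by
  obtain ⟨H, hH, hL⟩ := deny_legal E
  exact hL.anti_flickering t p x hp ((hH ..).2 h) u q r htu ((hH ..).2 h')

theorem deny_appended {t p x} (hp : p ∈ P.denyVerifiers)
    (h : E.event t = some (denyCall p (.prove x) .fail)) :
    ∃ u < t, ∃ q, E.event u = some (denyCall q (.append x) .ok) := by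
  obtain ⟨H, hH, hL⟩ := deny_legal E
  simpa only [hH] using (hL.prove_valid t p x ((hH ..).2 h)).resolve_left (not_not.2 hp)

theorem deny_progress {t p x} (h : E.event t = some (denyCall p (.append x) .ok)) :
    ∃ u, ∀ v q r, u ≤ v → E.event v = some (denyCall q (.prove x) r) → r = .fail := by
  obtain ⟨H, hH, hL⟩ := deny_legal E
  obtain ⟨u, hu⟩ := hL.progress t p x ((hH ..).2 h)
  exact ⟨u, fun v q r h1 h2 => hu v q r h1 ((hH ..).2 h2)⟩

theorem deny_read {t p r} (h : E.event t = some (denyCall p .read r)) :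
    ∃ l, r = .proofs l ∧
      ∀ q x, (q, x) ∈ l ↔ ∃ u < t, E.event u = some (denyCall q (.prove x) .ok) := by
  obtain ⟨H, hH, hL⟩ := deny_legal E
  obtain ⟨l, ts, h1, -, h3, h4⟩ := hL.read_valid t p r ((hH ..).2 h)
  refine ⟨l, h1, fun q x => ⟨fun hm => ?_, fun ⟨u, hu, he⟩ => ?_⟩⟩
  · obtain ⟨i, hi, hq⟩ := List.getElem_of_mem hm
    have hlen := h4.length_eq
    have h5 := List.Forall₂.get h4 (i := i) (by omega) hi
    simp only [List.get_eq_getElem, hq] at h5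
    exact ⟨ts[i], ((h3 _).1 (List.getElem_mem _)).1, (hH ..).1 h5⟩
  · have hm := (h3 u).2 ⟨hu, q, x, (hH ..).2 he⟩
    obtain ⟨i, hi, hq⟩ := List.getElem_of_mem hm
    have hlen := h4.length_eq
    have h5 := List.Forall₂.get h4 (i := i) hi (by omega)
    simp only [List.get_eq_getElem, hq] at h5
    rw [(hH ..).2 he] at h5
    simp only [Option.some.injEq, Prod.mk.injEq, ListOp.prove.injEq, and_true] at h5
    rw [show (q, x) = l[i] from Prod.ext h5.1 h5.2]
    exact List.getElem_mem _

theorem allow_append_ok {t p x r} (hp : p ∈ P.allowManagers)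
    (h : E.event t = some (allowCall p (.append x) r)) : r = .ok := by
  obtain ⟨H, hH, hL⟩ := allow_legal E
  exact (hL.append_valid t p x r ((hH ..).2 h)).1 hp

theorem allow_prove_iff {t p x r} (h : E.event t = some (allowCall p (.prove x) r)) :
    r = .ok ↔ p ∈ P.allowVerifiers ∧ (x ∈ initialTokens W P.v₀ ∨
      ∃ u < t, ∃ q, E.event u = some (allowCall q (.append x) .ok)) := by
  obtain ⟨H, hH, hL⟩ := allow_legal E
  simpa only [hH] using hL.prove_valid t p x r ((hH ..).2 h)

theorem deny_prove_pending {t p T r} (h : E.event t = some (denyCall p (.prove T) r)) :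
    ∃ s o m, E.Pending s p o t ∧ o.source = T ∧ (pour o).Verify ∧ s < m ∧ m < t ∧
      E.event m = some (allowCall p (.prove T) .ok) := by
  obtain ⟨l, next, h1, h2, -⟩ := E.status_of_call h
  obtain ⟨s, o, hP⟩ := E.exists_pending_of_busy h1
  obtain ⟨l', h1', hF⟩ := hP.lineFacts
  rw [h1] at h1'
  cases h1'
  cases l <;> cases h2
  · obtain ⟨rfl, h2, h3, u, h4, h5, h6⟩ := hF
    exact ⟨s, o, u, hP, rfl, h2, h4, h5, h6⟩
  · obtain ⟨rfl, h2, u, v, h3, h4, h5, h6, -⟩ := hF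
    exact ⟨s, o, u, hP, rfl, h2, h3, by omega, h6⟩
  · obtain ⟨rfl, ⟨h2, u, v, h3, h4, h5, h6, -⟩, -⟩ := hF
    exact ⟨s, o, u, hP, rfl, h2, h3, by omega, h6⟩

theorem deny_append_entered {t p T r} (h : E.event t = some (denyCall p (.append T) r)) :
    ∃ u q, E.event u = some (denyCall q (.prove T) .ok) := by
  obtain ⟨l, next, h1, h2, -⟩ := E.status_of_call h
  obtain ⟨s, o, hP⟩ := E.exists_pending_of_busy h1
  obtain ⟨l', h1', hF⟩ := hP.lineFacts
  rw [h1] at h1'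
  cases h1'
  cases l <;> cases h2
  obtain ⟨rfl, -, u, v, -, -, -, -, h3⟩ := hF
  exact ⟨v, p, h3⟩

theorem allow_append_pending {t p T r} (h : E.event t = some (allowCall p (.append T) r)) :
    ∃ s o r₁, E.Pending s p o t ∧ (pour o).created = T ∧ Elected E s p o t r₁ ∧
      chooseLeader P.choose r₁ o.source = p := by
  obtain ⟨l, next, h1, h2, -⟩ := E.status_of_call h
  obtain ⟨s, o, hP⟩ := E.exists_pending_of_busy h1
  obtain ⟨l', h1', hF⟩ := hP.lineFacts
  rw [h1] at h1'
  cases h1'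
  cases l <;> cases h2
  obtain ⟨rfl, r, h3, h4⟩ := hF
  exact ⟨s, o, r, hP, rfl, h3, h4⟩

theorem lineFacts_of_ret {t p r} (h : E.event t = some (.ret p r)) :
    ∃ s o, E.Pending s p o t ∧ LineFacts E s p o t (.done r) := by
  obtain ⟨l, l₁, h1, h2, -⟩ := E.status_of_ret h
  obtain ⟨s, o, hP⟩ := E.exists_pending_of_busy h1
  obtain ⟨l', h1', hF⟩ := hP.lineFacts
  rw [h1] at h1'
  cases h1'
  cases l <;> cases h2
  · exact hF.elim
  · exact ⟨s, o, hP, hF⟩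

theorem Execution.Returns.lineFacts {s p o t r} (h : E.Returns s p t r) (hi : E.Invokes s p o) :
    E.Pending s p o t ∧ LineFacts E s p o t (.done r) := by
  obtain ⟨o', h1, h2⟩ := E.returns_iff.1 h
  obtain ⟨-, rfl⟩ := h1.1.unique hi
  obtain ⟨s', o'', h3, h4⟩ := lineFacts_of_ret h2
  obtain rfl := h1.unique h3
  obtain rfl := h1.unique_op h3
  exact ⟨h1, h4⟩

/-! ### Destruction and activation -/

/-- The first invalid PROVE of `T` by a verifier of the DenyList takes place at time `n`. From this
instant on no proof for `T` is valid any more, so that the set of candidate leaders is fixed. -/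
def FirstRevoked (E : Execution (transferAlgorithm P)) (T : Token W) (n : ℕ) : Prop :=
  (∃ p ∈ P.denyVerifiers, E.event n = some (denyCall p (.prove T) .fail)) ∧
  ∀ m < n, ∀ p ∈ P.denyVerifiers, E.event m ≠ some (denyCall p (.prove T) .fail)

open Classical in
/-- The process that is chosen among all processes that ever get a valid proof for `T`. -/
noncomputable def leader (E : Execution (transferAlgorithm P)) (T : Token W) : Proc :=
  P.choose (Finset.univ.filter fun q => ∃ u, E.event u = some (denyCall q (.prove T) .ok))

/-- The TRANSFER invoked at time `s` destroys its source at time `n`: it got a valid proof from the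
DenyList, it was issued by the leader for its source, and `n` is the instant that fixes the
leader. -/
def DestroysAt (E : Execution (transferAlgorithm P)) (s n : ℕ) : Prop :=
  ∃ p o u, E.Pending s p o u ∧ E.event u = some (denyCall p (.prove o.source) .ok) ∧
    leader E o.source = p ∧ FirstRevoked E o.source n

/-- The TRANSFER invoked at time `s` appends the new token to the AllowList at time `n`. -/
def ActivatesAt (E : Execution (transferAlgorithm P)) (s n : ℕ) : Prop :=
  ∃ p o r, E.Pending s p o n ∧ E.event n = some (allowCall p (.append (pour o).created) r)

theorem FirstRevoked.unique {T n m} (h : FirstRevoked E T n) (h' : FirstRevoked E T m) :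
    n = m := by
  obtain ⟨⟨p, hp, h1⟩, h2⟩ := h
  obtain ⟨⟨q, hq, h3⟩, h4⟩ := h'
  rcases lt_trichotomy n m with h | h | h
  · exact absurd h1 (h4 n h p hp)
  · exact h
  · exact absurd h3 (h2 m h q hq)

theorem exists_firstRevoked {T p u} (hp : p ∈ P.denyVerifiers)
    (h : E.event u = some (denyCall p (.prove T) .fail)) :
    ∃ n ≤ u, FirstRevoked E T n := by
  classical
  have hex : ∃ n, ∃ p ∈ P.denyVerifiers, E.event n = some (denyCall p (.prove T) .fail) :=
    ⟨u, p, hp, h⟩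
  refine ⟨Nat.find hex, Nat.find_min' hex ⟨p, hp, h⟩, Nat.find_spec hex, fun m hm q hq he => ?_⟩
  exact Nat.find_min hex hm ⟨q, hq, he⟩

theorem FirstRevoked.lt_of_ok {T n u q} (h : FirstRevoked E T n)
    (hu : E.event u = some (denyCall q (.prove T) .ok)) : u < n := by
  obtain ⟨⟨p, hp, h1⟩, -⟩ := h
  rcases lt_trichotomy u n with h | rfl | h
  · exact h
  · rw [h1] at hu; cases hu
  · cases deny_anti_flickering hp h1 h hu

theorem mem_denyVerifiers {k s p o} (hP : P.Admissible k) (hA : Authorized E)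
    (h : E.Invokes s p o) : p ∈ P.denyVerifiers := hP.serves _ (hA s p o h)

theorem Elected.firstRevoked {s p o t r} (hp : p ∈ P.denyVerifiers) (h : Elected E s p o t r) :
    ∃ n < t, FirstRevoked E o.source n := by
  obtain ⟨-, u, v, -, h2, h3, h4, -⟩ := h
  obtain ⟨n, hn, hf⟩ := exists_firstRevoked hp h4
  exact ⟨n, by omega, hf⟩

/-- All processes that read the DenyList after an invalid proof elect the same leader. -/
theorem Elected.chooseLeader_eq {s p o t r} (hp : p ∈ P.denyVerifiers) (h : Elected E s p o t r) :
    chooseLeader P.choose r o.source = leader E o.source := by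
  obtain ⟨-, u, v, -, h2, h3, h4, h5⟩ := h
  obtain ⟨l, rfl, hl⟩ := deny_read h5
  obtain ⟨n, hn, hf⟩ := exists_firstRevoked hp h4
  refine congrArg P.choose ?_
  ext q
  simp only [Finset.mem_filter, Finset.mem_univ, true_and, hl]
  exact ⟨fun ⟨w, _, hw⟩ => ⟨w, hw⟩, fun ⟨w, hw⟩ => ⟨w, by have := hf.lt_of_ok hw; omega, hw⟩⟩

theorem Elected.destroysAt {s p o t r} (hp : p ∈ P.denyVerifiers) (h : Elected E s p o t r)
    (hPd : E.Pending s p o t) (hl : chooseLeader P.choose r o.source = p) :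
    ∃ n < t, DestroysAt E s n := by
  obtain ⟨n, hn, hf⟩ := h.firstRevoked hp
  obtain ⟨-, u, v, h1, h2, h3, -, h4⟩ := h.1
  exact ⟨n, hn, p, o, v, hPd.mono (by omega) h3.le, h4, by rw [← h.chooseLeader_eq hp, hl], hf⟩

theorem DestroysAt.of_invokes {s n p o} (h : DestroysAt E s n) (hi : E.Invokes s p o) :
    s < n ∧ (pour o).Verify ∧ leader E o.source = p ∧ FirstRevoked E o.source n ∧
      ∃ u, E.Pending s p o u ∧ E.event u = some (denyCall p (.prove o.source) .ok) := by
  obtain ⟨p', o', u, h1, h2, h3, h4⟩ := h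
  obtain ⟨rfl, rfl⟩ := h1.1.unique hi
  obtain ⟨s', o'', m, h5, h6, h7, -⟩ := deny_prove_pending h2
  obtain rfl := h1.unique_op h5
  exact ⟨h1.2.1.trans (h4.lt_of_ok h2), h7, h3, h4, u, h1, h2⟩

theorem DestroysAt.invokes {s n} (h : DestroysAt E s n) : ∃ p o, E.Invokes s p o := by
  obtain ⟨p, o, u, h1, -⟩ := h
  exact ⟨p, o, h1.1⟩

theorem DestroysAt.unique {s n m} (h : DestroysAt E s n) (h' : DestroysAt E s m) : n = m := by
  obtain ⟨p, o, hi⟩ := h.invokes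
  exact (h.of_invokes hi).2.2.2.1.unique (h'.of_invokes hi).2.2.2.1

section Admissible

variable {k : ℕ} (hP : P.Admissible k) (hA : Authorized E)
include hP hA

theorem ActivatesAt.destroysAt {s n} (h : ActivatesAt E s n) : ∃ m < n, DestroysAt E s m := by
  obtain ⟨p, o, r, h1, h2⟩ := h
  obtain ⟨s', o', r₁, h3, -, h4, h5⟩ := allow_append_pending h2
  obtain rfl := h1.unique h3
  exact h4.destroysAt (mem_denyVerifiers hP hA h3.1) h3 h5

/-- A token on the AllowList is initial or was activated. -/
theorem allow_prove_ok_iff {p x r t} (hp : p ∈ P.denyVerifiers)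
    (h : E.event t = some (allowCall p (.prove x) r)) :
    r = .ok ↔ (x ∈ initialTokens W P.v₀ ∨
      ∃ s q o n, E.Invokes s q o ∧ (pour o).created = x ∧ ActivatesAt E s n ∧ n < t) := by
  rw [allow_prove_iff h]
  refine ⟨fun ⟨_, h1⟩ => h1.imp_right fun ⟨u, hu, q, he⟩ => ?_,
    fun h1 => ⟨hP.allowVerifiers hp, h1.imp_right fun ⟨s, q, o, n, hi, ho, h2, hn⟩ => ?_⟩⟩
  · obtain ⟨s, o, r₁, h2, rfl, -⟩ := allow_append_pending he
    exact ⟨s, q, o, u, h2.1, rfl, ⟨q, o, _, h2, he⟩, hu⟩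
  · obtain ⟨q', o', r', h3, h4⟩ := h2
    obtain ⟨rfl, rfl⟩ := h3.1.unique hi
    have := allow_append_ok (hP.allowManagers (mem_denyVerifiers hP hA hi)) h4
    subst this
    exact ⟨n, hn, q', ho ▸ h4⟩

theorem DestroysAt.source_exists {s n p o} (h : DestroysAt E s n) (hi : E.Invokes s p o) :
    o.source ∈ initialTokens W P.v₀ ∨ ∃ s₁ q o₁ m, E.Invokes s₁ q o₁ ∧
      (pour o₁).created = o.source ∧ ActivatesAt E s₁ m ∧ m < n := by
  obtain ⟨-, -, -, h1, u, h2, h3⟩ := h.of_invokes hi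
  obtain ⟨s', o', m, h4, -, -, h5, h6, h7⟩ := deny_prove_pending h3
  have hlt := h1.lt_of_ok h3
  rcases (allow_prove_ok_iff hP hA (mem_denyVerifiers hP hA hi) h7).1 rfl with
    h8 | ⟨s₁, q, o₁, m', h8, h9, h10, h11⟩
  · exact .inl h8
  · exact .inr ⟨s₁, q, o₁, m', h8, h9, h10, by omega⟩

/-- A TRANSFER that returns `False` although it passed the tests was not issued by the leader. -/
theorem not_destroysAt_of_returns_none {s p t n} (h : E.Returns s p t none) :
    ¬ DestroysAt E s n := by
  intro hd
  obtain ⟨o, hi⟩ := h.1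
  obtain ⟨hPd, hF⟩ := h.lineFacts hi
  obtain ⟨-, -, h1, h2, u, h3, h4⟩ := hd.of_invokes hi
  have hut : u < t := by
    by_contra hc
    rcases (not_lt.mp hc).lt_or_eq with hlt | rfl
    · exact h3.2.2 t none hPd.2.1 hlt h.2.2.1
    · rw [h.2.2.1] at h4; cases h4
  rcases hF with ⟨hN, -⟩ | ⟨r, h5, h6⟩
  · exact hN u h3.2.1 hut h4
  · exact h6 (by rw [h5.chooseLeader_eq (mem_denyVerifiers hP hA hi), h1])

theorem DestroysAt.unique_source {s₁ s₂ p₁ p₂ o₁ o₂ n₁ n₂} (h₁ : DestroysAt E s₁ n₁)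
    (h₂ : DestroysAt E s₂ n₂) (i₁ : E.Invokes s₁ p₁ o₁) (i₂ : E.Invokes s₂ p₂ o₂)
    (h : o₁.source = o₂.source) : s₁ = s₂ := by
  -- the earlier operation of the leader has seen the token revoked before the later one begins
  have key : ∀ {s₁ s₂ p₁ p₂ o₁ o₂ n₁ n₂}, DestroysAt E s₁ n₁ → DestroysAt E s₂ n₂ →
      E.Invokes s₁ p₁ o₁ → E.Invokes s₂ p₂ o₂ → o₁.source = o₂.source → ¬ s₁ < s₂ := by
    intro s₁ s₂ p₁ p₂ o₁ o₂ n₁ n₂ h₁ h₂ i₁ i₂ h hlt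
    obtain ⟨-, -, hl₁, hf₁, -⟩ := h₁.of_invokes i₁
    obtain ⟨-, -, hl₂, hf₂, v, hv, hev⟩ := h₂.of_invokes i₂
    rw [h, hl₂] at hl₁
    subst hl₁
    obtain ⟨t, r, ht, hr⟩ := E.exists_returns_between i₁ i₂ hlt
    obtain ⟨hPd, hF⟩ := hr.lineFacts i₁
    have hel : ∃ t' ≤ t, ∃ r', Elected E s₁ p₂ o₁ t' r' := by
      cases r with
      | none => exact absurd h₁ (not_destroysAt_of_returns_none hP hA hr)
      | some T =>
        obtain ⟨-, u, r', -, -, hu, hE, -⟩ := hF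
        exact ⟨u, hu.le, r', hE⟩
    obtain ⟨t', ht', r', hE⟩ := hel
    obtain ⟨n, hn, hf⟩ := hE.firstRevoked (mem_denyVerifiers hP hA i₁)
    rw [h] at hf
    have := hf.lt_of_ok hev
    have := hv.2.1
    omega
  exact le_antisymm (not_lt.1 (key h₂ h₁ i₂ i₁ h.symm)) (not_lt.1 (key h₁ h₂ i₁ i₂ h))

omit hA in
/-- Once a token that some process got a valid proof for is revoked, a TRANSFER destroys it. -/
theorem exists_destroysAt {T n u q} (hf : FirstRevoked E T n)
    (hu : E.event u = some (denyCall q (.prove T) .ok)) :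
    ∃ s p o, E.Invokes s p o ∧ o.source = T ∧ DestroysAt E s n := by
  classical
  have hne : (Finset.univ.filter fun q =>
      ∃ u, E.event u = some (denyCall q (.prove T) .ok)).Nonempty :=
    ⟨q, by simp only [Finset.mem_filter, Finset.mem_univ, true_and]; exact ⟨u, hu⟩⟩
  have hmem := hP.choose_mem _ hne
  simp only [Finset.mem_filter, Finset.mem_univ, true_and] at hmem
  obtain ⟨v, hv⟩ := hmem
  obtain ⟨s, o, m, h1, rfl, -⟩ := deny_prove_pending hv
  refine ⟨s, _, o, h1.1, rfl, _, o, v, h1, hv, ?_, hf⟩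
  unfold leader
  congr!

omit hP hA in
theorem returns_some {s p o t T} (h : E.Returns s p t (some T)) (hi : E.Invokes s p o) :
    T = (pour o).created ∧ ∃ m < t, ActivatesAt E s m := by
  obtain ⟨hPd, hT, u, r, r₁, h1, h2, -, -, h3⟩ := h.lineFacts hi
  exact ⟨hT, u, h2, p, o, r₁, hPd.mono h1 h2.le, h3⟩

/-- The reasons for which a TRANSFER returns `False`. -/
theorem returns_none {s p o t} (h : E.Returns s p t none) (hi : E.Invokes s p o) :
    ¬ (pour o).Verify ∨
    (∃ m, s < m ∧ m < t ∧ o.source ∉ initialTokens W P.v₀ ∧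
      ∀ s₁ q o₁ n, E.Invokes s₁ q o₁ → (pour o₁).created = o.source → ActivatesAt E s₁ n →
        ¬ n < m) ∨
    ∃ n < t, ∃ s₁ q o₁, E.Invokes s₁ q o₁ ∧ o₁.source = o.source ∧ DestroysAt E s₁ n := by
  obtain ⟨hPd, hF⟩ := h.lineFacts hi
  have hp := mem_denyVerifiers hP hA hi
  rcases hF with ⟨-, h1 | ⟨u, r, h1, h2, h3, h4⟩ | ⟨u, r, h1, h2, h3, h4⟩⟩ | ⟨r, h1, -⟩
  · exact .inl h1
  · right; left
    have := (allow_prove_ok_iff hP hA hp h4).not.1 h3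
    push Not at this
    refine ⟨u, h1, h2, this.1, fun s₁ q o₁ n h5 h6 h7 => ?_⟩
    exact not_lt.2 (this.2 s₁ q o₁ n h5 h6 h7)
  · right; right
    obtain rfl := (deny_prove_response h4).resolve_left h3
    obtain ⟨n, hn, hf⟩ := exists_firstRevoked hp h4
    obtain ⟨v, -, q, hv⟩ := deny_appended hp h4
    obtain ⟨v', q', hv'⟩ := deny_append_entered hv
    obtain ⟨s₁, q, o₁, h4, h5, h6⟩ := exists_destroysAt hP hf hv'
    exact ⟨n, by omega, s₁, q, o₁, h4, h5, h6⟩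
  · right; right
    obtain ⟨n, hn, hf⟩ := h1.firstRevoked hp
    obtain ⟨-, u, v, -, -, -, -, h3⟩ := h1.1
    obtain ⟨s₁, q, o₁, h4, h5, h6⟩ := exists_destroysAt hP hf h3
    exact ⟨n, hn, s₁, q, o₁, h4, h5, h6⟩

end Admissible

variable {k : ℕ}

/-! ### Termination -/

/-- An upper bound for the number of steps to the return, if no step repeats the loop. -/
def Line.rank : Line W → ℕ
  | .ready => 0
  | .done _ => 0
  | .appendAllow _ => 1
  | .elect _ => 2
  | .loop _ => 3
  | .appendDeny _ => 4
  | .proveDeny _ => 5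
  | .proveAllow _ => 6
  | .testDeny _ => 7
  | .testAllow _ => 8

theorem rank_call {t p i op r next} {l : Line W} (h : E.event t = some (.call p i op r))
    (h2 : (transferAlgorithm P).instr p l = .call i op next) :
    (next r : Line W).rank < l.rank ∨ ∃ (tx : Tx W) (r' : _), l = .loop tx ∧ next r = Line.loop tx ∧
      E.event t = some (denyCall p (.prove tx.source) r') ∧ r' ≠ .fail := by
  cases l <;> cases h2
  case loop tx =>
    cases r with
    | ok => exact .inr ⟨tx, .ok, rfl, rfl, h, by simp⟩
    | fail => exact .inl (by simp [Line.rank])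
    | proofs l => exact .inr ⟨tx, .proofs l, rfl, rfl, h, by simp⟩
  case elect tx =>
    left
    dsimp only
    split_ifs <;> simp [Line.rank]
  all_goals left; cases r <;> simp [Line.rank]

theorem waitFree (hP : P.Admissible k) (hA : Authorized E) : E.WaitFree := by
  intro s p o hi hinf
  refine E.exists_returns_of_rank hi hinf Line.rank ?_ fun n => ?_
  · intro t l i op next r _ _ h2 h3
    rcases rank_call h3 h2 with h | ⟨tx, r', rfl, h, -⟩
    · exact h.le
    · rw [h]
  · by_cases hloop : ∃ t tx, E.Pending s p o t ∧ E.status t p = .busy (Line.loop tx)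
    · -- the process has appended its token, which is rejected after some time
      obtain ⟨t, tx, hPd, hl⟩ := hloop
      obtain ⟨l', hl', hF⟩ := hPd.lineFacts
      rw [hl] at hl'
      cases hl'
      obtain ⟨rfl, -, u, r, -, -, hap⟩ := hF
      obtain rfl := deny_append_ok (hP.denyManagers (mem_denyVerifiers hP hA hi)) hap
      obtain ⟨w, hw⟩ := deny_progress hap
      refine ⟨w, fun t' ht' l i op next r hPd' h1 h2 h3 hn => ?_⟩
      rcases rank_call h3 h2 with h | ⟨tx, r', rfl, -, h4, h5⟩
      · exact hn ▸ h
      · obtain ⟨_, hl', hF⟩ := hPd'.lineFacts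
        rw [h1] at hl'
        cases hl'
        obtain ⟨rfl, -⟩ := hF
        exact absurd (hw t' p r' ht' h4) h5
    · refine ⟨0, fun t' _ l i op next r hPd' h1 h2 h3 hn => ?_⟩
      rcases rank_call h3 h2 with h | ⟨tx, r', rfl, -⟩
      · exact hn ▸ h
      · exact absurd ⟨t', tx, hPd', h1⟩ hloop

/-! ### Validity of TRANSFER -/

open Classical in
/-- The first time at which `R` holds, `⊤` if there is none. -/
noncomputable def firstTime (R : ℕ → Prop) : ℕ∞ := if h : ∃ n, R n then (Nat.find h : ℕ) else ⊤

theorem of_firstTime_eq {R : ℕ → Prop} {n : ℕ} (h : firstTime R = n) : R n := by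
  classical
  unfold firstTime at h
  split_ifs at h with hex
  · have := Nat.find_spec hex
    rw [Nat.cast_inj] at h
    rwa [h] at this
  · exact absurd h (by simp)

theorem firstTime_lt_iff {R : ℕ → Prop} {n : ℕ} : firstTime R < n ↔ ∃ m < n, R m := by
  classical
  unfold firstTime
  split_ifs with hex
  · rw [Nat.cast_lt, Nat.find_lt_iff]
  · simp only [not_top_lt, false_iff]
    exact fun ⟨m, _, hm⟩ => hex ⟨m, hm⟩

theorem firstTime_ne_top_iff {R : ℕ → Prop} : firstTime R ≠ ⊤ ↔ ∃ m, R m := by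
  classical
  unfold firstTime
  split_ifs with hex <;> simp [hex]

theorem live_iff {T : Token W} {n : ℕ} :
    Live E (fun s => firstTime (DestroysAt E s)) (fun s => firstTime (ActivatesAt E s)) T n ↔
      (T ∈ initialTokens W P.v₀ ∨ ∃ s p o, E.Invokes s p o ∧ (pour o).created = T ∧
        ∃ m < n, ActivatesAt E s m) ∧
      ∀ s p o, E.Invokes s p o → o.source = T → ¬ ∃ m < n, DestroysAt E s m := by
  unfold Live
  simp only [firstTime_lt_iff]

theorem transferValidity (hP : P.Admissible k) (hA : Authorized E) : TransferValidity E := by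
  refine ⟨fun s => firstTime (DestroysAt E s), fun s => firstTime (ActivatesAt E s),
    fun s p o hi => ⟨?_, ?_, ?_, ?_, ?_⟩⟩
  · by_cases h : firstTime (ActivatesAt E s) = ⊤
    · simp [h]
    · obtain ⟨n, hn⟩ := ENat.ne_top_iff_exists.1 h
      obtain ⟨m, hm, hd⟩ := ActivatesAt.destroysAt hP hA (of_firstTime_eq hn.symm)
      beta_reduce
      rw [← hn]
      exact (firstTime_lt_iff.2 ⟨m, hm, hd⟩).le
  · intro n hn
    have hd : DestroysAt E s n := of_firstTime_eq hn
    obtain ⟨h1, h2, -⟩ := hd.of_invokes hi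
    refine ⟨h1, h2, live_iff.2 ⟨?_, ?_⟩⟩
    · refine (hd.source_exists hP hA hi).imp_right ?_
      rintro ⟨s₁, q, o₁, m, h3, h4, h5, h6⟩
      exact ⟨s₁, q, o₁, h3, h4, m, h6, h5⟩
    · rintro s₁ q o₁ hi₁ ho ⟨m, hm, hd₁⟩
      obtain rfl := hd.unique_source hP hA hd₁ hi hi₁ ho.symm
      obtain rfl := hd.unique hd₁
      exact lt_irrefl _ hm
  · intro s₁ p₁ o₁ hi₁ ho h1 h2
    obtain ⟨n, hn⟩ := firstTime_ne_top_iff.1 h1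
    obtain ⟨m, hm⟩ := firstTime_ne_top_iff.1 h2
    exact hm.unique_source hP hA hn hi₁ hi ho
  · intro t T h
    obtain ⟨h1, h2⟩ := returns_some h hi
    exact ⟨h1, firstTime_lt_iff.2 h2⟩
  · intro t h
    refine ⟨?_, fun hv => ?_⟩
    · by_contra hne
      obtain ⟨n, hn⟩ := firstTime_ne_top_iff.1 hne
      exact not_destroysAt_of_returns_none hP hA h hn
    · rcases returns_none hP hA h hi with h1 | ⟨m, h1, h2, h3, h4⟩ | ⟨n, hn, s₁, q, o₁, h1, h2, h3⟩
      · exact absurd hv h1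
      · refine ⟨m, h1, h2.le, fun hl => ?_⟩
        rcases (live_iff.1 hl).1 with h5 | ⟨s₁, q, o₁, h5, h6, n, hn, h7⟩
        · exact h3 h5
        · exact h4 s₁ q o₁ n h5 h6 h7 hn
      · exact ⟨t, h.2.1, le_rfl, fun hl => (live_iff.1 hl).2 s₁ q o₁ h1 h2 ⟨n, hn, h3⟩⟩

/-! ### Linearizability -/

/-- The linearization point of the TRANSFER invoked at time `s`: the destruction of its source, if
it destroys it; its response, if it returns `False` after another TRANSFER destroyed its source; and
its invocation, if it returns `False` for any other reason. -/
inductive LinearizedAt (E : Execution (transferAlgorithm P)) (s : ℕ) : ℕ → Prop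
  | destroys {n} (h : DestroysAt E s n) : LinearizedAt E s n
  | response {p o t} (hi : E.Invokes s p o) (h : E.Returns s p t none)
      (hd : ∃ n < t, ∃ s₁ q o₁, E.Invokes s₁ q o₁ ∧ o₁.source = o.source ∧ DestroysAt E s₁ n) :
      LinearizedAt E s t
  | invocation {p o t} (hi : E.Invokes s p o) (h : E.Returns s p t none)
      (hd : ¬ ∃ n < t, ∃ s₁ q o₁, E.Invokes s₁ q o₁ ∧ o₁.source = o.source ∧ DestroysAt E s₁ n) :
      LinearizedAt E s s

theorem Execution.Returns.unique {s p q t t' r r'} (h : E.Returns s p t r)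
    (h' : E.Returns s q t' r') : t = t' ∧ r = r' := by
  obtain ⟨o, h1, h2⟩ := E.returns_iff.1 h
  obtain ⟨o', h3, h4⟩ := E.returns_iff.1 h'
  obtain ⟨rfl, rfl⟩ := h1.1.unique h3.1
  have : t = t' := by
    rcases lt_trichotomy t t' with hlt | heq | hlt
    · exact absurd h2 (h3.2.2 t r h1.2.1 hlt)
    · exact heq
    · exact absurd h4 (h1.2.2 t' r' h3.2.1 hlt)
  subst this
  rw [h2] at h4
  cases h4
  exact ⟨rfl, rfl⟩

omit [Fintype Proc] [DecidableEq Proc] in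
theorem denyCall_prove_injective {q₁ q₂ : Proc} {T₁ T₂ : Token W} {r₁ r₂}
    (h : some (denyCall (P := P) q₁ (.prove T₁) r₁) = some (denyCall q₂ (.prove T₂) r₂)) :
    T₁ = T₂ := by
  cases h
  rfl

theorem DestroysAt.event {s n} (h : DestroysAt E s n) :
    ∃ q T, E.event n = some (denyCall q (.prove T) .fail) := by
  obtain ⟨p, o, u, -, -, -, ⟨⟨q, -, h1⟩, -⟩⟩ := h
  exact ⟨q, _, h1⟩

section Admissible

variable (hP : P.Admissible k) (hA : Authorized E)
include hP hA

theorem LinearizedAt.unique {s n m} (h : LinearizedAt E s n) (h' : LinearizedAt E s m) : n = m := by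
  cases h with
  | destroys h =>
    cases h' with
    | destroys h' => exact h.unique h'
    | response hi h1 hd => exact absurd h (not_destroysAt_of_returns_none hP hA h1)
    | invocation hi h1 hd => exact absurd h (not_destroysAt_of_returns_none hP hA h1)
  | response hi h1 hd =>
    cases h' with
    | destroys h => exact absurd h (not_destroysAt_of_returns_none hP hA h1)
    | response hi' h1' hd' => exact (h1.unique h1').1
    | invocation hi' h1' hd' =>
      obtain ⟨rfl, rfl⟩ := hi.unique hi'
      obtain ⟨rfl, -⟩ := h1.unique h1'
      exact absurd hd hd'
  | invocation hi h1 hd =>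
    cases h' with
    | destroys h => exact absurd h (not_destroysAt_of_returns_none hP hA h1)
    | response hi' h1' hd' =>
      obtain ⟨rfl, rfl⟩ := hi.unique hi'
      obtain ⟨rfl, -⟩ := h1.unique h1'
      exact absurd hd' hd
    | invocation hi' h1' hd' => rfl

theorem LinearizedAt.unique_op {s s' n} (h : LinearizedAt E s n) (h' : LinearizedAt E s' n) :
    s = s' := by
  cases h with
  | destroys h =>
    obtain ⟨q, T, he⟩ := h.event
    cases h' with
    | destroys h' =>
      obtain ⟨p, o, hi⟩ := h.invokes
      obtain ⟨p', o', hi'⟩ := h'.invokes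
      refine h.unique_source hP hA h' hi hi' ?_
      obtain ⟨-, -, -, ⟨⟨q₁, -, h1⟩, -⟩, -⟩ := h.of_invokes hi
      obtain ⟨-, -, -, ⟨⟨q₂, -, h2⟩, -⟩, -⟩ := h'.of_invokes hi'
      exact denyCall_prove_injective (h1.symm.trans h2)
    | response hi h1 hd => have := h1.2.2.1; rw [he] at this; cases this
    | invocation hi h1 hd => unfold Execution.Invokes at hi; rw [he] at hi; cases hi
  | response hi h1 hd =>
    have hr := h1.2.2.1
    cases h' with
    | destroys h => obtain ⟨q, T, he⟩ := h.event; rw [hr] at he; cases he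
    | response hi' h1' hd' =>
      have hr' := h1'.2.2.1
      rw [hr] at hr'
      cases hr'
      exact (h1.lineFacts hi).1.unique (h1'.lineFacts hi').1
    | invocation hi' h1' hd' => unfold Execution.Invokes at hi'; rw [hr] at hi'; cases hi'
  | invocation hi h1 hd =>
    cases h' with
    | destroys h =>
      obtain ⟨q, T, he⟩ := h.event; unfold Execution.Invokes at hi; rw [he] at hi; cases hi
    | response hi' h1' hd' =>
      have := h1'.2.2.1; unfold Execution.Invokes at hi; rw [this] at hi; cases hi
    | invocation hi' h1' hd' => rfl

omit hP hA in
theorem LinearizedAt.le {s n} (h : LinearizedAt E s n) : s ≤ n := by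
  cases h with
  | destroys h => obtain ⟨p, o, hi⟩ := h.invokes; exact (h.of_invokes hi).1.le
  | response hi h1 hd => exact h1.2.1.le
  | invocation => rfl

omit hP hA in
theorem LinearizedAt.invokes {s n} (h : LinearizedAt E s n) : ∃ p o, E.Invokes s p o := by
  cases h with
  | destroys h => exact h.invokes
  | response hi h1 hd => exact ⟨_, _, hi⟩
  | invocation hi => exact ⟨_, _, hi⟩

theorem exists_destroysAt_of_returns_some {s p t T} (h : E.Returns s p t (some T)) :
    ∃ n < t, DestroysAt E s n := by
  obtain ⟨o, hi⟩ := h.1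
  obtain ⟨-, m, hm, ha⟩ := returns_some h hi
  obtain ⟨n, hn, hd⟩ := ha.destroysAt hP hA
  exact ⟨n, by omega, hd⟩

theorem exists_linearizedAt {s p t r} (h : E.Returns s p t r) : ∃ n ≤ t, LinearizedAt E s n := by
  obtain ⟨o, hi⟩ := h.1
  cases r with
  | some T =>
    obtain ⟨n, hn, hd⟩ := exists_destroysAt_of_returns_some hP hA h
    exact ⟨n, hn.le, .destroys hd⟩
  | none =>
    by_cases hd : ∃ n < t, ∃ s₁ q o₁, E.Invokes s₁ q o₁ ∧ o₁.source = o.source ∧ DestroysAt E s₁ n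
    · exact ⟨t, le_rfl, .response hi h hd⟩
    · exact ⟨s, h.2.1.le, .invocation hi h hd⟩

/-- The tokens created before time `n` in the linearization: activation counts from the instant at
which the source is destroyed. -/
def createdBefore (E : Execution (transferAlgorithm P)) (n : ℕ) : Set (Token W) :=
  {T | T ∈ initialTokens W P.v₀ ∨
    ∃ s p o, E.Invokes s p o ∧ (pour o).created = T ∧ ∃ m < n, DestroysAt E s m}

/-- The tokens destroyed before time `n`. -/
def destroyedBefore (E : Execution (transferAlgorithm P)) (n : ℕ) : Set (Token W) :=
  {T | ∃ s p o, E.Invokes s p o ∧ o.source = T ∧ ∃ m < n, DestroysAt E s m}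

theorem createdBefore_succ {n s p o} (h : DestroysAt E s n) (hi : E.Invokes s p o) :
    createdBefore E (n + 1) = insert (pour o).created (createdBefore E n) := by
  ext T
  simp only [createdBefore, Set.mem_ofPred_eq, Set.mem_insert_iff]
  constructor
  · rintro (h1 | ⟨s₁, q, o₁, h1, h2, m, h3, h4⟩)
    · exact .inr (.inl h1)
    · rcases Nat.lt_succ_iff_lt_or_eq.mp h3 with h5 | rfl
      · exact .inr (.inr ⟨s₁, q, o₁, h1, h2, m, h5, h4⟩)
      · obtain rfl := LinearizedAt.unique_op hP hA (.destroys h) (.destroys h4)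
        obtain ⟨-, rfl⟩ := hi.unique h1
        exact .inl h2.symm
  · rintro (rfl | h1 | ⟨s₁, q, o₁, h1, h2, m, h3, h4⟩)
    · exact .inr ⟨s, p, o, hi, rfl, n, by omega, h⟩
    · exact .inl h1
    · exact .inr ⟨s₁, q, o₁, h1, h2, m, by omega, h4⟩

theorem destroyedBefore_succ {n s p o} (h : DestroysAt E s n) (hi : E.Invokes s p o) :
    destroyedBefore E (n + 1) = insert o.source (destroyedBefore E n) := by
  ext T
  simp only [destroyedBefore, Set.mem_ofPred_eq, Set.mem_insert_iff]
  constructor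
  · rintro ⟨s₁, q, o₁, h1, h2, m, h3, h4⟩
    rcases Nat.lt_succ_iff_lt_or_eq.mp h3 with h5 | rfl
    · exact .inr ⟨s₁, q, o₁, h1, h2, m, h5, h4⟩
    · obtain rfl := LinearizedAt.unique_op hP hA (.destroys h) (.destroys h4)
      obtain ⟨-, rfl⟩ := hi.unique h1
      exact .inl h2.symm
  · rintro (rfl | ⟨s₁, q, o₁, h1, h2, m, h3, h4⟩)
    · exact ⟨s, p, o, hi, rfl, n, by omega, h⟩
    · exact ⟨s₁, q, o₁, h1, h2, m, by omega, h4⟩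

omit hP hA in
theorem before_succ_of_not {n} (h : ∀ s, ¬ DestroysAt E s n) :
    createdBefore E (n + 1) = createdBefore E n ∧
      destroyedBefore E (n + 1) = destroyedBefore E n := by
  have key : ∀ s, (∃ m < n + 1, DestroysAt E s m) ↔ ∃ m < n, DestroysAt E s m := by
    refine fun s => ⟨fun ⟨m, h3, h4⟩ => ?_, fun ⟨m, h3, h4⟩ => ⟨m, by omega, h4⟩⟩
    rcases Nat.lt_succ_iff_lt_or_eq.mp h3 with h5 | rfl
    · exact ⟨m, h5, h4⟩
    · exact absurd h4 (h s)
  simp only [createdBefore, destroyedBefore, key, and_self]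

/-- A TRANSFER that returns `False` is invalid in the sequential object at its linearization
point. -/
theorem LinearizedAt.invalid {s n p o} (hF : NoSpendingInFlight E) (h : LinearizedAt E s n)
    (hd : ¬ DestroysAt E s n) (hi : E.Invokes s p o) :
    ¬ (p ∈ P.μ o.key ∧ (pour o).Verify ∧ o.source ∈ createdBefore E n ∧
      o.source ∉ destroyedBefore E n) := by
  rintro ⟨-, hv, hc, hnd⟩
  cases h with
  | destroys h => exact hd h
  | response hi' h1 h2 =>
    obtain ⟨rfl, rfl⟩ := hi.unique hi'
    obtain ⟨m, hm, s₁, q, o₁, h3, h4, h5⟩ := h2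
    exact hnd ⟨s₁, q, o₁, h3, h4, m, hm, h5⟩
  | invocation hi' h1 h2 =>
    obtain ⟨rfl, rfl⟩ := hi.unique hi'
    rcases returns_none hP hA h1 hi with h3 | ⟨m, h3, -, h5, h6⟩ | h3
    · exact h3 hv
    · -- the token would have been created by a TRANSFER that returned before this one began
      rcases hc with hc | ⟨s₁, q, o₁, h7, h8, f, hf, h9⟩
      · exact h5 hc
      obtain ⟨h10, h11, -⟩ := h9.of_invokes h7
      obtain ⟨t', r, h12, h13⟩ := hF s₁ q o₁ s p o h7 hi (by omega) h11 h8
      cases r with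
      | none => exact not_destroysAt_of_returns_none hP hA h13 h9
      | some T =>
        obtain ⟨-, m', hm', ha⟩ := returns_some h13 h7
        exact h6 s₁ q o₁ m' h7 h8 ha (by omega)
    · exact h2 h3

theorem linearizable (hF : NoSpendingInFlight E) :
    Execution.Linearizable (anonAT P.μ P.v₀).toSpec E := by
  classical
  let pos : ℕ → Option ℕ := fun s =>
    if h : ∃ n, LinearizedAt E s n then some h.choose else none
  have hpos : ∀ s n, pos s = some n ↔ LinearizedAt E s n := by
    intro s n
    simp only [pos]
    split_ifs with h
    · simp only [Option.some.injEq]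
      exact ⟨fun h1 => h1 ▸ h.choose_spec, fun h1 => h.choose_spec.unique hP hA h1⟩
    · simp only [false_iff]
      exact fun h1 => h ⟨n, h1⟩
  let R : ℕ → Proc × TransferOp W × Option (Token W) → Prop := fun n x =>
    ∃ s, LinearizedAt E s n ∧ E.Invokes s x.1 x.2.1 ∧
      x.2.2 = if DestroysAt E s n then some (pour x.2.1).created else none
  have hR : ∀ n x y, R n x → R n y → x = y := by
    rintro n ⟨p, o, r⟩ ⟨p', o', r'⟩ ⟨s, h1, h2, h3⟩ ⟨s', h4, h5, h6⟩
    obtain rfl := h1.unique_op hP hA h4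
    obtain ⟨rfl, rfl⟩ := h2.unique h5
    simp only at h3 h6
    rw [h3, h6]
  let S : ℕ → Option (Proc × TransferOp W × Option (Token W)) := fun n =>
    if h : ∃ x, R n x then some h.choose else none
  have hS : ∀ n x, S n = some x ↔ R n x := by
    intro n x
    simp only [S]
    split_ifs with h
    · simp only [Option.some.injEq]
      exact ⟨fun h1 => h1 ▸ h.choose_spec, fun h1 => hR n _ _ h.choose_spec h1⟩
    · simp only [false_iff]
      exact fun h1 => h ⟨x, h1⟩
  refine ⟨S, pos, ⟨fun n => (createdBefore E n, destroyedBefore E n), ?_, fun n => ?_⟩, ?_, ?_, ?_,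
    ?_, ?_⟩
  · simp [createdBefore, destroyedBefore, anonAT]
    exact Set.mem_singleton _
  · cases hn : S n with
    | none =>
      have hnot : ∀ s, ¬ DestroysAt E s n := by
        intro s hd
        obtain ⟨p, o, hi⟩ := hd.invokes
        have := (hS n (p, o, if DestroysAt E s n then some (pour o).created else none)).2 ⟨s, .destroys hd, hi, rfl⟩
        rw [hn] at this
        cases this
      obtain ⟨h1, h2⟩ := before_succ_of_not hnot
      exact Prod.ext h1 h2
    | some x =>
      obtain ⟨p, o, r⟩ := x
      obtain ⟨s, h1, h2, h3⟩ := (hS _ _).1 hn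
      simp only at h2 h3
      by_cases hd : DestroysAt E s n
      · left
        obtain ⟨h4, h5, -⟩ := hd.of_invokes h2
        refine ⟨⟨hA s p o h2, h5, ?_, ?_⟩, by rw [h3, if_pos hd],
          Prod.ext (createdBefore_succ hP hA hd h2) (destroyedBefore_succ hP hA hd h2)⟩
        · refine (hd.source_exists hP hA h2).imp_right ?_
          rintro ⟨s₁, q, o₁, m, h6, h7, h8, h9⟩
          obtain ⟨f, hf, h10⟩ := h8.destroysAt hP hA
          exact ⟨s₁, q, o₁, h6, h7, f, by omega, h10⟩
        · rintro ⟨s₁, q, o₁, h6, h7, m, h8, h9⟩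
          obtain rfl := hd.unique_source hP hA h9 h2 h6 h7.symm
          obtain rfl := hd.unique h9
          omega
      · right
        have hnot : ∀ s', ¬ DestroysAt E s' n := by
          intro s' hd'
          obtain rfl := h1.unique_op hP hA (.destroys hd')
          exact hd hd'
        obtain ⟨h4, h5⟩ := before_succ_of_not hnot
        exact ⟨h1.invalid hP hA hF hd h2, by rw [h3, if_neg hd], Prod.ext h4 h5⟩
  · intro s n h
    rw [hpos] at h
    obtain ⟨p, o, hi⟩ := h.invokes
    refine ⟨p, o, _, hi, (hS n (p, o, if DestroysAt E s n then some (pour o).created else none)).2 ⟨s, h, hi, rfl⟩, fun t r₁ hr => ?_⟩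
    cases r₁ with
    | none => rw [if_neg (not_destroysAt_of_returns_none hP hA hr)]
    | some T =>
      obtain ⟨m, -, hd⟩ := exists_destroysAt_of_returns_some hP hA hr
      obtain rfl := h.unique hP hA (.destroys hd)
      rw [if_pos hd, (returns_some hr hi).1]
  · intro s p t r h
    obtain ⟨n, -, hn⟩ := exists_linearizedAt hP hA h
    exact ⟨n, (hpos s n).2 hn⟩
  · intro n x h
    obtain ⟨s, h1, -⟩ := (hS n x).1 h
    exact ⟨s, (hpos s n).2 h1⟩
  · intro s₁ s₂ n h1 h2
    rw [hpos] at h1 h2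
    exact h1.unique_op hP hA h2
  · intro s₁ s₂ p t r n₁ n₂ hr ht h1 h2
    rw [hpos] at h1 h2
    obtain ⟨n, hn, h3⟩ := exists_linearizedAt hP hA hr
    obtain rfl := h1.unique hP hA h3
    have := h2.le
    omega

end Admissible

end Transfer

/-! ### Renaming the tokens of an execution -/

section Rename

theorem ListRes.map_eq_ok {Proc S S₁ : Type} {f : S → S₁} {r : ListRes Proc S} :
    ListRes.map f r = .ok ↔ r = .ok := by cases r <;> simp [ListRes.map]

theorem ListRes.map_eq_fail {Proc S S₁ : Type} {f : S → S₁} {r : ListRes Proc S} :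
    ListRes.map f r = .fail ↔ r = .fail := by cases r <;> simp [ListRes.map]

theorem ListOp.map_eq_prove {S : Type} {f : S ≃ S} {o : ListOp S} {x : S} :
    ListOp.map f o = .prove x ↔ o = .prove (f.symm x) := by
  cases o <;> simp [ListOp.map, Equiv.eq_symm_apply]

theorem ListOp.map_eq_append {S : Type} {f : S ≃ S} {o : ListOp S} {x : S} :
    ListOp.map f o = .append x ↔ o = .append (f.symm x) := by
  cases o <;> simp [ListOp.map, Equiv.eq_symm_apply]

theorem ListOp.map_eq_read {S : Type} {f : S ≃ S} {o : ListOp S} :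
    ListOp.map f o = .read ↔ o = .read := by
  cases o <;> simp [ListOp.map]

/-- The DenyList treats all elements alike. -/
theorem DenyListLegal.rename {Proc S : Type} {managers verifiers : Finset Proc} (f : S ≃ S)
    {h h' : History Proc (ListOp S) (ListRes Proc S)} (hL : DenyListLegal managers verifiers h)
    (hh : ∀ t p o r, h' t = some (p, o, r) ↔
      ∃ o₀ r₀, h t = some (p, o₀, r₀) ∧ ListOp.map f o₀ = o ∧ ListRes.map f r₀ = r) :
    DenyListLegal managers verifiers h' := by
  have hap : ∀ t p x r, h' t = some (p, .append x, r) ↔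
      ∃ r₀, h t = some (p, .append (f.symm x), r₀) ∧ ListRes.map f r₀ = r := by
    intro t p x r
    simp only [hh, ListOp.map_eq_append]
    exact ⟨fun ⟨_, r₀, h1, h2, h3⟩ => ⟨r₀, h2 ▸ h1, h3⟩, fun ⟨r₀, h1, h3⟩ => ⟨_, r₀, h1, rfl, h3⟩⟩
  have hpr : ∀ t p x r, h' t = some (p, .prove x, r) ↔
      ∃ r₀, h t = some (p, .prove (f.symm x), r₀) ∧ ListRes.map f r₀ = r := by
    intro t p x r
    simp only [hh, ListOp.map_eq_prove]
    exact ⟨fun ⟨_, r₀, h1, h2, h3⟩ => ⟨r₀, h2 ▸ h1, h3⟩, fun ⟨r₀, h1, h3⟩ => ⟨_, r₀, h1, rfl, h3⟩⟩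
  have hok : ∀ t p x, h' t = some (p, .prove x, .ok) ↔ h t = some (p, .prove (f.symm x), .ok) := by
    intro t p x
    simp only [hpr, ListRes.map_eq_ok]
    exact ⟨fun ⟨_, h1, h2⟩ => h2 ▸ h1, fun h1 => ⟨_, h1, rfl⟩⟩
  have hfail : ∀ t p x,
      h' t = some (p, .prove x, .fail) ↔ h t = some (p, .prove (f.symm x), .fail) := by
    intro t p x
    simp only [hpr, ListRes.map_eq_fail]
    exact ⟨fun ⟨_, h1, h2⟩ => h2 ▸ h1, fun h1 => ⟨_, h1, rfl⟩⟩
  have haok : ∀ t p x,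
      h' t = some (p, .append x, .ok) ↔ h t = some (p, .append (f.symm x), .ok) := by
    intro t p x
    simp only [hap, ListRes.map_eq_ok]
    exact ⟨fun ⟨_, h1, h2⟩ => h2 ▸ h1, fun h1 => ⟨_, h1, rfl⟩⟩
  refine ⟨fun t p x r h1 => ?_, fun t p x r h1 => ?_, fun t p x h1 => ?_, fun t p x h1 => ?_,
    fun t p x hp h1 u q r htu h2 => ?_, fun t p x h1 => ?_, fun t p r h1 => ?_⟩
  · obtain ⟨r₀, h2, rfl⟩ := (hap ..).1 h1
    rw [ListRes.map_eq_ok, ListRes.map_eq_fail]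
    exact hL.append_valid t p _ r₀ h2
  · obtain ⟨r₀, h2, rfl⟩ := (hpr ..).1 h1
    rw [ListRes.map_eq_ok, ListRes.map_eq_fail]
    exact hL.prove_response t p _ r₀ h2
  · exact hL.prove_verifier t p _ ((hok ..).1 h1)
  · simp only [haok]
    exact hL.prove_valid t p _ ((hfail ..).1 h1)
  · obtain ⟨r₀, h3, rfl⟩ := (hpr ..).1 h2
    rw [ListRes.map_eq_fail]
    exact hL.anti_flickering t p _ hp ((hfail ..).1 h1) u q r₀ htu h3
  · obtain ⟨u, hu⟩ := hL.progress t p _ ((haok ..).1 h1)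
    refine ⟨u, fun v q r huv h2 => ?_⟩
    obtain ⟨r₀, h3, rfl⟩ := (hpr ..).1 h2
    rw [ListRes.map_eq_fail]
    exact hu v q r₀ huv h3
  · obtain ⟨o₀, r₀, h2, h3, rfl⟩ := (hh ..).1 h1
    rw [ListOp.map_eq_read] at h3
    subst h3
    obtain ⟨l, ts, rfl, h4, h5, h6⟩ := hL.read_valid t p r₀ h2
    refine ⟨l.map fun x => (x.1, f x.2), ts, rfl, h4, fun u => ?_, ?_⟩
    · simp only [hok, h5]
      refine and_congr_right fun _ => exists_congr fun q => ?_
      exact (f.symm.surjective.exists (p := fun y => h u = some (q, .prove y, .ok)))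
    · rw [List.forall₂_map_right_iff]
      refine h6.imp fun u y hy => ?_
      rw [hok]
      simpa using hy

end Rename

/-! ### Anonymity -/

section Anonymity

variable {Proc W : Type} [Fintype Proc] [DecidableEq Proc] {P : Params Proc W}
  {E : Execution (transferAlgorithm P)} {k : ℕ}

open Classical in
/-- The transposition of the tokens that the TRANSFER operations `o` and `o₁` destroy. -/
noncomputable def sourceSwap (o o₁ : TransferOp W) : Token W ≃ Token W :=
  Equiv.swap o.source o₁.source

open Classical in
/-- The transposition of the tokens that the TRANSFER operations `o` and `o₁` create. -/
noncomputable def createdSwap (o o₁ : TransferOp W) : Token W ≃ Token W :=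
  Equiv.swap (pour o).created (pour o₁).created

open Classical in
/-- Replace `o` by `o₁`. -/
noncomputable def renameOp (o o₁ o' : TransferOp W) : TransferOp W :=
  if o'.source = o.source then o₁ else o'

open Classical in
/-- The effect of `renameOp` on the material that `pour` computes. -/
noncomputable def renameTx (o o₁ : TransferOp W) (tx : Tx W) : Tx W :=
  if tx.source = o.source then pour o₁ else tx

/-- The effect of `renameOp` on the local states. A token that is about to be returned is one of the
created ones. -/
noncomputable def renameLine (o o₁ : TransferOp W) : Line W → Line W
  | .ready => .ready
  | .testAllow tx => .testAllow (renameTx o o₁ tx)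
  | .testDeny tx => .testDeny (renameTx o o₁ tx)
  | .proveAllow tx => .proveAllow (renameTx o o₁ tx)
  | .proveDeny tx => .proveDeny (renameTx o o₁ tx)
  | .appendDeny tx => .appendDeny (renameTx o o₁ tx)
  | .loop tx => .loop (renameTx o o₁ tx)
  | .elect tx => .elect (renameTx o o₁ tx)
  | .appendAllow tx => .appendAllow (renameTx o o₁ tx)
  | .done r => .done (r.map (createdSwap o o₁))

noncomputable def renameStatus (P : Params Proc W) (o o₁ : TransferOp W) :
    Status (transferAlgorithm P).Loc → Status (transferAlgorithm P).Loc
  | .idle l => .idle (renameLine o o₁ l)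
  | .busy l => .busy (renameLine o o₁ l)

/-- In the AllowList, membership is proven of the tokens to destroy, and the tokens that are created
are appended. -/
noncomputable def renameAllowOp (o o₁ : TransferOp W) : ListOp (Token W) → ListOp (Token W)
  | .append x => .append (createdSwap o o₁ x)
  | .prove x => .prove (sourceSwap o o₁ x)
  | .read => .read

/-- The renaming of the operations on the two lists. -/
noncomputable def renameBaseOp (P : Params Proc W) (o o₁ : TransferOp W) :
    (i : Base) → (P.obj i).Op → (P.obj i).Op
  | .allow => renameAllowOp o o₁
  | .deny => ListOp.map (sourceSwap o o₁)

/-- The renaming of the responses of the two lists. Those of the AllowList contain no tokens, as it is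
never read. -/
noncomputable def renameBaseRes (P : Params Proc W) (o o₁ : TransferOp W) :
    (i : Base) → (P.obj i).Res → (P.obj i).Res
  | .allow => id
  | .deny => ListRes.map (sourceSwap o o₁)

/-- The event that takes the place of an event when `o` is replaced by `o₁`. -/
noncomputable def renameEvent (o o₁ : TransferOp W) :
    Event P.obj (TransferOp W) (Option (Token W)) → Event P.obj (TransferOp W) (Option (Token W))
  | .inv p o' => .inv p (renameOp o o₁ o')
  | .call p i op r => .call p i (renameBaseOp P o o₁ i op) (renameBaseRes P o o₁ i r)
  | .ret p r => .ret p (r.map (createdSwap o o₁))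

/-- The operation `o'` is `o` itself, or it has nothing to do with the tokens of `o` and `o₁`. -/
def Unrelated (o o₁ o' : TransferOp W) : Prop :=
  o' = o ∨ (o'.source ≠ o.source ∧ o'.source ≠ o₁.source ∧ o'.source ≠ (pour o).created ∧
    o'.source ≠ (pour o₁).created)

theorem Instr.call_congr {Proc ι Res Loc : Type} {obj : ι → ObjSpec Proc} {i : ι}
    {op op' : (obj i).Op} {next : (obj i).Res → Loc} (h : op = op') :
    (Instr.call i op next : Instr obj Res Loc) = Instr.call i op' next := by rw [h]

theorem pour_renameOp (o o₁ o' : TransferOp W) :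
    pour (renameOp o o₁ o') = renameTx o o₁ (pour o') := by
  unfold renameOp renameTx
  by_cases h : o'.source = o.source
  · rw [if_pos h, if_pos (by exact h)]
  · rw [if_neg h, if_neg (by exact h)]

theorem Unrelated.source {o o₁ o' : TransferOp W} (h : Unrelated o o₁ o') :
    (renameTx o o₁ (pour o')).source = sourceSwap o o₁ o'.source := by
  classical
  unfold renameTx sourceSwap
  rcases h with rfl | ⟨h1, h2, -⟩
  · rw [if_pos (by rfl), Equiv.swap_apply_left]; rfl
  · rw [if_neg (by exact h1), Equiv.swap_apply_of_ne_of_ne h1 h2]; rfl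

theorem Unrelated.created {o o₁ o' : TransferOp W} (h : Unrelated o o₁ o') :
    (renameTx o o₁ (pour o')).created = createdSwap o o₁ (pour o').created := by
  classical
  unfold renameTx createdSwap
  rcases h with rfl | ⟨h1, h2, -⟩
  · rw [if_pos (by rfl), Equiv.swap_apply_left]
  · rw [if_neg (by exact h1), Equiv.swap_apply_of_ne_of_ne]
    · intro h; injection h; contradiction
    · intro h; injection h; contradiction

theorem Unrelated.verify {o o₁ o' : TransferOp W} (h : Unrelated o o₁ o') (hv : (pour o).Verify)
    (hv₁ : (pour o₁).Verify) : (renameTx o o₁ (pour o')).Verify ↔ (pour o').Verify := by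
  unfold renameTx
  rcases h with rfl | ⟨h1, -⟩
  · rw [if_pos (by rfl)]; exact ⟨fun _ => hv, fun _ => hv₁⟩
  · rw [if_neg (by exact h1)]

omit [DecidableEq Proc] in
theorem chooseLeader_map (choose : Finset Proc → Proc) (f : Token W ≃ Token W)
    (r : ListRes Proc (Token W)) (T : Token W) :
    chooseLeader choose (ListRes.map f r) (f T) = chooseLeader choose r T := by
  cases r with
  | ok => rfl
  | fail => rfl
  | proofs l =>
    refine congrArg choose ?_
    ext q
    simp only [Finset.mem_filter, Finset.mem_univ, true_and, List.mem_map, Prod.mk.injEq,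
      EmbeddingLike.apply_eq_iff_eq]
    exact ⟨fun ⟨⟨a, b⟩, h1, h2, h3⟩ => by simp only at h2 h3; rwa [← h2, ← h3],
      fun h => ⟨(q, T), h, rfl, rfl⟩⟩

/-- The renamed local state makes the renamed access, and the renamed response leads to the renamed
next state. -/
theorem renameLine_call {s p t o o₁ o'} {l : Line W} {i op next} (r : (P.obj i).Res)
    (hu : Unrelated o o₁ o')
    (hl : LineFacts E s p o' t l) (hi : (transferAlgorithm P).instr p l = .call i op next) :
    ∃ next', (transferAlgorithm P).instr p (renameLine o o₁ l) =
        .call i (renameBaseOp P o o₁ i op) next' ∧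
      next' (renameBaseRes P o o₁ i r) = renameLine o o₁ (next r) := by
  have hsrc := hu.source
  have hcr := hu.created
  cases l with
  | ready => cases hi
  | done r => cases hi
  | testAllow tx =>
    obtain ⟨rfl, -⟩ := hl
    cases hi
    refine ⟨_, Instr.call_congr (obj := P.obj) (i := .allow) (congrArg ListOp.prove hsrc), ?_⟩
    cases r <;> rfl
  | testDeny tx =>
    obtain ⟨rfl, -⟩ := hl
    cases hi
    refine ⟨_, Instr.call_congr (obj := P.obj) (i := .deny) (congrArg ListOp.prove hsrc), ?_⟩
    cases r <;> rfl
  | proveAllow tx =>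
    obtain ⟨rfl, -⟩ := hl
    cases hi
    exact ⟨_, Instr.call_congr (obj := P.obj) (i := .allow) (congrArg ListOp.prove hsrc), rfl⟩
  | proveDeny tx =>
    obtain ⟨rfl, -⟩ := hl
    cases hi
    exact ⟨_, Instr.call_congr (obj := P.obj) (i := .deny) (congrArg ListOp.prove hsrc), rfl⟩
  | appendDeny tx =>
    obtain ⟨rfl, -⟩ := hl
    cases hi
    exact ⟨_, Instr.call_congr (obj := P.obj) (i := .deny) (congrArg ListOp.append hsrc), rfl⟩
  | loop tx =>
    obtain ⟨rfl, -⟩ := hl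
    cases hi
    refine ⟨_, Instr.call_congr (obj := P.obj) (i := .deny) (congrArg ListOp.prove hsrc), ?_⟩
    cases r <;> rfl
  | elect tx =>
    obtain ⟨rfl, -⟩ := hl
    cases hi
    refine ⟨_, rfl, ?_⟩
    have hc := chooseLeader_map P.choose (sourceSwap o o₁) r o'.source
    rw [← hsrc] at hc
    simp only [renameBaseRes, hc]
    simp only [show (pour o').source = o'.source from rfl]
    split_ifs <;> rfl
  | appendAllow tx =>
    obtain ⟨rfl, -⟩ := hl
    cases hi
    refine ⟨_, Instr.call_congr (obj := P.obj) (i := .allow) (congrArg ListOp.append hcr), ?_⟩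
    exact congrArg (fun x => Line.done (some x)) hcr

/-- The AllowList is never read, and membership is proven only of sources. -/
theorem allow_call_pending {t p op r} (h : E.event t = some (allowCall p op r)) :
    (∃ T, op = .append T) ∨ ∃ s o, E.Pending s p o t ∧ op = .prove o.source := by
  obtain ⟨l, next, h1, h2, -⟩ := E.status_of_call h
  obtain ⟨s, o, hP⟩ := E.exists_pending_of_busy h1
  obtain ⟨l', h1', hF⟩ := hP.lineFacts
  rw [h1] at h1'
  cases h1'
  cases l <;> cases h2
  · obtain ⟨rfl, h2⟩ := hF
    exact .inr ⟨s, o, hP, rfl⟩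
  · obtain ⟨rfl, h2⟩ := hF
    exact .inr ⟨s, o, hP, rfl⟩
  · exact .inl ⟨_, rfl⟩

theorem Token.out_ne (T : Token W) (w : W) : Token.out T w ≠ T := by
  induction T generalizing w with
  | mint => simp
  | out src w' ih => intro h; injection h with h1 h2; exact ih _ h1

omit [Fintype Proc] [DecidableEq Proc] in
theorem renameEvent_call_iff {o o₁ : TransferOp W} {x p i op' r'} :
    Option.map (renameEvent (P := P) o o₁) x = some (.call p i op' r') ↔
      ∃ op r, x = some (.call p i op r) ∧ renameBaseOp P o o₁ i op = op' ∧
        renameBaseRes P o o₁ i r = r' := by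
  constructor
  · intro h
    obtain ⟨e, rfl, he⟩ := Option.map_eq_some_iff.1 h
    cases e <;> cases he
    exact ⟨_, _, rfl, rfl, rfl⟩
  · rintro ⟨op, r, rfl, rfl, rfl⟩
    rfl

theorem existsBefore_iff (hP : P.Admissible k) (hA : Authorized E) {T s}
    (h : ExistsBefore E T s) : T ∈ initialTokens W P.v₀ ∨
      ∃ u < s, ∃ q, E.event u = some (allowCall q (.append T) .ok) := by
  refine h.imp_right fun ⟨t, ht, q, he⟩ => ?_
  obtain ⟨s', o, hPd, hT, u, r, r₁, h1, h2, -, -, h3⟩ := lineFacts_of_ret he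
  have := allow_append_ok (hP.allowManagers (mem_denyVerifiers hP hA hPd.1)) h3
  subst this
  exact ⟨u, by omega, q, hT ▸ h3⟩

theorem anonymous (hP : P.Admissible k) (hA : Authorized E) : Anonymous E := by
  classical
  intro s p o o₁ hi hv hv₁ hμ hex hex₁ hother H cm sn hcm hsn
  have hun : ∀ s' q o', E.Invokes s' q o' → Unrelated o o₁ o' := by
    intro s' q o' h
    by_cases hs : s' = s
    · subst hs
      exact .inl (h.unique hi).2
    · exact .inr (hother s' q o' h hs)
  have hop : ∀ s' q o', E.Invokes s' q o' → s' ≠ s → renameOp o o₁ o' = o' := by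
    intro s' q o' h hs
    exact if_neg (hother s' q o' h hs).1
  have hops : renameOp o o₁ o = o₁ := if_pos rfl
  -- the source of `o₁` existed before time `s`, hence is not one of the new tokens
  have hne : o₁.source ≠ (pour o).created := by
    intro hc
    rcases existsBefore_iff hP hA hex₁ with ⟨w, i, -, h1⟩ | ⟨u, hu, q, h1⟩
    · rw [hc] at h1; cases h1
    · obtain ⟨s', o', r₁, hPd, h2, -⟩ := allow_append_pending h1
      rw [hc] at h2
      injection h2 with h3 h4
      exact (hother s' q o' hPd.1 (by have := hPd.2.1; omega)).1 h3
  have hne₁ : o₁.source ≠ (pour o₁).created := (Token.out_ne _ _).symm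
  have hinv : ∀ t q o', (E.event t).map (renameEvent o o₁) = some (.inv q o') ↔
      ∃ o'', E.Invokes t q o'' ∧ renameOp o o₁ o'' = o' := by
    intro t q o'
    unfold Execution.Invokes
    constructor
    · intro h
      obtain ⟨e, he, h1⟩ := Option.map_eq_some_iff.1 h
      cases e <;> cases h1
      exact ⟨_, he, rfl⟩
    · rintro ⟨o'', h1, rfl⟩
      rw [h1]; rfl
  have hdeny : ∃ h : History Proc (ListOp (Token W)) (ListRes Proc (Token W)),
      (∀ t q op r, h t = some (q, op, r) ↔
        (E.event t).map (renameEvent o o₁) = some (denyCall q op r)) ∧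
      DenyListLegal P.denyManagers P.denyVerifiers h := by
    obtain ⟨h, hh, hL⟩ := deny_legal E
    have hh' : ∀ t q op r, (h t).map (fun x => (x.1, ListOp.map (sourceSwap o o₁) x.2.1,
        ListRes.map (sourceSwap o o₁) x.2.2)) = some (q, op, r) ↔
        ∃ op₀ r₀, h t = some (q, op₀, r₀) ∧ ListOp.map (sourceSwap o o₁) op₀ = op ∧
          ListRes.map (sourceSwap o o₁) r₀ = r := by
      intro t q op r
      constructor
      · intro h1
        obtain ⟨⟨q, op, r⟩, h2, h3⟩ := Option.map_eq_some_iff.1 h1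
        cases h3
        exact ⟨op, r, h2, rfl, rfl⟩
      · rintro ⟨op₀, r₀, h2, rfl, rfl⟩
        rw [h2]; rfl
    refine ⟨_, fun t q op r => ?_, hL.rename (sourceSwap o o₁) hh'⟩
    refine (hh' ..).trans (Iff.trans ?_ renameEvent_call_iff.symm)
    simp only [hh]
    rfl
  have hallow : ∃ h : History Proc (ListOp (Token W)) (ListRes Proc (Token W)),
      (∀ t q op r, h t = some (q, op, r) ↔
        (E.event t).map (renameEvent o o₁) = some (allowCall q op r)) ∧
      AllowListLegal P.allowManagers P.allowVerifiers (initialTokens W P.v₀) h := by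
    obtain ⟨h, hh, hL⟩ := allow_legal E
    obtain ⟨h', hh'⟩ : ∃ h' : History Proc (ListOp (Token W)) (ListRes Proc (Token W)),
        ∀ t q op r, h' t = some (q, op, r) ↔
          ∃ op₀, h t = some (q, op₀, r) ∧ renameAllowOp o o₁ op₀ = op := by
      refine ⟨fun t => (h t).map fun x => (x.1, renameAllowOp o o₁ x.2.1, x.2.2),
        fun t q op r => ?_⟩
      constructor
      · intro h1
        obtain ⟨⟨q, op, r⟩, h2, h3⟩ := Option.map_eq_some_iff.1 h1
        cases h3
        exact ⟨op, h2, rfl⟩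
      · rintro ⟨op₀, h2, rfl⟩
        beta_reduce
        rw [h2]; rfl
    have hap : ∀ t q x r, h' t = some (q, .append x, r) ↔
        h t = some (q, .append ((createdSwap o o₁).symm x), r) := by
      intro t q x r
      rw [hh']
      constructor
      · rintro ⟨op₀, h1, h2⟩
        cases op₀ <;> cases h2
        rwa [Equiv.symm_apply_apply]
      · intro h1
        exact ⟨_, h1, congrArg ListOp.append (Equiv.apply_symm_apply _ _)⟩
    refine ⟨h', fun t q op r => ?_, fun t q x r h1 => ?_, fun t q x r h1 => ?_,
      fun t q x r h1 => ?_, fun t q r h1 => ?_⟩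
    · refine (hh' ..).trans (Iff.trans ?_ renameEvent_call_iff.symm)
      simp only [hh]
      exact ⟨fun ⟨op₀, h1, h2⟩ => ⟨op₀, r, h1, h2, rfl⟩,
        fun ⟨op₀, r₀, h1, h2, h3⟩ => ⟨op₀, h3 ▸ h1, h2⟩⟩
    · exact hL.append_valid t q _ r ((hap ..).1 h1)
    · obtain ⟨op₀, h2, h3⟩ := (hh' ..).1 h1
      cases op₀ <;> cases h3
      exact hL.prove_response t q _ r h2
    · obtain ⟨op₀, h2, h3⟩ := (hh' ..).1 h1
      cases op₀ <;> cases h3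
      rename_i x
      rw [hL.prove_valid t q _ r h2]
      refine and_congr_right fun _ => ?_
      simp only [hap]
      obtain ⟨T, hT⟩ | ⟨s', o', hPd, hT⟩ := allow_call_pending ((hh ..).1 h2)
      · cases hT
      cases hT
      by_cases hs : s' = s
      · -- both sources existed before the operation began
        subst hs
        obtain ⟨rfl, rfl⟩ := hi.unique hPd.1
        have hlt := hPd.2.1
        have hsw : sourceSwap o o₁ o.source = o₁.source := Equiv.swap_apply_left _ _
        have hcr : (createdSwap o o₁).symm o₁.source = o₁.source := by
          rw [createdSwap, Equiv.symm_swap]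
          exact Equiv.swap_apply_of_ne_of_ne hne hne₁
        rw [hsw, hcr]
        refine iff_of_true ?_ ?_
        · exact (existsBefore_iff hP hA hex).imp_right fun ⟨u, hu, q, he⟩ =>
            ⟨u, by omega, q, (hh ..).2 he⟩
        · exact (existsBefore_iff hP hA hex₁).imp_right fun ⟨u, hu, q, he⟩ =>
            ⟨u, by omega, q, (hh ..).2 he⟩
      · obtain ⟨h4, h5, h6, h7⟩ := hother s' q o' hPd.1 hs
        have hsw : sourceSwap o o₁ o'.source = o'.source := Equiv.swap_apply_of_ne_of_ne h4 h5
        have hcr : (createdSwap o o₁).symm o'.source = o'.source := by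
          rw [createdSwap, Equiv.symm_swap]
          exact Equiv.swap_apply_of_ne_of_ne h6 h7
        rw [hsw, hcr]
    · obtain ⟨op₀, h2, h3⟩ := (hh' ..).1 h1
      cases op₀ <;> cases h3
      obtain ⟨T, hT⟩ | ⟨s', o', hPd, hT⟩ := allow_call_pending ((hh ..).1 h2) <;> cases hT
  let E₁ : Execution (transferAlgorithm P) :=
    { event := fun t => (E.event t).map (renameEvent o o₁)
      status := fun t => renameStatus P o o₁ ∘ E.status t
      status_zero := fun q => by
        show renameStatus P o o₁ (E.status 0 q) = _
        rw [E.status_zero]; rfl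
      step := fun t => by
        have hst := E.step t
        cases he : E.event t with
        | none =>
          rw [he] at hst
          exact congrArg (renameStatus P o o₁ ∘ ·) hst
        | some e =>
          rw [he] at hst
          cases e with
          | inv q o' =>
            obtain ⟨l, h1, h2⟩ := hst
            refine ⟨renameLine o o₁ l, ?_, ?_⟩
            · show renameStatus P o o₁ (E.status t q) = _
              rw [h1]; rfl
            · rw [h2, Function.comp_update]
              congr 1
              have hv' := (hun t q o' he).verify hv hv₁
              have hpr := pour_renameOp o o₁ o'
              dsimp only [transferAlgorithm, renameStatus]
              congr 1
              simp only [hpr, hv']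
              split_ifs <;> rfl
          | call q i op r =>
            obtain ⟨l, next, h1, h2, h3⟩ := hst
            obtain ⟨s', o', hPd⟩ := E.exists_pending_of_busy h1
            obtain ⟨l', hl', hF⟩ := hPd.lineFacts
            rw [h1] at hl'
            cases hl'
            obtain ⟨next', h4, h5⟩ := renameLine_call r (hun s' q o' hPd.1) hF h2
            refine ⟨_, next', ?_, h4, ?_⟩
            · show renameStatus P o o₁ (E.status t q) = _
              rw [h1]; rfl
            · rw [h3, Function.comp_update, h5]; rfl
          | ret q r =>
            obtain ⟨l, l₁, h1, h2, h3⟩ := hst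
            refine ⟨renameLine o o₁ l, renameLine o o₁ l₁, ?_, ?_, ?_⟩
            · show renameStatus P o o₁ (E.status t q) = _
              rw [h1]; rfl
            · cases l <;> cases h2 <;> rfl
            · rw [h3, Function.comp_update]; rfl
      legal := fun i => by
        cases i with
        | allow => exact hallow
        | deny => exact hdeny }
  have hfix : ∀ t q r, (∀ r₁, ¬ E.Returns s p t r₁) → E.event t = some (.ret q r) →
      r.map (createdSwap o o₁) = r := by
    intro t q r hr he
    obtain ⟨s', o', hPd, hF⟩ := lineFacts_of_ret he
    cases r with
    | none => rfl
    | some T =>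
      obtain ⟨rfl, -⟩ := hF
      by_cases hs : s' = s
      · subst hs
        obtain ⟨rfl, rfl⟩ := hi.unique hPd.1
        exact absurd (E.returns_iff.2 ⟨_, hPd, he⟩) (hr _)
      · have h1 := hother s' q o' hPd.1 hs
        refine congrArg some (Equiv.swap_apply_of_ne_of_ne ?_ ?_)
        · intro h; injection h; exact h1.1 ‹_›
        · intro h; injection h; exact h1.2.1 ‹_›
  refine ⟨E₁, cm ∘ createdSwap o o₁, sn ∘ sourceSwap o o₁, ?_, ?_, ?_, ?_, ?_,
    hcm.comp (Equiv.injective _), hsn.comp (Equiv.injective _), ?_, ?_⟩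
  · intro s' q o' h
    obtain ⟨o'', h1, rfl⟩ := (hinv ..).1 h
    by_cases hs : s' = s
    · subst hs
      obtain ⟨rfl, rfl⟩ := hi.unique h1
      rwa [hops]
    · rw [hop s' q o'' h1 hs]
      exact hA s' q o'' h1
  · exact (hinv ..).2 ⟨o, hi, hops⟩
  · intro t q o₂ ht
    refine (hinv ..).trans ⟨?_, fun h => ⟨o₂, h, hop t q o₂ h ht⟩⟩
    rintro ⟨o'', h1, rfl⟩
    rwa [hop t q o'' h1 ht]
  · intro t q r hr
    show (E.event t).map (renameEvent o o₁) = _ ↔ _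
    constructor
    · intro h
      obtain ⟨e, he, h1⟩ := Option.map_eq_some_iff.1 h
      cases e <;> cases h1
      rw [hfix t _ _ hr he, he]
    · intro h
      rw [h]
      exact congrArg (fun x => some (Event.ret q x)) (hfix t q r hr h)
  · intro t
    have hcs : ∀ x, createdSwap o o₁ (createdSwap o o₁ x) = x := Equiv.swap_apply_self _ _
    have hss : ∀ x, sourceSwap o o₁ (sourceSwap o o₁ x) = x := Equiv.swap_apply_self _ _
    show ((E.event t).map (renameEvent o o₁)).map _ = _
    rw [Option.map_map]
    congr 1
    funext e
    cases e with
    | inv q o' => rfl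
    | ret q r => cases r <;> rfl
    | call q i op r =>
      cases i with
      | allow =>
        cases op with
        | append x => exact congrArg (fun y => PublicEvent.allow q (.append (some (cm y))) _) (hcs x)
        | prove x => rfl
        | read => rfl
      | deny =>
        have h1 : ListOp.map (sn ∘ sourceSwap o o₁) (ListOp.map (sourceSwap o o₁) op) =
            ListOp.map sn op := by
          cases op <;> simp [ListOp.map, hss]
        have h2 : ListRes.map (sn ∘ sourceSwap o o₁) (ListRes.map (sourceSwap o o₁) r) =
            ListRes.map sn r := by
          cases r <;> simp [ListRes.map, hss]
        exact congrArg₂ (PublicEvent.deny q) h1 h2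
  · intro T h1 h2
    exact congrArg cm (Equiv.swap_apply_of_ne_of_ne h1 h2)
  · intro T h1 h2
    exact congrArg sn (Equiv.swap_apply_of_ne_of_ne h1 h2)

end Anonymity

/-! ### Bivalence -/

section Bivalence

variable {Proc ι X : Type} {T : ι → ObjType Proc}

/-- The phase of a process in a run of a consensus algorithm in which it proposes exactly once: it has
not begun, it executes its operation, or it has decided `x`. -/
inductive Phase (Loc X : Type)
  | fresh
  | busy (l : Loc)
  | decided (x : X) (l : Loc)

/-- A configuration: the states of all objects and of all processes. -/
@[ext]
structure Cfg (T : ι → ObjType Proc) (Loc X : Type) where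
  obj : ∀ i, (T i).State
  phase : Proc → Phase Loc X

/-- The next step of a process: it changes nothing but its own phase, or it accesses an object. -/
inductive Act (T : ι → ObjType Proc) (Loc X : Type)
  | loc (φ : Phase Loc X)
  | call (i : ι) (o : (T i).Op) (next : (T i).Res → Loc)

/-- A deterministic implementation of an object type. -/
structure ObjType.Impl (T : ObjType Proc) where
  init : T.State
  init_mem : init ∈ T.initial
  next : Proc → T.State → T.Op → T.Res × T.State
  next_trans : ∀ p q o, T.trans p q o (next p q o).1 (next p q o).2

/-- If all processes are about to access the object, and the choice of the one that goes first is
decisive, then there are two processes with different decisions such that the order of their accesses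
makes no difference, or such that the access of the first one is undetectable after that of
the second one. -/
def ObjType.Impl.Weak {T : ObjType Proc} (I : T.Impl) : Prop :=
  ∀ (X : Type) (q : T.State) (o : Proc → T.Op) (c : Proc → X), (∃ p p', c p ≠ c p') →
    ∃ p p', c p ≠ c p' ∧
      (((I.next p q (o p)).1 = (I.next p (I.next p' q (o p')).2 (o p)).1 ∧
        (I.next p' (I.next p q (o p)).2 (o p')).1 = (I.next p' q (o p')).1 ∧
        (I.next p' (I.next p q (o p)).2 (o p')).2 = (I.next p (I.next p' q (o p')).2 (o p)).2) ∨
      I.next p' (I.next p q (o p)).2 (o p') = I.next p' q (o p'))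

variable (A : Algorithm (fun i => (T i).toSpec) X X) (inp : Proc → X) (I : ∀ i, (T i).Impl)

/-- The next step of `p`, which proposes `inp p`, in a given phase. -/
def act (p : Proc) : Phase A.Loc X → Act T A.Loc X
  | .fresh => .loc (.busy (A.begin_ p (inp p) (A.start p)))
  | .busy l =>
    match A.instr p l with
    | .call i o next => .call i o next
    | .ret x l₁ => .loc (.decided x l₁)
  | .decided x l => .loc (.decided x l)

open Classical in
/-- The configuration after a step of `p`; a process that has decided does nothing any more. -/
noncomputable def stepCfg (p : Proc) (C : Cfg T A.Loc X) : Cfg T A.Loc X :=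
  match act A inp p (C.phase p) with
  | .loc φ => ⟨C.obj, Function.update C.phase p φ⟩
  | .call i o next => ⟨Function.update C.obj i ((I i).next p (C.obj i) o).2,
      Function.update C.phase p (.busy (next ((I i).next p (C.obj i) o).1))⟩

/-- The event that the next step of `p` contributes to an execution. -/
def eventOf (p : Proc) (C : Cfg T A.Loc X) : Option (Event (fun i => (T i).toSpec) X X) :=
  match C.phase p with
  | .fresh => some (.inv p (inp p))
  | .busy l =>
    match A.instr p l with
    | .call i o _ => some (.call p i o ((I i).next p (C.obj i) o).1)
    | .ret x _ => some (.ret p x)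
  | .decided _ _ => none

/-- The configuration after `t` steps of the schedule `sch`. -/
noncomputable def run (C : Cfg T A.Loc X) (sch : ℕ → Proc) : ℕ → Cfg T A.Loc X
  | 0 => C
  | t + 1 => stepCfg A inp I (sch t) (run C sch t)

/-- The initial configuration, in which no process has begun. -/
def initCfg : Cfg T A.Loc X := ⟨fun i => (I i).init, fun _ => .fresh⟩

/-- The configuration occurs in a run of the algorithm. -/
def Reachable (C : Cfg T A.Loc X) : Prop := ∃ sch t, C = run A inp I (initCfg A I) sch t

/-- Some process decides `x` in some run that continues the configuration. -/
def MayDecide (C : Cfg T A.Loc X) (x : X) : Prop :=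
  ∃ sch t p l, (run A inp I C sch t).phase p = .decided x l

/-- At least two different values may still be decided. -/
def Bivalent (C : Cfg T A.Loc X) : Prop :=
  ∃ x y, x ≠ y ∧ MayDecide A inp I C x ∧ MayDecide A inp I C y

/-- The status of a process in an execution. -/
def Phase.status (p : Proc) : Phase A.Loc X → Status A.Loc
  | .fresh => .idle (A.start p)
  | .busy l => .busy l
  | .decided _ l => .idle l

variable {A inp I}

theorem stepCfg_loc {p : Proc} {C : Cfg T A.Loc X} {φ} (h : act A inp p (C.phase p) = .loc φ) :
    (stepCfg A inp I p C).obj = C.obj ∧ (stepCfg A inp I p C).phase p = φ := by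
  unfold stepCfg
  rw [h]
  simp

open Classical in
theorem stepCfg_loc_eq {p : Proc} {C : Cfg T A.Loc X} {φ} (h : act A inp p (C.phase p) = .loc φ) :
    stepCfg A inp I p C = ⟨C.obj, Function.update C.phase p φ⟩ := by
  unfold stepCfg
  rw [h]

open Classical in
theorem stepCfg_call {p : Proc} {C : Cfg T A.Loc X} {i o next}
    (h : act A inp p (C.phase p) = .call i o next) :
    stepCfg A inp I p C = ⟨Function.update C.obj i ((I i).next p (C.obj i) o).2,
      Function.update C.phase p (.busy (next ((I i).next p (C.obj i) o).1))⟩ := by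
  unfold stepCfg
  rw [h]

theorem stepCfg_phase_of_ne {p q : Proc} (C : Cfg T A.Loc X) (h : q ≠ p) :
    (stepCfg A inp I p C).phase q = C.phase q := by
  unfold stepCfg
  split <;> simp [h]

theorem run_add (C : Cfg T A.Loc X) (sch : ℕ → Proc) (t m : ℕ) :
    run A inp I C sch (t + m) = run A inp I (run A inp I C sch t) (fun u => sch (t + u)) m := by
  induction m with
  | zero => rfl
  | succ m ih => rw [← add_assoc]; simp only [run, ih]

theorem run_congr (C : Cfg T A.Loc X) {sch sch' : ℕ → Proc} {t : ℕ} (h : ∀ u < t, sch u = sch' u) :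
    run A inp I C sch t = run A inp I C sch' t := by
  induction t with
  | zero => rfl
  | succ t ih => simp only [run]; rw [ih fun u hu => h u (by omega), h t (by omega)]

/-- Two schedules can be performed one after the other. -/
theorem run_splice (C : Cfg T A.Loc X) (sch sch' : ℕ → Proc) (t : ℕ) :
    ∃ sch'' : ℕ → Proc, (∀ m, run A inp I C sch'' (t + m) =
      run A inp I (run A inp I C sch t) sch' m) ∧ ∀ u, sch'' (t + u) = sch' u := by
  have h : ∀ u, (fun u => if u < t then sch u else sch' (u - t)) (t + u) = sch' u := by
    intro u; simp
  refine ⟨fun u => if u < t then sch u else sch' (u - t), fun m => ?_, h⟩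
  rw [run_add, run_congr C (sch' := sch) (fun u hu => by simp [hu])]
  exact run_congr _ fun u _ => h u

theorem Reachable.run {C : Cfg T A.Loc X} (h : Reachable A inp I C) (sch : ℕ → Proc) (t : ℕ) :
    Reachable A inp I (run A inp I C sch t) := by
  obtain ⟨sch₀, t₀, rfl⟩ := h
  obtain ⟨sch₁, h₁, -⟩ := run_splice (A := A) (inp := inp) (I := I) (initCfg A I) sch₀ sch t₀
  exact ⟨sch₁, t₀ + t, (h₁ t).symm⟩

theorem Reachable.step {C : Cfg T A.Loc X} (h : Reachable A inp I C) (p : Proc) :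
    Reachable A inp I (stepCfg A inp I p C) := h.run (fun _ => p) 1

theorem MayDecide.of_run {C : Cfg T A.Loc X} {sch t x}
    (h : MayDecide A inp I (run A inp I C sch t) x) : MayDecide A inp I C x := by
  obtain ⟨sch', t', p, l, h'⟩ := h
  obtain ⟨sch₁, h₁, -⟩ := run_splice (A := A) (inp := inp) (I := I) C sch sch' t
  exact ⟨sch₁, t + t', p, l, by rw [h₁, h']⟩

theorem MayDecide.of_step {C : Cfg T A.Loc X} {p x}
    (h : MayDecide A inp I (stepCfg A inp I p C) x) : MayDecide A inp I C x :=
  MayDecide.of_run (sch := fun _ => p) (t := 1) h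

theorem MayDecide.cases {C : Cfg T A.Loc X} {x} (h : MayDecide A inp I C x) :
    (∃ p l, C.phase p = .decided x l) ∨ ∃ p, MayDecide A inp I (stepCfg A inp I p C) x := by
  obtain ⟨sch, t, p, l, h⟩ := h
  cases t with
  | zero => exact .inl ⟨p, l, h⟩
  | succ t =>
    rw [add_comm, run_add] at h
    exact .inr ⟨sch 0, _, t, p, l, h⟩

/-! ### The executions of a schedule -/

theorem stepCfg_fresh {p : Proc} {C : Cfg T A.Loc X} (h : C.phase p = .fresh) :
    (stepCfg A inp I p C).obj = C.obj ∧
      (stepCfg A inp I p C).phase p = .busy (A.begin_ p (inp p) (A.start p)) :=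
  stepCfg_loc (by rw [h]; rfl)

theorem stepCfg_decided {p : Proc} {C : Cfg T A.Loc X} {x l} (h : C.phase p = .decided x l) :
    stepCfg A inp I p C = C := by
  have h1 := stepCfg_loc (I := I) (show act A inp p (C.phase p) = .loc (.decided x l) by rw [h]; rfl)
  refine Cfg.ext h1.1 (funext fun q => ?_)
  by_cases hq : q = p
  · subst hq; rw [h1.2, h]
  · exact stepCfg_phase_of_ne C hq

theorem act_busy_call {p : Proc} {l : A.Loc} {i o next} (h : A.instr p l = .call i o next) :
    act A inp p (.busy l) = .call i o next := by
  simp only [act, h]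

theorem act_busy_ret {p : Proc} {l : A.Loc} {x l₁} (h : A.instr p l = .ret x l₁) :
    act A inp p (.busy l) = .loc (.decided x l₁) := by
  simp only [act, h]

theorem eventOf_proc {p : Proc} {C : Cfg T A.Loc X} {e} (h : eventOf A inp I p C = some e) :
    e.proc = p := by
  unfold eventOf at h
  split at h
  · cases h; rfl
  · split at h <;> cases h <;> rfl
  · cases h

theorem eventOf_eq_inv {p q : Proc} {C : Cfg T A.Loc X} {x}
    (h : eventOf A inp I p C = some (.inv q x)) : p = q ∧ C.phase p = .fresh ∧ x = inp p := by
  unfold eventOf at h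
  split at h
  · cases h; exact ⟨rfl, by assumption, rfl⟩
  · split at h <;> cases h
  · cases h

theorem eventOf_eq_call {p q : Proc} {C : Cfg T A.Loc X} {i o r}
    (h : eventOf A inp I p C = some (.call q i o r)) : p = q ∧ ∃ l next, C.phase p = .busy l ∧
      A.instr p l = .call i o next ∧ r = ((I i).next p (C.obj i) o).1 := by
  unfold eventOf at h
  split at h
  · cases h
  · split at h
    · cases h; exact ⟨rfl, _, _, by assumption, by assumption, rfl⟩
    · cases h
  · cases h

theorem eventOf_eq_ret {p q : Proc} {C : Cfg T A.Loc X} {x}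
    (h : eventOf A inp I p C = some (.ret q x)) : p = q ∧ ∃ l l₁, C.phase p = .busy l ∧
      A.instr p l = .ret x l₁ := by
  unfold eventOf at h
  split at h
  · cases h
  · split at h
    · cases h
    · cases h; exact ⟨rfl, _, _, by assumption, by assumption⟩
  · cases h

theorem eventOf_eq_none {p : Proc} {C : Cfg T A.Loc X} (h : eventOf A inp I p C = none) :
    ∃ x l, C.phase p = .decided x l := by
  unfold eventOf at h
  split at h
  · cases h
  · split at h <;> cases h
  · exact ⟨_, _, by assumption⟩

/-- The states of an object change only by the accesses to it. -/
theorem stepCfg_obj {p : Proc} {C : Cfg T A.Loc X} {i}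
    (h : ∀ o r, eventOf A inp I p C ≠ some (.call p i o r)) :
    (stepCfg A inp I p C).obj i = C.obj i := by
  classical
  unfold stepCfg
  split
  · rfl
  · rename_i j o next hact
    have hj : j ≠ i := by
      rintro rfl
      unfold act at hact
      split at hact
      · cases hact
      · rename_i l hl
        split at hact
        · rename_i hins
          cases hact
          refine h o ((I j).next p (C.obj j) o).1 ?_
          unfold eventOf
          rw [hl]
          simp only [hins]
        · cases hact
      · cases hact
    simp [hj.symm]

variable [DecidableEq Proc]

variable (A inp I) in
/-- The execution in which the processes take steps according to a schedule. -/
noncomputable def execution (sch : ℕ → Proc) : Execution A where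
  event t := eventOf A inp I (sch t) (run A inp I (initCfg A I) sch t)
  status t p := ((run A inp I (initCfg A I) sch t).phase p).status A p
  status_zero p := rfl
  step t := by
    set C := run A inp I (initCfg A I) sch t with hC
    have hrun : run A inp I (initCfg A I) sch (t + 1) = stepCfg A inp I (sch t) C := rfl
    rw [hrun]
    have hupd : ∀ v, ((stepCfg A inp I (sch t) C).phase (sch t)).status A (sch t) = v →
        (fun p => ((stepCfg A inp I (sch t) C).phase p).status A p) =
          Function.update (fun p => (C.phase p).status A p) (sch t) v := by
      intro v hv
      funext q
      by_cases hq : q = sch t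
      · subst hq; rw [hv]; simp
      · rw [stepCfg_phase_of_ne C hq]; simp [hq]
    cases he : eventOf A inp I (sch t) C with
    | none =>
      obtain ⟨x, l, hx⟩ := eventOf_eq_none he
      rw [stepCfg_decided hx]
      rfl
    | some e =>
      cases e with
      | inv q x =>
        obtain ⟨rfl, h1, rfl⟩ := eventOf_eq_inv he
        exact ⟨A.start (sch t), congrArg (Phase.status A (sch t)) h1, hupd _ (by rw [(stepCfg_fresh h1).2]; rfl)⟩
      | call q i o r =>
        obtain ⟨rfl, l, next, h1, h2, rfl⟩ := eventOf_eq_call he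
        refine ⟨l, next, congrArg (Phase.status A (sch t)) h1, h2, hupd _ ?_⟩
        rw [stepCfg_call (by rw [h1]; exact act_busy_call h2)]
        simp only [Function.update_self]
        rfl
      | ret q x =>
        obtain ⟨rfl, l, l₁, h1, h2⟩ := eventOf_eq_ret he
        refine ⟨l, l₁, congrArg (Phase.status A (sch t)) h1, h2, hupd _ ?_⟩
        rw [(stepCfg_loc (by rw [h1]; exact act_busy_ret h2)).2]
        rfl
  legal i := by
    classical
    let ev := fun t => eventOf A inp I (sch t) (run A inp I (initCfg A I) sch t)
    let h : ℕ → Option (Proc × (T i).Op × (T i).Res) := fun t =>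
      if hx : ∃ x : Proc × (T i).Op × (T i).Res, ev t = some (.call x.1 i x.2.1 x.2.2)
      then some hx.choose else none
    have hh : ∀ t p o r, h t = some (p, o, r) ↔ ev t = some (.call p i o r) := by
      intro t p o r
      simp only [h]
      split_ifs with hx
      · have hs := hx.choose_spec
        generalize hx.choose = y at hs
        obtain ⟨p', o', r'⟩ := y
        simp only at hs
        rw [hs]
        constructor
        · intro h1; cases h1; rfl
        · intro h1; cases h1; rfl
      · simp only [false_iff]
        exact fun h1 => hx ⟨(p, o, r), h1⟩
    refine ⟨h, hh, fun t => (run A inp I (initCfg A I) sch t).obj i, (I i).init_mem, fun t => ?_⟩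
    cases hc : h t with
    | none =>
      refine stepCfg_obj fun o r he => ?_
      rw [(hh t _ o r).2 he] at hc
      cases hc
    | some x =>
      obtain ⟨p, o, r⟩ := x
      obtain ⟨hp, l, next, h1, h2, rfl⟩ := eventOf_eq_call ((hh ..).1 hc)
      subst hp
      show (T i).trans _ _ _ _ ((stepCfg A inp I (sch t) _).obj i)
      rw [stepCfg_call (by rw [h1]; exact act_busy_call h2)]
      simp only [Function.update_self]
      exact (I i).next_trans _ _ _

theorem phase_ne_fresh {C : Cfg T A.Loc X} {sch : ℕ → Proc} {p t u} (htu : t ≤ u)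
    (h : (run A inp I C sch t).phase p ≠ .fresh) : (run A inp I C sch u).phase p ≠ .fresh := by
  induction u, htu using Nat.le_induction with
  | base => exact h
  | succ u _ ih =>
    show (stepCfg A inp I (sch u) _).phase p ≠ _
    by_cases hp : p = sch u
    · subst hp
      cases hph : (run A inp I C sch u).phase (sch u) with
      | fresh => exact absurd hph ih
      | busy l =>
        cases hins : A.instr (sch u) l with
        | call i o next =>
          rw [stepCfg_call (by rw [hph]; exact act_busy_call hins)]
          simp
        | ret x l₁ =>
          rw [(stepCfg_loc (by rw [hph]; exact act_busy_ret hins)).2]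
          simp
      | decided x l => rw [stepCfg_decided hph, hph]; simp
    · rwa [stepCfg_phase_of_ne _ hp]

theorem phase_decided {C : Cfg T A.Loc X} {sch : ℕ → Proc} {p x l t u} (htu : t ≤ u)
    (h : (run A inp I C sch t).phase p = .decided x l) :
    (run A inp I C sch u).phase p = .decided x l := by
  induction u, htu using Nat.le_induction with
  | base => exact h
  | succ u _ ih =>
    show (stepCfg A inp I (sch u) _).phase p = _
    by_cases hp : p = sch u
    · subst hp; rw [stepCfg_decided ih, ih]
    · rwa [stepCfg_phase_of_ne _ hp]

theorem execution_invokes {sch : ℕ → Proc} {s p x} (h : (execution A inp I sch).Invokes s p x) :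
    sch s = p ∧ (run A inp I (initCfg A I) sch s).phase p = .fresh ∧ x = inp p := by
  obtain ⟨rfl, h'⟩ := eventOf_eq_inv h
  exact ⟨rfl, h'⟩

theorem execution_invokes_once {sch : ℕ → Proc} {s₁ s₂ p x₁ x₂}
    (h₁ : (execution A inp I sch).Invokes s₁ p x₁) (h₂ : (execution A inp I sch).Invokes s₂ p x₂) :
    s₁ = s₂ := by
  have key : ∀ {s₁ s₂ x₁ x₂}, (execution A inp I sch).Invokes s₁ p x₁ →
      (execution A inp I sch).Invokes s₂ p x₂ → ¬ s₁ < s₂ := by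
    intro s₁ s₂ x₁ x₂ h₁ h₂ hlt
    obtain ⟨h1, h2, -⟩ := execution_invokes h₁
    refine phase_ne_fresh (t := s₁ + 1) hlt ?_ (execution_invokes h₂).2.1
    subst h1
    show (stepCfg A inp I (sch s₁) _).phase (sch s₁) ≠ _
    rw [(stepCfg_fresh h2).2]
    simp
  exact le_antisymm (not_lt.1 (key h₂ h₁)) (not_lt.1 (key h₁ h₂))

theorem exists_ret_of_decided {sch : ℕ → Proc} {t p x l}
    (h : (run A inp I (initCfg A I) sch t).phase p = .decided x l) :
    ∃ u < t, (execution A inp I sch).event u = some (.ret p x) := by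
  induction t with
  | zero => cases h
  | succ t ih =>
    by_cases hp : p = sch t
    · subst hp
      replace h : (stepCfg A inp I (sch t) (run A inp I (initCfg A I) sch t)).phase (sch t) = _ := h
      cases hph : (run A inp I (initCfg A I) sch t).phase (sch t) with
      | fresh => rw [(stepCfg_fresh hph).2] at h; cases h
      | busy l =>
        cases hins : A.instr (sch t) l with
        | call i o next =>
          rw [stepCfg_call (by rw [hph]; exact act_busy_call hins)] at h
          simp at h
        | ret y l₁ =>
          rw [(stepCfg_loc (by rw [hph]; exact act_busy_ret hins)).2] at h
          cases h
          refine ⟨t, by omega, ?_⟩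
          show eventOf A inp I (sch t) _ = _
          unfold eventOf
          rw [hph]
          simp only [hins]
      | decided y l =>
        rw [stepCfg_decided hph, hph] at h
        cases h
        obtain ⟨u, hu, he⟩ := ih hph
        exact ⟨u, by omega, he⟩
    · replace h : (stepCfg A inp I (sch t) (run A inp I (initCfg A I) sch t)).phase p = _ := h
      rw [stepCfg_phase_of_ne _ hp] at h
      obtain ⟨u, hu, he⟩ := ih h
      exact ⟨u, by omega, he⟩

section Solves

variable (hA : A.SolvesConsensus)
include hA

theorem agreement {C : Cfg T A.Loc X} (hC : Reachable A inp I C) {p q x y l l'}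
    (h : C.phase p = .decided x l) (h' : C.phase q = .decided y l') : x = y := by
  obtain ⟨sch, t, rfl⟩ := hC
  obtain ⟨u, -, hu⟩ := exists_ret_of_decided h
  obtain ⟨v, -, hv⟩ := exists_ret_of_decided h'
  exact (hA (execution A inp I sch) fun _ _ _ _ _ => execution_invokes_once).2.1 u v p q x y hu hv

theorem validity {sch : ℕ → Proc} {t p x l}
    (h : (run A inp I (initCfg A I) sch t).phase p = .decided x l) : ∃ s, x = inp (sch s) := by
  obtain ⟨u, -, hu⟩ := exists_ret_of_decided h
  obtain ⟨s, -, q, hs⟩ :=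
    (hA (execution A inp I sch) fun _ _ _ _ _ => execution_invokes_once).2.2 u p x hu
  obtain ⟨rfl, -, h1⟩ := execution_invokes hs
  exact ⟨s, h1⟩

/-- A process that takes infinitely many steps decides. -/
theorem termination {sch : ℕ → Proc} {p} (hp : ∀ m, ∃ t ≥ m, sch t = p) :
    ∃ t x l, (run A inp I (initCfg A I) sch t).phase p = .decided x l := by
  by_contra hc
  push Not at hc
  have hev : ∀ t, sch t = p → ∃ e, (execution A inp I sch).event t = some e ∧ e.proc = p := by
    rintro t rfl
    cases he : (execution A inp I sch).event t with
    | none =>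
      obtain ⟨x, l, h⟩ := eventOf_eq_none he
      exact absurd h (hc t x l)
    | some e => exact ⟨e, rfl, eventOf_proc he⟩
  have hinf : (execution A inp I sch).TakesInfinitelyManySteps p := by
    refine Set.infinite_of_forall_exists_gt fun m => ?_
    obtain ⟨t, ht, h⟩ := hp (m + 1)
    exact ⟨t, hev t h, by omega⟩
  have hinv : ∃ s x, (execution A inp I sch).Invokes s p x := by
    classical
    obtain ⟨t, -, ht⟩ := hp 0
    have hex : ∃ t, sch t = p := ⟨t, ht⟩
    refine ⟨Nat.find hex, inp p, ?_⟩
    have hfresh : ∀ u ≤ Nat.find hex, (run A inp I (initCfg A I) sch u).phase p = .fresh := by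
      intro u
      induction u with
      | zero => intro _; rfl
      | succ u ih =>
        intro hu
        show (stepCfg A inp I (sch u) _).phase p = _
        rw [stepCfg_phase_of_ne _ fun h => Nat.find_min hex hu h.symm]
        exact ih (by omega)
    show eventOf A inp I (sch (Nat.find hex)) _ = _
    rw [Nat.find_spec hex]
    unfold eventOf
    rw [hfresh _ le_rfl]
  obtain ⟨s, x, hs⟩ := hinv
  obtain ⟨t, r, ht⟩ :=
    (hA (execution A inp I sch) fun _ _ _ _ _ => execution_invokes_once).1 s p x hs hinf
  obtain ⟨h1, l, l₁, h2, h3⟩ := eventOf_eq_ret ht.2.2.1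
  refine hc (t + 1) r l₁ ?_
  subst h1
  show (stepCfg A inp I (sch t) _).phase (sch t) = _
  rw [(stepCfg_loc (by rw [h2]; exact act_busy_ret h3)).2]

theorem decides_solo {C : Cfg T A.Loc X} (hC : Reachable A inp I C) (p : Proc) :
    ∃ m x l, (run A inp I C (fun _ => p) m).phase p = .decided x l := by
  obtain ⟨sch, t, rfl⟩ := hC
  obtain ⟨sch', h1, h2⟩ :=
    run_splice (A := A) (inp := inp) (I := I) (initCfg A I) sch (fun _ => p) t
  obtain ⟨u, x, l, hu⟩ := termination (A := A) (inp := inp) (I := I) hA (sch := sch') (p := p)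
    fun m => ⟨t + m, by omega, h2 m⟩
  exact ⟨u, x, l, by rw [← h1]; exact phase_decided (by omega) hu⟩

theorem not_bivalent_of_decided {C : Cfg T A.Loc X} (hC : Reachable A inp I C) {p x l}
    (h : C.phase p = .decided x l) : ¬ Bivalent A inp I C := by
  have key : ∀ y, MayDecide A inp I C y → y = x := by
    rintro y ⟨sch, t, q, l', hq⟩
    exact agreement hA (hC.run sch t) hq (phase_decided (Nat.zero_le t) h)
  rintro ⟨y, z, hyz, hy, hz⟩
  exact hyz ((key y hy).trans (key z hz).symm)

/-- A process that runs alone from the start decides its own proposal. -/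
theorem bivalent_init {p q : Proc} (h : inp p ≠ inp q) : Bivalent A inp I (initCfg A I) := by
  have key : ∀ p, MayDecide A inp I (initCfg A I) (inp p) := by
    intro p
    obtain ⟨m, x, l, hx⟩ := decides_solo hA (C := initCfg A I) ⟨fun _ => p, 0, rfl⟩ p
    obtain ⟨-, rfl⟩ := validity hA hx
    exact ⟨_, m, p, l, hx⟩
  exact ⟨_, _, h, key p, key q⟩

omit [DecidableEq Proc] hA in
/-- The steps of two processes that do not access the same object commute. -/
theorem stepCfg_comm {C : Cfg T A.Loc X} {p p' : Proc} (hne : p ≠ p')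
    (h : ¬ ∃ i, (∃ o next, act A inp p (C.phase p) = .call i o next) ∧
      ∃ o next, act A inp p' (C.phase p') = .call i o next) :
    stepCfg A inp I p' (stepCfg A inp I p C) = stepCfg A inp I p (stepCfg A inp I p' C) := by
  classical
  have h1 := stepCfg_phase_of_ne (I := I) (inp := inp) C hne
  have h2 := stepCfg_phase_of_ne (I := I) (inp := inp) C hne.symm
  cases ha : act A inp p (C.phase p) with
  | loc φ =>
    cases ha' : act A inp p' (C.phase p') with
    | loc φ' =>
      rw [stepCfg_loc_eq (by rw [h2]; exact ha'), stepCfg_loc_eq ha,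
        stepCfg_loc_eq (by rw [h1]; exact ha), stepCfg_loc_eq ha']
      exact Cfg.ext rfl (Function.update_comm hne _ _ _)
    | call i' o' next' =>
      rw [stepCfg_call (by rw [h2]; exact ha'), stepCfg_loc_eq ha,
        stepCfg_loc_eq (by rw [h1]; exact ha), stepCfg_call ha']
      exact Cfg.ext rfl (Function.update_comm hne _ _ _)
  | call i o next =>
    cases ha' : act A inp p' (C.phase p') with
    | loc φ' =>
      rw [stepCfg_loc_eq (by rw [h2]; exact ha'), stepCfg_call ha,
        stepCfg_call (by rw [h1]; exact ha), stepCfg_loc_eq ha']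
      exact Cfg.ext rfl (Function.update_comm hne _ _ _)
    | call i' o' next' =>
      have hi : i ≠ i' := by
        rintro rfl
        exact h ⟨i, ⟨o, next, ha⟩, o', next', ha'⟩
      rw [stepCfg_call (by rw [h2]; exact ha'), stepCfg_call ha,
        stepCfg_call (by rw [h1]; exact ha), stepCfg_call ha']
      simp only [Function.update_of_ne hi, Function.update_of_ne hi.symm]
      exact Cfg.ext (Function.update_comm hi _ _ _) (Function.update_comm hne _ _ _)

omit [DecidableEq Proc] hA in
/-- A process that runs alone does not notice the states of the others. -/
theorem run_solo_congr {C C' : Cfg T A.Loc X} {p : Proc} (hobj : C.obj = C'.obj)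
    (hph : C.phase p = C'.phase p) (m : ℕ) :
    (run A inp I C (fun _ => p) m).obj = (run A inp I C' (fun _ => p) m).obj ∧
    (run A inp I C (fun _ => p) m).phase p = (run A inp I C' (fun _ => p) m).phase p := by
  induction m with
  | zero => exact ⟨hobj, hph⟩
  | succ m ih =>
    obtain ⟨h1, h2⟩ := ih
    simp only [run]
    unfold stepCfg
    rw [h2]
    cases act A inp p ((run A inp I C' (fun _ => p) m).phase p) with
    | loc φ => simp [h1]
    | call i o next => simp [h1]

/-- There is no critical configuration: every bivalent one has a bivalent successor. -/
theorem exists_bivalent_step (hI : ∀ i, (I i).Weak) {C : Cfg T A.Loc X}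
    (hC : Reachable A inp I C) (hb : Bivalent A inp I C) :
    ∃ p, Bivalent A inp I (stepCfg A inp I p C) := by
  classical
  by_contra hcrit
  push Not at hcrit
  have hval : ∀ p, ∃ x, MayDecide A inp I (stepCfg A inp I p C) x := by
    intro p
    obtain ⟨m, x, l, h⟩ := decides_solo hA (hC.step p) p
    exact ⟨x, _, m, p, l, h⟩
  choose c hc using hval
  have huniq : ∀ p x, MayDecide A inp I (stepCfg A inp I p C) x → x = c p := by
    intro p x hx
    by_contra hne
    exact hcrit p ⟨x, c p, hne, hx, hc p⟩
  -- `c p` is the only value that may be decided once `p` has taken the next step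
  obtain ⟨a, b, hab⟩ : ∃ a b, c a ≠ c b := by
    obtain ⟨x, y, hxy, hx, hy⟩ := id hb
    rcases hx.cases with ⟨p, l, h⟩ | ⟨a, ha⟩
    · exact absurd hb (not_bivalent_of_decided hA hC h)
    rcases hy.cases with ⟨p, l, h⟩ | ⟨b, hb'⟩
    · exact absurd hb (not_bivalent_of_decided hA hC h)
    exact ⟨a, b, by rwa [← huniq a x ha, ← huniq b y hb']⟩
  have hcomm : ∀ p p', c p ≠ c p' →
      stepCfg A inp I p' (stepCfg A inp I p C) ≠ stepCfg A inp I p (stepCfg A inp I p' C) := by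
    intro p p' hne heq
    obtain ⟨m, x, l, h⟩ := decides_solo hA ((hC.step p).step p') p
    have hx : MayDecide A inp I (stepCfg A inp I p' (stepCfg A inp I p C)) x := ⟨_, m, p, l, h⟩
    have h1 := huniq p x hx.of_step
    rw [heq] at hx
    exact hne (h1.symm.trans (huniq p' x hx.of_step))
  have hsame : ∀ p p', c p ≠ c p' → ∃ i, (∃ o next, act A inp p (C.phase p) = .call i o next) ∧
      ∃ o next, act A inp p' (C.phase p') = .call i o next := by
    intro p p' hne
    by_contra h
    exact hcomm p p' hne (stepCfg_comm (fun hp => hne (by rw [hp])) h)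
  -- hence all processes are about to access the same object
  obtain ⟨i, ⟨oa, na, ha⟩, ob, nb, hb'⟩ := hsame a b hab
  have hall : ∀ p, ∃ o next, act A inp p (C.phase p) = .call i o next := by
    intro p
    by_cases hpa : c p = c a
    · obtain ⟨j, h1, o, next, h2⟩ := hsame p b (hpa ▸ hab)
      rw [hb'] at h2
      cases h2
      exact h1
    · obtain ⟨j, h1, o, next, h2⟩ := hsame p a hpa
      rw [ha] at h2
      cases h2
      exact h1
  choose o next hact using hall
  obtain ⟨p, p', hne, h⟩ := hI i X (C.obj i) o c ⟨a, b, hab⟩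
  have hpp : p ≠ p' := fun hp => hne (by rw [hp])
  have h1 := stepCfg_phase_of_ne (I := I) (inp := inp) C hpp
  have h2 := stepCfg_phase_of_ne (I := I) (inp := inp) C hpp.symm
  have e1 : stepCfg A inp I p' (stepCfg A inp I p C) = _ :=
    stepCfg_call (by rw [h2]; exact hact p')
  have e2 : stepCfg A inp I p (stepCfg A inp I p' C) = _ :=
    stepCfg_call (by rw [h1]; exact hact p)
  rw [stepCfg_call (hact p)] at e1
  rw [stepCfg_call (hact p')] at e2
  simp only [Function.update_self, Function.update_idem] at e1 e2
  rcases h with ⟨h3, h4, h5⟩ | h3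
  · refine hcomm p p' hne ?_
    rw [stepCfg_call (hact p), stepCfg_call (hact p'), e1, e2, ← h3, h4, h5]
    exact Cfg.ext rfl (@Function.update_comm _ (fun _ _ => Classical.propDecidable _) _ _ _ hpp _ _ _)
  · -- the step of `p` cannot be detected by `p'` running alone
    rw [h3] at e1
    rw [← stepCfg_call (I := I) (hact p)] at e1
    have e3 := stepCfg_call (I := I) (hact p')
    obtain ⟨m, x, l, hx⟩ := decides_solo hA (hC.step p') p'
    have hs := run_solo_congr (A := A) (inp := inp) (I := I)
      (C := stepCfg A inp I p' (stepCfg A inp I p C)) (C' := stepCfg A inp I p' C) (p := p')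
      (by rw [e1, e3]) (by rw [e1, e3]; simp) m
    have hx' : MayDecide A inp I (stepCfg A inp I p' (stepCfg A inp I p C)) x :=
      ⟨_, m, p', l, hs.2.trans hx⟩
    exact hne ((huniq p x hx'.of_step).symm.trans (huniq p' x ⟨_, m, p', l, hx⟩))

/-- From bivalent configurations to bivalent successors, some process takes infinitely many steps
without deciding. -/
theorem false_of_weak [Finite Proc] (hI : ∀ i, (I i).Weak) {p q : Proc} (h : inp p ≠ inp q) :
    False := by
  classical
  have hstep : ∀ C : {C // Reachable A inp I C ∧ Bivalent A inp I C},
      ∃ p, Bivalent A inp I (stepCfg A inp I p C.1) :=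
    fun C => exists_bivalent_step hA hI C.2.1 C.2.2
  choose f hf using hstep
  let seq : ℕ → {C // Reachable A inp I C ∧ Bivalent A inp I C} := fun t =>
    Nat.rec ⟨initCfg A I, ⟨fun _ => p, 0, rfl⟩, bivalent_init hA h⟩
      (fun _ C => ⟨stepCfg A inp I (f C) C.1, C.2.1.step _, hf C⟩) t
  have hrun : ∀ t, run A inp I (initCfg A I) (fun t => f (seq t)) t = (seq t).1 := by
    intro t
    induction t with
    | zero => rfl
    | succ t ih => simp only [run, ih]; rfl
  obtain ⟨r, hr⟩ := Finite.exists_infinite_fiber fun t => f (seq t)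
  obtain ⟨t, x, l, hx⟩ := termination (A := A) (inp := inp) (I := I) hA
    (sch := fun t => f (seq t)) (p := r) fun m => by
      obtain ⟨t, ht, hmt⟩ := (Set.infinite_coe_iff.1 hr).exists_gt m
      exact ⟨t, hmt.le, ht⟩
  rw [hrun] at hx
  exact not_bivalent_of_decided hA (seq t).2.1 hx (seq t).2.2

end Solves

end Bivalence

/-! ### The consensus number is at most `k` -/

section UpperBound

variable {Proc : Type}

/-- The register as a deterministic object. -/
def registerImpl (Proc : Type) {X : Type} (x₀ : X) : (register Proc x₀).Impl where
  init := x₀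
  init_mem := Set.mem_singleton _
  next _ x o :=
    match o with
    | .read => (some x, x)
    | .write z => (none, z)
  next_trans _ x o := by cases o <;> exact ⟨rfl, rfl⟩

/-- A read is undetectable, and so is anything that happens before a write. -/
theorem registerImpl_weak {X : Type} (x₀ : X) : (registerImpl Proc x₀).Weak := by
  rintro Y q o c ⟨p, p', hne⟩
  cases hp : o p with
  | read => exact ⟨p, p', hne, .inr (by rw [hp]; rfl)⟩
  | write z => exact ⟨p', p, hne.symm, .inr (by rw [hp]; rfl)⟩

/-- A TRANSFER is executed successfully in state `q`. -/
def TransferOp.ValidIn {W : Type} (μ : W → Finset Proc) (p : Proc)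
    (q : Set (Token W) × Set (Token W)) (o : TransferOp W) : Prop :=
  p ∈ μ o.key ∧ (pour o).Verify ∧ o.source ∈ q.1 ∧ o.source ∉ q.2

open Classical in
/-- Response and new state of the Anon-AT object. -/
noncomputable def anonATNext {W : Type} (μ : W → Finset Proc) (p : Proc)
    (q : Set (Token W) × Set (Token W)) (o : TransferOp W) :
    Option (Token W) × (Set (Token W) × Set (Token W)) :=
  if o.ValidIn μ p q then
    (some (pour o).created, (insert (pour o).created q.1, insert o.source q.2))
  else (none, q)

/-- The Anon-AT object as a deterministic object. -/
noncomputable def anonATImpl {W : Type} (μ : W → Finset Proc) (v₀ : ℕ) : (anonAT μ v₀).Impl where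
  init := (initialTokens W v₀, ∅)
  init_mem := Set.mem_singleton _
  next := anonATNext μ
  next_trans p q o := by
    show _ ∨ _
    unfold anonATNext
    by_cases h : o.ValidIn μ p q
    · rw [if_pos h]; exact .inl ⟨h, rfl, rfl⟩
    · rw [if_neg h]; exact .inr ⟨h, rfl, rfl⟩

/-- An invalid TRANSFER is undetectable, and valid ones of different tokens commute. More processes
than the wallets have servants cannot all be about to spend the same token. -/
theorem anonATImpl_weak [Fintype Proc] {W : Type} {μ : W → Finset Proc} {v₀ k : ℕ}
    (hμ : ∀ w, (μ w).card ≤ k) (hk : k < Fintype.card Proc) : (anonATImpl μ v₀).Weak := by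
  intro Y (q : Set (Token W) × Set (Token W)) (o : Proc → TransferOp W) c ⟨a, b, hab⟩
  show ∃ p p', c p ≠ c p' ∧
      (((anonATNext μ p q (o p)).1 = (anonATNext μ p (anonATNext μ p' q (o p')).2 (o p)).1 ∧
        (anonATNext μ p' (anonATNext μ p q (o p)).2 (o p')).1 = (anonATNext μ p' q (o p')).1 ∧
        (anonATNext μ p' (anonATNext μ p q (o p)).2 (o p')).2 =
          (anonATNext μ p (anonATNext μ p' q (o p')).2 (o p)).2) ∨
      anonATNext μ p' (anonATNext μ p q (o p)).2 (o p') = anonATNext μ p' q (o p'))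
  by_cases hall : ∀ p, (o p).ValidIn μ p q
  · obtain ⟨p, p', hne, hsrc⟩ : ∃ p p', c p ≠ c p' ∧ (o p).source ≠ (o p').source := by
      by_contra hc
      push Not at hc
      have hsame : ∀ p, (o p).source = (o a).source := by
        intro p
        by_cases h : c p = c a
        · exact (hc p b (h ▸ hab)).trans (hc a b hab).symm
        · exact hc p a h
      have hkey : ∀ p, p ∈ μ (o a).key := by
        intro p
        have h1 : (o p).key = (o p).source.owner := (hall p).2.1
        have h2 : (o a).key = (o a).source.owner := (hall a).2.1
        rw [h2, ← hsame p, ← h1]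
        exact (hall p).1
      have : Fintype.card Proc ≤ k := by
        rw [← Finset.card_univ, ← Finset.eq_univ_iff_forall.2 hkey]
        exact hμ _
      omega
    refine ⟨p, p', hne, .inl ?_⟩
    obtain ⟨h1, h2, h3, h4⟩ := hall p
    obtain ⟨h1', h2', h3', h4'⟩ := hall p'
    have e : anonATNext μ p q (o p) = _ := if_pos (hall p)
    have e' : anonATNext μ p' q (o p') = _ := if_pos (hall p')
    have f : anonATNext μ p (anonATNext μ p' q (o p')).2 (o p) = _ := if_pos (by
      rw [e']
      exact ⟨h1, h2, Set.mem_insert_of_mem _ h3, by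
        rw [Set.mem_insert_iff]; exact not_or.2 ⟨hsrc, h4⟩⟩)
    have f' : anonATNext μ p' (anonATNext μ p q (o p)).2 (o p') = _ := if_pos (by
      rw [e]
      exact ⟨h1', h2', Set.mem_insert_of_mem _ h3', by
        rw [Set.mem_insert_iff]; exact not_or.2 ⟨hsrc.symm, h4'⟩⟩)
    rw [f, f', e, e']
    exact ⟨rfl, rfl, Prod.ext (Set.insert_comm _ _ _) (Set.insert_comm _ _ _)⟩
  · push Not at hall
    obtain ⟨p, hp⟩ := hall
    obtain ⟨p', hp'⟩ : ∃ p', c p ≠ c p' := by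
      by_contra hc
      push Not at hc
      exact hab ((hc a).symm.trans (hc b))
    refine ⟨p, p', hp', .inr ?_⟩
    have e : anonATNext μ p q (o p) = _ := if_neg hp
    rw [e]

/-- More than `k` processes cannot reach consensus. -/
theorem not_consensusSolvable {X : Type} [Nontrivial X] {n k v₀ : ℕ} (hk : 1 ≤ k) (hn : k < n) :
    ¬ ConsensusSolvable X n (IsKAnonAT k v₀) := by
  rintro ⟨ι, obj, A, hobj, hA⟩
  have hT : ∀ i, ∃ T : ObjType (Fin n), obj i = T.toSpec ∧ ∃ I : T.Impl, I.Weak := by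
    intro i
    rcases hobj i with ⟨Y, y₀, h⟩ | ⟨W, -, μ, h1, -, h⟩
    · exact ⟨_, h, _, registerImpl_weak y₀⟩
    · exact ⟨_, h, _, anonATImpl_weak h1 (by simpa using hn)⟩
  choose T hT I hI using hT
  obtain rfl : obj = fun i => (T i).toSpec := funext hT
  obtain ⟨x, y, hxy⟩ := exists_pair_ne X
  let a : Fin n := ⟨0, by omega⟩
  let b : Fin n := ⟨1, by omega⟩
  refine false_of_weak (A := A) (I := I) (inp := fun p => if p = a then x else y) hA hI
    (p := a) (q := b) ?_
  have : b ≠ a := by simp [a, b]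
  simpa [this] using hxy

end UpperBound

/-! ### Consensus from a `k`-Anon-AT object -/

section LowerBound

/-- The number of transfers that led to the token. -/
def Token.depth {W : Type} : Token W → ℕ
  | .mint _ _ => 0
  | .out T _ => T.depth + 1

/-- The second token comes from the first one by transfers. -/
inductive Token.Descends {W : Type} (T : Token W) : Token W → Prop
  | refl : Token.Descends T T
  | out {T' : Token W} (h : Token.Descends T T') (w : W) : Token.Descends T (.out T' w)

theorem Token.Descends.trans {W : Type} {T T' T'' : Token W} (h : T.Descends T')
    (h' : T'.Descends T'') : T.Descends T'' := by
  induction h' with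
  | refl => exact h
  | out _ w ih => exact ih.out w

theorem Token.Descends.depth_le {W : Type} {T T' : Token W} (h : T.Descends T') :
    T.depth ≤ T'.depth := by
  induction h with
  | refl => rfl
  | out _ w ih => exact ih.trans (Nat.le_succ _)

theorem Token.Descends.eq_or_depth_lt {W : Type} {T T' : Token W} (h : T.Descends T') :
    T = T' ∨ T.depth < T'.depth := by
  cases h with
  | refl => exact .inl rfl
  | out h w => exact .inr (Nat.lt_succ_of_le h.depth_le)

/-- The recipient of the first transfer of a sequence of transfers that leads to the token and then
transfers it to `p`. -/
def Token.firstRecipient {W : Type} : Token W → W → W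
  | .mint _ _, p => p
  | .out T w, _ => T.firstRecipient w

variable {k : ℕ}

/-- The tokens that come from `T` by `n` transfers. -/
def tokenLevel (T : Token (Fin k)) : ℕ → List (Token (Fin k))
  | 0 => [T]
  | n + 1 => (tokenLevel T n).flatMap fun T' => (List.finRange k).map (Token.out T')

theorem mem_tokenLevel {T T' : Token (Fin k)} {n : ℕ} :
    T' ∈ tokenLevel T n ↔ T.Descends T' ∧ T'.depth = T.depth + n := by
  induction n generalizing T' with
  | zero =>
    simp only [tokenLevel, List.mem_singleton, add_zero]
    refine ⟨fun h => h ▸ ⟨.refl, rfl⟩, fun ⟨h1, h2⟩ => ?_⟩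
    rcases h1.eq_or_depth_lt with h | h
    · exact h.symm
    · omega
  | succ n ih =>
    simp only [tokenLevel, List.mem_flatMap, List.mem_map, List.mem_finRange, true_and, ih]
    constructor
    · rintro ⟨T₁, ⟨h1, h2⟩, w, rfl⟩
      exact ⟨h1.out w, by simp only [Token.depth]; omega⟩
    · rintro ⟨h1, h2⟩
      cases h1 with
      | refl => omega
      | out h w =>
        simp only [Token.depth] at h2
        exact ⟨_, ⟨h, by omega⟩, w, rfl⟩

variable [NeZero k]

/-- The token with which the wallets compete. -/
def rootToken (k : ℕ) [NeZero k] : Token (Fin k) := .mint 0 0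

/-- All tokens that come from the root by less than `k` transfers, in the order of their depths. -/
def candidates (k : ℕ) [NeZero k] : List (Token (Fin k)) :=
  (List.range k).flatMap (tokenLevel (rootToken k))

theorem mem_candidates {T : Token (Fin k)} :
    T ∈ candidates k ↔ (rootToken k).Descends T ∧ T.depth < k := by
  have h0 : (rootToken k).depth = 0 := rfl
  simp only [candidates, List.mem_flatMap, List.mem_range, mem_tokenLevel, h0, zero_add]
  exact ⟨fun ⟨n, hn, h1, h2⟩ => ⟨h1, h2 ▸ hn⟩, fun ⟨h1, h2⟩ => ⟨_, h2, h1, rfl⟩⟩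

theorem candidates_sorted : (candidates k).Pairwise fun T T' => T.depth ≤ T'.depth := by
  rw [candidates, List.pairwise_flatMap]
  refine ⟨fun n _ => ?_, ?_⟩
  · refine List.pairwise_of_forall_mem_list fun T hT T' hT' => ?_
    rw [(mem_tokenLevel.1 hT).2, (mem_tokenLevel.1 hT').2]
  · refine List.pairwise_lt_range.imp fun {m n} hmn T hT T' hT' => ?_
    rw [(mem_tokenLevel.1 hT).2, (mem_tokenLevel.1 hT').2]
    omega

/-- One Anon-AT object, all of whose wallets are served by all processes, and one register for each
process. -/
def consensusObj (k v₀ : ℕ) (X : Type) : Option (Fin k) → ObjSpec (Fin k)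
  | none => (anonAT (fun _ : Fin k => (Finset.univ : Finset (Fin k))) v₀).toSpec
  | some _ => (register (Fin k) (none : Option X)).toSpec

/-- Program points of the consensus algorithm; `x` is the proposal, and `done x` carries the decision.
An argument `l` lists the tokens still to be tried, and `w` is the process that came first. -/
inductive ConsensusLine (k : ℕ) (X : Type)
  | ready
  | write (x : X)
  | search (x : X) (l : List (Token (Fin k)))
  | read (x : X) (w : Fin k)
  | done (x : X)

/-- A process publishes its proposal in its register. It then tries to transfer the root or one of
its descendants to its own wallet, until it succeeds for the first time. The wallet that received
the root, or that is about to receive it, belongs to the process whose proposal is decided.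
The value `x₀` is returned only in a local state that no pending operation reaches. -/
noncomputable def tokenConsensus (k v₀ : ℕ) [NeZero k] {X : Type} (x₀ : X) :
    Algorithm (consensusObj k v₀ X) X X where
  Loc := ConsensusLine k X
  start _ := .ready
  begin_ _ x _ := .write x
  instr p l :=
    match l with
    | .ready => .ret x₀ .ready
    | .write x => .call (some p) (RegisterOp.write (some x)) fun _ => .search x (candidates k)
    | .search x [] => .ret x .ready
    | .search x (T :: l) => .call none (⟨T, p, T.owner⟩ : TransferOp (Fin k))
        fun r : Option (Token (Fin k)) =>
          match r with
          | some _ => .read x (T.firstRecipient p)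
          | none => .search x l
    | .read x w => .call (some w) RegisterOp.read fun r : Option (Option X) =>
        match r with
        | some (some y) => .done y
        | _ => .done x
    | .done x => .ret x (.done x)

variable {v₀ : ℕ} {X : Type} {x₀ : X}

/-- What the status of `p` at time `t` tells, if `created` is the set of the tokens created so far,
`reg` are the contents of the registers, and `c` is the last descendant of the root. -/
def StatusOK (E : Execution (tokenConsensus k v₀ x₀)) (created : Set (Token (Fin k)))
    (reg : Fin k → Option X) (c : Token (Fin k)) (t : ℕ) (p : Fin k) :
    Status (ConsensusLine k X) → Prop
  | .busy .ready => False
  | .busy (.write x) => ∃ s < t, E.Invokes s p x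
  | .busy (.search _ l) => reg p ≠ none ∧ l.Pairwise (fun T T' => T.depth ≤ T'.depth) ∧
      (∀ T ∈ l, (rootToken k).Descends T) ∧ ∀ T, c.Descends T → T.depth < k → T ∈ l
  | .busy (.read _ w) => .out (rootToken k) w ∈ created
  | .busy (.done y) => ∃ w, .out (rootToken k) w ∈ created ∧ ∃ s < t, E.Invokes s w y
  | .idle .ready => True
  | .idle (.done _) => ∃ s < t, ∃ x, E.Invokes s p x
  | .idle _ => False

/-- The process has succeeded with a transfer. -/
def HasMoved : Status (ConsensusLine k X) → Prop
  | .busy (.read _ _) => True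
  | .busy (.done _) => True
  | .idle (.done _) => True
  | _ => False

/-- The invariant of the consensus algorithm; `c` is the last descendant of the root, and `S` is the
set of the processes that have succeeded with a transfer. -/
structure ConsensusInv (E : Execution (tokenConsensus k v₀ x₀))
    (q : Set (Token (Fin k)) × Set (Token (Fin k))) (reg : Fin k → Option X) (t : ℕ)
    (c : Token (Fin k)) (S : Finset (Fin k)) : Prop where
  created : c ∈ q.1
  descends : (rootToken k).Descends c
  unique : ∀ T ∈ q.1, T ∉ q.2 → (rootToken k).Descends T → T = c
  destroyed : ∀ T ∈ q.2, (rootToken k).Descends T → T.depth < c.depth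
  first_created : c ≠ rootToken k → ∀ p, .out (rootToken k) (c.firstRecipient p) ∈ q.1
  first_unique : ∀ w w', .out (rootToken k) w ∈ q.1 → .out (rootToken k) w' ∈ q.1 → w = w'
  first_destroyed : ∀ w, .out (rootToken k) w ∈ q.1 → rootToken k ∈ q.2
  written : ∀ w, .out (rootToken k) w ∈ q.1 → reg w ≠ none
  proposed : ∀ w y, reg w = some y → ∃ s < t, E.Invokes s w y
  card : S.card = c.depth
  moved : ∀ p ∈ S, HasMoved (E.status t p)
  status : ∀ p, StatusOK E q.1 reg c t p (E.status t p)

theorem StatusOK.mono {E : Execution (tokenConsensus k v₀ x₀)} {created created' reg reg' c c' t t'}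
    {p : Fin k} {st : Status (ConsensusLine k X)} (h : StatusOK E created reg c t p st)
    (hcr : created ⊆ created') (hreg : ∀ w, reg w ≠ none → reg' w ≠ none) (hc : c.Descends c')
    (ht : t ≤ t') : StatusOK E created' reg' c' t' p st := by
  cases st with
  | idle l =>
    cases l with
    | ready => trivial
    | done y => obtain ⟨s, hs, h⟩ := h; exact ⟨s, by omega, h⟩
    | _ => exact h
  | busy l =>
    cases l with
    | ready => exact h
    | write x => obtain ⟨s, hs, h⟩ := h; exact ⟨s, by omega, h⟩
    | search x l =>
      obtain ⟨h1, h2, h3, h4⟩ := h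
      exact ⟨hreg _ h1, h2, h3, fun T hT => h4 T (hc.trans hT)⟩
    | read x w => exact hcr h
    | done y =>
      obtain ⟨w, hw, s, hs, h⟩ := h
      exact ⟨w, hcr hw, s, by omega, h⟩

/-- A process that is still searching finds the last descendant of the root among the tokens that
it has not yet tried, since each transfer was performed by another process. -/
theorem ConsensusInv.mem_search {E : Execution (tokenConsensus k v₀ x₀)} {q reg t c S}
    (h : ConsensusInv E q reg t c S) {p : Fin k} {x l} (hp : E.status t p = .busy (.search x l)) :
    c ∈ l := by
  have h1 := h.status p
  rw [hp] at h1
  refine h1.2.2.2 c .refl ?_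
  have hpS : p ∉ S := fun hpS => by
    have := h.moved p hpS
    rw [hp] at this
    exact this
  rw [← h.card]
  have := Finset.card_lt_univ_of_notMem hpS
  simpa using this

theorem anonAT_states (E : Execution (tokenConsensus k v₀ x₀)) :
    ∃ σ : ℕ → Set (Token (Fin k)) × Set (Token (Fin k)), σ 0 = (initialTokens (Fin k) v₀, ∅) ∧
      (∀ t p (o : TransferOp (Fin k)) (r : Option (Token (Fin k))),
        E.event t = some (.call p none o r) →
        (anonAT (fun _ : Fin k => (Finset.univ : Finset (Fin k))) v₀).trans p (σ t) o r
          (σ (t + 1))) ∧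
      ∀ t, (∀ p o r, E.event t ≠ some (.call p none o r)) → σ (t + 1) = σ t := by
  obtain ⟨h, hh, σ, h0, hσ⟩ := E.legal none
  refine ⟨σ, h0, fun t p o r he => ?_, fun t he => ?_⟩
  · have := hσ t
    rw [(hh t p o r).2 he] at this
    exact this
  · have := hσ t
    cases hc : h t with
    | none => rw [hc] at this; exact this
    | some x => exact absurd ((hh t x.1 x.2.1 x.2.2).1 hc) (he _ _ _)

theorem register_states (E : Execution (tokenConsensus k v₀ x₀)) (w : Fin k) :
    ∃ ρ : ℕ → Option X, ρ 0 = none ∧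
      (∀ t p (o : RegisterOp (Option X)) (r : Option (Option X)),
        E.event t = some (.call p (some w) o r) →
        (register (Fin k) (none : Option X)).trans p (ρ t) o r (ρ (t + 1))) ∧
      ∀ t, (∀ p o r, E.event t ≠ some (.call p (some w) o r)) → ρ (t + 1) = ρ t := by
  obtain ⟨h, hh, σ, h0, hσ⟩ := E.legal (some w)
  refine ⟨σ, h0, fun t p o r he => ?_, fun t he => ?_⟩
  · have := hσ t
    rw [(hh t p o r).2 he] at this
    exact this
  · have := hσ t
    cases hc : h t with
    | none => rw [hc] at this; exact this
    | some x => exact absurd ((hh t x.1 x.2.1 x.2.2).1 hc) (he _ _ _)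

theorem consensusInv_zero (hv₀ : 1 ≤ v₀) (E : Execution (tokenConsensus k v₀ x₀)) :
    ConsensusInv E (initialTokens (Fin k) v₀, ∅) (fun _ => none) 0 (rootToken k) ∅ where
  created := ⟨0, 0, hv₀, rfl⟩
  descends := .refl
  unique := by
    rintro T ⟨w, i, -, rfl⟩ - h
    cases h
    rfl
  destroyed := fun T hT => hT.elim
  first_created := fun h => absurd rfl h
  first_unique := by rintro w w' ⟨_, _, _, h⟩; cases h
  first_destroyed := by rintro w ⟨_, _, _, h⟩; cases h
  written := by rintro w ⟨_, _, _, h⟩; cases h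
  proposed := by simp
  card := rfl
  moved := by simp
  status p := by rw [E.status_zero]; trivial

/-- An instant that leaves the state of the Anon-AT object as it is. -/
theorem ConsensusInv.succ {E : Execution (tokenConsensus k v₀ x₀)} {q reg reg' t c S}
    (h : ConsensusInv E q reg t c S) (hreg : ∀ w, reg w ≠ none → reg' w ≠ none)
    (hprop : ∀ w y, reg' w = some y → ∃ s < t + 1, E.Invokes s w y)
    (hst : ∀ p, E.status (t + 1) p = E.status t p ∨
      ((HasMoved (E.status t p) → HasMoved (E.status (t + 1) p)) ∧
        StatusOK E q.1 reg' c (t + 1) p (E.status (t + 1) p))) :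
    ConsensusInv E q reg' (t + 1) c S where
  created := h.created
  descends := h.descends
  unique := h.unique
  destroyed := h.destroyed
  first_created := h.first_created
  first_unique := h.first_unique
  first_destroyed := h.first_destroyed
  written w hw := hreg w (h.written w hw)
  proposed := hprop
  card := h.card
  moved p hp := by
    rcases hst p with h1 | ⟨h1, -⟩
    · rw [h1]; exact h.moved p hp
    · exact h1 (h.moved p hp)
  status p := by
    rcases hst p with h1 | ⟨-, h1⟩
    · rw [h1]; exact (h.status p).mono subset_rfl hreg .refl (Nat.le_succ t)
    · exact h1

theorem consensusInv_succ {E : Execution (tokenConsensus k v₀ x₀)}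
    (hE : ∀ s₁ s₂ p x₁ x₂, E.Invokes s₁ p x₁ → E.Invokes s₂ p x₂ → s₁ = s₂)
    {σ : ℕ → Set (Token (Fin k)) × Set (Token (Fin k))} {ρ : Fin k → ℕ → Option X}
    (hσ : ∀ t p (o : TransferOp (Fin k)) (r : Option (Token (Fin k))),
        E.event t = some (.call p none o r) →
        (anonAT (fun _ : Fin k => (Finset.univ : Finset (Fin k))) v₀).trans p (σ t) o r
          (σ (t + 1)))
    (hσ' : ∀ t, (∀ p o r, E.event t ≠ some (.call p none o r)) → σ (t + 1) = σ t)
    (hρ : ∀ w t p (o : RegisterOp (Option X)) (r : Option (Option X)),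
        E.event t = some (.call p (some w) o r) →
        (register (Fin k) (none : Option X)).trans p (ρ w t) o r (ρ w (t + 1)))
    (hρ' : ∀ w t, (∀ p o r, E.event t ≠ some (.call p (some w) o r)) → ρ w (t + 1) = ρ w t)
    {t c S} (h : ConsensusInv E (σ t) (fun w => ρ w t) t c S) :
    ∃ c' S', ConsensusInv E (σ (t + 1)) (fun w => ρ w (t + 1)) (t + 1) c' S' := by
  have hother : ∀ e, E.event t = some e → ∀ q, q ≠ e.proc → E.status (t + 1) q = E.status t q := by
    intro e he q hq
    refine E.status_of_ne fun e' he' hp => ?_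
    rw [he] at he'
    cases he'
    exact hq hp.symm
  have hprop : ∀ w y, ρ w t = some y → ∃ s < t + 1, E.Invokes s w y := fun w y hw => by
    obtain ⟨s, hs, hi⟩ := h.proposed w y hw
    exact ⟨s, by omega, hi⟩
  -- an event that accesses no object
  have hlocal : (∀ p i o r, E.event t ≠ some (.call p i o r)) →
      (∀ p, E.status (t + 1) p = E.status t p ∨
      ((HasMoved (E.status t p) → HasMoved (E.status (t + 1) p)) ∧
        StatusOK E (σ t).1 (fun w => ρ w t) c (t + 1) p (E.status (t + 1) p))) →
      ∃ c' S', ConsensusInv E (σ (t + 1)) (fun w => ρ w (t + 1)) (t + 1) c' S' := by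
    intro hno hst
    rw [hσ' t fun p => hno p none]
    have : (fun w => ρ w (t + 1)) = fun w => ρ w t := funext fun w => hρ' w t fun p => hno p (some w)
    rw [this]
    exact ⟨c, S, h.succ (fun _ => id) hprop hst⟩
  cases he : E.event t with
  | none =>
    exact hlocal (by simp [he]) fun p => .inl (E.status_of_ne (by simp [he]))
  | some e =>
    have hoth := hother e he
    cases e with
    | inv p x =>
      refine hlocal (by simp [he]) fun q => ?_
      by_cases hq : q = p
      · subst hq
        right
        obtain ⟨l, h1, h2⟩ := E.status_of_inv he
        have h3 := h.status q
        rw [h1] at h3 ⊢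
        rw [h2]
        refine ⟨fun hm => ?_, t, by omega, he⟩
        cases l <;> try exact hm.elim
        obtain ⟨s, hs, x', hi⟩ := h3
        exact absurd (hE s t q x' x hi he) (by omega)
      · exact .inl (hoth q hq)
    | ret p x =>
      refine hlocal (by simp [he]) fun q => ?_
      by_cases hq : q = p
      · subst hq
        right
        obtain ⟨l, l₁, h1, h2, h3⟩ := E.status_of_ret he
        obtain ⟨s, x', hPd⟩ := E.exists_pending_of_busy h1
        have h4 := h.status q
        rw [h1] at h4 ⊢
        rw [h3]
        cases l with
        | ready => exact h4.elim
        | write x => cases h2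
        | search x l =>
          have := h.mem_search h1
          cases l with
          | nil => simp at this
          | cons T l => cases h2
        | read x w => cases h2
        | done y =>
          cases h2
          exact ⟨fun _ => trivial, s, by have := hPd.2.1; omega, x', hPd.1⟩
      · exact .inl (hoth q hq)
    | call p i o r =>
      obtain ⟨l, next, h1, h2, h3⟩ := E.status_of_call he
      have hi : ∀ {p' i' o' r'}, E.event t = some (.call p' i' o' r') → i = i' := by
        intro p' i' o' r' he'
        rw [he] at he'
        cases he'
        rfl
      have h4 := h.status p
      rw [h1] at h4
      cases l with
      | ready => exact h4.elim
      | done y => cases h2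
      | write x =>
        cases h2
        rw [hσ' t fun p' o' r' he' => by cases hi he']
        obtain ⟨-, hw⟩ := hρ p t p _ r he
        have hw' : ∀ w, w ≠ p → ρ w (t + 1) = ρ w t := fun w hwp => hρ' w t fun p' o' r' he' =>
          hwp (Option.some.inj (hi he')).symm
        refine ⟨c, S, h.succ (fun w hwn => ?_) (fun w y hwy => ?_) fun q => ?_⟩
        · by_cases hwp : w = p
          · subst hwp; simp [hw]
          · simpa only [hw' w hwp] using hwn
        · by_cases hwp : w = p
          · subst hwp
            obtain ⟨s, hs, hi⟩ := h4
            rw [hw] at hwy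
            cases hwy
            exact ⟨s, by omega, hi⟩
          · simp only [hw' w hwp] at hwy
            exact hprop w y hwy
        · by_cases hq : q = p
          · subst hq
            right
            rw [h1, h3]
            exact ⟨fun hm => hm.elim, by simp [hw], candidates_sorted,
              fun T hT => (mem_candidates.1 hT).1,
              fun T hT hd => mem_candidates.2 ⟨h.descends.trans hT, hd⟩⟩
          · exact .inl (hoth q hq)
      | read x w =>
        cases h2
        rw [hσ' t fun p' o' r' he' => by cases hi he']
        obtain ⟨hr, hw⟩ := hρ w t p _ r he
        have hw' : (fun w => ρ w (t + 1)) = fun w => ρ w t := by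
          funext w'
          by_cases hww : w' = w
          · subst hww; exact hw
          · exact hρ' w' t fun p' o' r' he' => hww (Option.some.inj (hi he')).symm
        rw [hw']
        refine ⟨c, S, h.succ (fun _ => id) hprop fun q => ?_⟩
        by_cases hq : q = p
        · subst hq
          right
          obtain ⟨y, hy⟩ := Option.ne_none_iff_exists'.1 (h.written w h4)
          obtain ⟨s, hs, hi⟩ := h.proposed w y hy
          change ρ w t = some y at hy
          rw [hy] at hr
          subst hr
          rw [h1, h3]
          exact ⟨fun _ => trivial, w, h4, s, by omega, hi⟩
        · exact .inl (hoth q hq)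
      | search x l =>
        have hmem := h.mem_search h1
        obtain ⟨hreg, hsort, hdesc, hcov⟩ := h4
        cases l with
        | nil => simp at hmem
        | cons T l =>
          cases h2
          have hρe : (fun w => ρ w (t + 1)) = fun w => ρ w t :=
            funext fun w => hρ' w t fun p' o' r' he' => by cases hi he'
          rw [hρe]
          rw [List.pairwise_cons] at hsort
          have htr := hσ t p _ r he
          have hTroot := hdesc T (by simp)
          rcases htr with ⟨⟨-, -, hT1, hT2⟩, rfl, hq⟩ | ⟨hinv, rfl, hq⟩
          · -- the process transfers the last descendant of the root
            obtain rfl := h.unique T hT1 hT2 hTroot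
            have hpS : p ∉ S := fun hpS => by
              have := h.moved p hpS
              rw [h1] at this
              exact this
            have hfirst : .out (rootToken k) (T.firstRecipient p) ∈ (σ (t + 1)).1 := by
              rw [hq]
              by_cases hTr : T = rootToken k
              · rw [hTr]; exact Set.mem_insert _ _
              · exact Set.mem_insert_of_mem _ (h.first_created hTr p)
            have hsub : (σ t).1 ⊆ (σ (t + 1)).1 := by
              rw [hq]; exact Set.subset_insert _ _
            have hfd : ∀ w, .out (rootToken k) w ∈ (σ (t + 1)).1 →
                .out (rootToken k) w ∈ (σ t).1 ∨ (T = rootToken k ∧ w = p) := by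
              intro w hw
              rw [hq] at hw
              rcases hw with hw | hw
              · injection hw with h5 h6
                exact .inr ⟨h5.symm, h6⟩
              · exact .inl hw
            have hnr : T = rootToken k → ∀ w, .out (rootToken k) w ∉ (σ t).1 :=
              fun h5 w hw => hT2 (h5 ▸ h.first_destroyed w hw)
            refine ⟨.out T p, insert p S, ?_⟩
            exact
              { created := by rw [hq]; exact Set.mem_insert _ _
                descends := h.descends.out p
                unique := by
                  rw [hq]
                  rintro T' (rfl | h5) h6 h7
                  · rfl
                  · rw [Set.mem_insert_iff, not_or] at h6
                    exact absurd (h.unique T' h5 h6.2 h7) h6.1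
                destroyed := by
                  rw [hq]
                  rintro T' (rfl | h5) h6
                  · exact Nat.lt_succ_self _
                  · exact Nat.lt_succ_of_lt (h.destroyed T' h5 h6)
                first_created := fun _ _ => hfirst
                first_unique := by
                  intro w w' hw hw'
                  rcases hfd w hw with h5 | ⟨h5, rfl⟩ <;> rcases hfd w' hw' with h6 | ⟨h6, rfl⟩
                  · exact h.first_unique w w' h5 h6
                  · exact absurd h5 (hnr h6 w)
                  · exact absurd h6 (hnr h5 w')
                  · rfl
                first_destroyed := by
                  intro w hw
                  rw [hq]
                  rcases hfd w hw with h5 | ⟨h5, rfl⟩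
                  · exact Set.mem_insert_of_mem _ (h.first_destroyed w h5)
                  · rw [← h5]; exact Set.mem_insert _ _
                written := by
                  intro w hw
                  rcases hfd w hw with h5 | ⟨-, rfl⟩
                  · exact h.written w h5
                  · exact hreg
                proposed := hprop
                card := by rw [Finset.card_insert_of_notMem hpS, h.card]; rfl
                moved := by
                  intro q hqS
                  by_cases hqp : q = p
                  · subst hqp; rw [h3]; trivial
                  · rw [hoth q hqp]
                    exact h.moved q (Finset.mem_of_mem_insert_of_ne hqS hqp)
                status := by
                  intro q
                  by_cases hqp : q = p
                  · subst hqp; rw [h3]; exact hfirst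
                  · rw [hoth q hqp]
                    exact (h.status q).mono hsub (fun _ => id) (Token.Descends.refl.out p)
                      (Nat.le_succ t) }
          · -- the transfer fails, so that the token is not the last descendant of the root
            rw [hq]
            have hTc : T ≠ c := by
              rintro rfl
              refine hinv ⟨Finset.mem_univ _, rfl, h.created, fun h5 => ?_⟩
              exact lt_irrefl _ (h.destroyed T h5 hTroot)
            have hcl : c ∈ l := (List.mem_cons.1 hmem).resolve_left (Ne.symm hTc)
            refine ⟨c, S, h.succ (fun _ => id) hprop fun q => ?_⟩
            by_cases hqp : q = p
            · subst hqp
              right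
              rw [h1, h3]
              refine ⟨fun hm => hm.elim, hreg, hsort.2,
                fun T' hT' => hdesc T' (List.mem_cons_of_mem _ hT'), fun T' hT' hd => ?_⟩
              refine (List.mem_cons.1 (hcov T' hT' hd)).resolve_left fun h5 => ?_
              subst h5
              rcases hT'.eq_or_depth_lt with h6 | h6
              · exact hTc h6.symm
              · exact absurd (hsort.1 c hcl) (by omega)
            · exact .inl (hoth q hqp)

/-- An upper bound for the number of accesses to objects before the return. -/
def ConsensusLine.rank : ConsensusLine k X → ℕ
  | .ready => 0
  | .write _ => (candidates k).length + 2
  | .search _ l => l.length + 1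
  | .read _ _ => 1
  | .done _ => 0

theorem tokenConsensus_rank {p : Fin k} {l : ConsensusLine k X} {i op next}
    (h : (tokenConsensus k v₀ x₀).instr p l = .call i op next) (r) :
    (next r : ConsensusLine k X).rank < l.rank := by
  cases l with
  | ready => cases h
  | write x => cases h; exact Nat.lt_succ_self _
  | search x l =>
    cases l with
    | nil => cases h
    | cons T l => cases h; cases r <;> simp [ConsensusLine.rank]
  | read x w =>
    cases h
    rcases r with _ | _ | y <;> simp [ConsensusLine.rank]
  | done x => cases h

theorem tokenConsensus_solvesConsensus (hv₀ : 1 ≤ v₀) :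
    (tokenConsensus k v₀ x₀).SolvesConsensus := by
  intro E hE
  obtain ⟨σ, h0, hσ, hσ'⟩ := anonAT_states E
  choose ρ hρ0 hρ hρ' using register_states E
  have hinv : ∀ t, ∃ c S, ConsensusInv E (σ t) (fun w => ρ w t) t c S := by
    intro t
    induction t with
    | zero =>
      rw [h0, show (fun w => ρ w 0) = fun _ => none from funext hρ0]
      exact ⟨_, _, consensusInv_zero hv₀ E⟩
    | succ t ih =>
      obtain ⟨c, S, h⟩ := ih
      exact consensusInv_succ hE hσ hσ' hρ hρ' h
  have hmono : Monotone fun t => (σ t).1 := by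
    refine monotone_nat_of_le_succ fun t => ?_
    by_cases he : ∃ p o r, E.event t = some (.call p none o r)
    · obtain ⟨p, o, r, he⟩ := he
      rcases hσ t p o r he with ⟨-, -, h⟩ | ⟨-, -, h⟩
      · rw [h]; exact Set.subset_insert _ _
      · rw [h]
    · push Not at he
      exact (congrArg Prod.fst (hσ' t he)).ge
  have hret : ∀ t p x, E.event t = some (.ret p x) →
      ∃ w, .out (rootToken k) w ∈ (σ t).1 ∧ ∃ s < t, E.Invokes s w x := by
    intro t p x he
    obtain ⟨l, l₁, h1, h2, -⟩ := E.status_of_ret he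
    obtain ⟨c, S, h⟩ := hinv t
    have h4 := h.status p
    rw [h1] at h4
    cases l with
    | ready => exact h4.elim
    | write x => cases h2
    | search x l =>
      have := h.mem_search h1
      cases l with
      | nil => simp at this
      | cons T l => cases h2
    | read x w => cases h2
    | done y => cases h2; exact h4
  refine ⟨fun s p o hi hinf => ?_, fun t₁ t₂ p₁ p₂ x₁ x₂ h1 h2 => ?_, fun t p x h => ?_⟩
  · refine E.exists_returns_of_rank hi hinf ConsensusLine.rank ?_ fun n => ⟨0, ?_⟩
    · exact fun t l i op next r _ _ h2 _ => (tokenConsensus_rank h2 r).le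
    · exact fun t _ l i op next r _ _ h2 _ hn => hn ▸ tokenConsensus_rank h2 r
  · obtain ⟨w₁, h3, s₁, -, h4⟩ := hret t₁ p₁ x₁ h1
    obtain ⟨w₂, h5, s₂, -, h6⟩ := hret t₂ p₂ x₂ h2
    obtain ⟨c, S, h⟩ := hinv (max t₁ t₂)
    obtain rfl := h.first_unique w₁ w₂ (hmono (le_max_left _ _) h3) (hmono (le_max_right _ _) h5)
    obtain rfl := hE s₁ s₂ w₁ x₁ x₂ h4 h6
    exact (h4.unique h6).2
  · obtain ⟨w, -, s, hs, hi⟩ := hret t p x h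
    exact ⟨s, hs, w, hi⟩

theorem consensusSolvable (X : Type) [Nonempty X] (hv₀ : 1 ≤ v₀) :
    ConsensusSolvable X k (IsKAnonAT k v₀) := by
  obtain ⟨x₀⟩ := ‹Nonempty X›
  refine ⟨_, consensusObj k v₀ X, tokenConsensus k v₀ x₀, fun i => ?_,
    tokenConsensus_solvesConsensus hv₀⟩
  cases i with
  | none => exact .inr ⟨Fin k, inferInstance, _, fun w => by simp, ⟨0, by simp⟩, rfl⟩
  | some w => exact .inl ⟨_, _, rfl⟩

end LowerBound

end AAT

theorem mainTheorem7 (k v₀ : ℕ) (hk : 1 ≤ k) (hv₀ : 1 ≤ v₀) :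
    (∀ (Proc W : Type) [Fintype Proc] [DecidableEq Proc] (P : AAT.Params Proc W),
      P.Admissible k → P.v₀ = v₀ →
      ∀ E : AAT.Execution (AAT.transferAlgorithm P), AAT.Authorized E →
        E.WaitFree ∧
        AAT.TransferValidity E ∧
        (AAT.NoSpendingInFlight E →
          AAT.Execution.Linearizable (AAT.anonAT P.μ v₀).toSpec E) ∧
        AAT.Anonymous E) ∧
    (∀ (X : Type) [Nontrivial X],
      IsGreatest {n | AAT.ConsensusSolvable X n (AAT.IsKAnonAT k v₀)} k) := by
  refine ⟨?_, fun X _ => ⟨?_, fun n hn => ?_⟩⟩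
  · rintro Proc W _ _ P hP rfl E hA
    exact ⟨AAT.waitFree hP hA, AAT.transferValidity hP hA, AAT.linearizable hP hA,
      AAT.anonymous hP hA⟩
  · have : NeZero k := ⟨by omega⟩
    exact AAT.consensusSolvable X hv₀
  · by_contra hlt
    exact AAT.not_consensusSolvable hk (not_le.1 hlt) hn
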